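/- Fix $d\ge 0$, $\lambda>0$, $\eta>0$, $\alpha>0$. Let $\mathcal P$ be the set of probability densities $q$ on $\mathbb R^d$ (with respect to Lebesgue measure) with finite second moment and finite entropy, i.e. $\int\|\theta\|_2^2\,q(\theta)\,d\theta<\infty$ and $\int |q\log q|\,d\theta<\infty$. Let $F:\mathcal P\to\mathbb R$ have a functional derivative $\frac{\delta F}{\delta q}:\mathcal P\times\mathbb R^d\to\mathbb R$, that is, for all $q,q'\in\mathcal P$, $$\frac{d}{d\epsilon}F(q+\epsilon(q'-q))\Big|_{\epsilon=0^+}=\int\frac{\delta F}{\delta q}(q)(\theta)\,(q'-q)(\theta)\,d\theta .$$ Put $\mathcal L(q)=F(q)+\lambda\int q\log q\,d\theta$ and $p_q(\theta)=Z(q)^{-1}\exp\!\big(-\tfrac1\lambda\frac{\delta F}{\delta q}(q)(\theta)\big)$, $Z(q)=\int\exp\!\big(-\tfrac1\lambda\frac{\delta F}{\delta q}(q)(\theta)\big)d\theta$. Assume: 1. (Potential) For every $q\in\mathcal P$ the function $\theta\mapsto\frac{\delta F}{\delta q}(q)(\theta)$ is $C^\infty$, $Z(q)<\infty$, and its gradient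 grows at most linearly: there is a constant $C_q$ with $\|\nabla\frac{\delta F}{\delta q}(q)(\theta)\|_2\le C_q(1+\|\theta\|_2)$ for all $\theta$. There is a constant $C$ with $|\frac{\delta F}{\delta q}(q)(\theta)|\le C(1+\|\theta\|_2^2)$ for all $q\in\mathcal P$ and $\theta\in\mathbb R^d$. $F$ is convex: $F(q')\ge F(q)+\int\frac{\delta F}{\delta q}(q)(\theta)\,(q'-q)(\theta)\,d\theta$ for all $q,q'\in\mathcal P$. 2. (Log-Sobolev inequality) For every $q\in\mathcal P$ and every $C^\infty$ function $g:\mathbb R^d\to\mathbb R$ for which the expectations below are finite, $$\mathbb E_{p_q}[g^2\log g^2]-\mathbb E_{p_q}[g^2]\log\mathbb E_{p_q}[g^2]\le\frac2\alpha\,\mathbb E_{p_q}\big[\|\nabla g\|_2^2\big].$$ Let $q_*\in\mathcal P$ be a minimizer of $\mathcal L$ over $\mathcal P$. Let $\theta^{(0)}$ be a random vector with density $q^{(0)}\in\mathcal P$ and let $$\theta^{(k+1)}=\theta^{(k)}-\eta\nabla\frac{\delta F}{\delta q}(q^{(k)})(\theta^{(k)})+\sqrt{2\lambda\eta}\,\xi^{(k)},\qquad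 k=0,1,2,\dots,$$ where $q^{(k)}$ is the density of $\theta^{(k)}$ and $\xi^{(k)}\sim\mathcal N(0,I_d)$ is independent of $\theta^{(k)}$. For $0<t\le\eta$ let $\theta^{(k+1)}_t=\theta^{(k)}-t\nabla\frac{\delta F}{\delta q}(q^{(k)})(\theta^{(k)})+\sqrt{2\lambda t}\,\xi^{(k)}$, let $q^{(k+1)}_t$ be its density, and let $$\delta_{q^{(k)},t}=\mathbb E\Big\|\nabla\frac{\delta F}{\delta q}(q^{(k)})(\theta^{(k)})-\nabla\frac{\delta F}{\delta q}(q^{(k+1)}_t)(\theta^{(k+1)}_t)\Big\|_2^2 .$$ Suppose that there is a constant $\delta_\eta$ such that $\delta_{q^{(k)},t}\le\delta_\eta$ for all $0<t\le\eta$ and all integers $k\ge0$. Then, for every integer $k\ge 0$, $q^{(k)}\in\mathcal P$ and $$\mathcal L(q^{(k)})-\mathcal L(q_*)\le\frac{\delta_\eta}{2\alpha\lambda}+e^{-\alpha\lambda\eta k}\big(\mathcal L(q^{(0)})-\mathcal L(q_*)\big).$$ -/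

import Mathlib

open MeasureTheory ProbabilityTheory
open scoped ContDiff Gradient

namespace MeanFieldLangevin

/-- The class `𝒫` of probability density functions on `ℝ^d` (with respect to Lebesgue measure)
with finite second moment and finite entropy. -/
def densities (d : ℕ) : Set (EuclideanSpace ℝ (Fin d) → ℝ) :=
  {q | Measurable q ∧ (∀ x, 0 ≤ q x) ∧ Integrable q ∧ ∫ x, q x = 1 ∧
    Integrable (fun x => ‖x‖ ^ 2 * q x) ∧ Integrable (fun x => q x * Real.log (q x))}

/-- `dF` is a functional derivative of `F` on `𝒫`: at every `q ∈ 𝒫` the derivative of `F` along the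
segment from `q` to any `q' ∈ 𝒫` is given by integration of `dF q` against `q' - q`.
The derivative is one-sided, because `q + ε (q' - q)` is a density only for `ε ∈ [0, 1]`. -/
def IsFunctionalDerivative {d : ℕ} (F : (EuclideanSpace ℝ (Fin d) → ℝ) → ℝ)
    (dF : (EuclideanSpace ℝ (Fin d) → ℝ) → EuclideanSpace ℝ (Fin d) → ℝ) : Prop :=
  ∀ q ∈ densities d, ∀ q' ∈ densities d,
    HasDerivWithinAt (fun ε : ℝ => F (q + ε • (q' - q)))
      (∫ x, dF q x * (q' x - q x)) (Set.Icc 0 1) 0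

/-- The unnormalized Gibbs weight `exp (- λ⁻¹ (δF/δq)(q))`. -/
noncomputable def gibbsWeight {d : ℕ}
    (dF : (EuclideanSpace ℝ (Fin d) → ℝ) → EuclideanSpace ℝ (Fin d) → ℝ) (lam : ℝ)
    (q : EuclideanSpace ℝ (Fin d) → ℝ) (x : EuclideanSpace ℝ (Fin d)) : ℝ :=
  Real.exp (-(1 / lam) * dF q x)

/-- The proximal Gibbs density `p_q = exp (- λ⁻¹ (δF/δq)(q)) / Z(q)`. -/
noncomputable def proximalGibbs {d : ℕ}
    (dF : (EuclideanSpace ℝ (Fin d) → ℝ) → EuclideanSpace ℝ (Fin d) → ℝ) (lam : ℝ)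
    (q : EuclideanSpace ℝ (Fin d) → ℝ) (x : EuclideanSpace ℝ (Fin d)) : ℝ :=
  gibbsWeight dF lam q x / ∫ y, gibbsWeight dF lam q y

/-- Standing assumption on the potential: the functional derivative exists, is smooth in the space
variable, the proximal Gibbs distributions are normalizable, the functional derivative grows at most
quadratically, uniformly over `𝒫`, and `F` is convex. -/
structure PotentialAssumption {d : ℕ} (F : (EuclideanSpace ℝ (Fin d) → ℝ) → ℝ)
    (dF : (EuclideanSpace ℝ (Fin d) → ℝ) → EuclideanSpace ℝ (Fin d) → ℝ) (lam : ℝ) : Prop where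
  isFunctionalDerivative : IsFunctionalDerivative F dF
  smooth : ∀ q ∈ densities d, ContDiff ℝ ∞ (dF q)
  normalizable : ∀ q ∈ densities d, Integrable (gibbsWeight dF lam q)
  growth : ∃ C : ℝ, ∀ q ∈ densities d, ∀ x, |dF q x| ≤ C * (1 + ‖x‖ ^ 2)
  convex : ∀ q ∈ densities d, ∀ q' ∈ densities d,
    F q + ∫ x, dF q x * (q' x - q x) ≤ F q'

/-- The log-Sobolev inequality with constant `α` for the probability density `p`, for all smooth
test functions for which the three expectations that occur in it are finite. -/
def LogSobolev {d : ℕ} (p : EuclideanSpace ℝ (Fin d) → ℝ) (α : ℝ) : Prop :=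
  ∀ g : EuclideanSpace ℝ (Fin d) → ℝ, ContDiff ℝ ∞ g →
    Integrable (fun x => g x ^ 2 * p x) →
    Integrable (fun x => g x ^ 2 * Real.log (g x ^ 2) * p x) →
    Integrable (fun x => ‖∇ g x‖ ^ 2 * p x) →
    (∫ x, g x ^ 2 * Real.log (g x ^ 2) * p x)
        - (∫ x, g x ^ 2 * p x) * Real.log (∫ x, g x ^ 2 * p x)
      ≤ 2 / α * ∫ x, ‖∇ g x‖ ^ 2 * p x

/-- The entropy-regularized objective `ℒ(q) = F(q) + λ E_q[log q]`. -/
noncomputable def objective {d : ℕ} (F : (EuclideanSpace ℝ (Fin d) → ℝ) → ℝ) (lam : ℝ)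
    (q : EuclideanSpace ℝ (Fin d) → ℝ) : ℝ :=
  F q + lam * ∫ x, q x * Real.log (q x)

/-- The (real-valued) probability density function of a random vector. -/
noncomputable def density {d : ℕ} {Ω : Type*} [MeasurableSpace Ω] (P : Measure Ω)
    (X : Ω → EuclideanSpace ℝ (Fin d)) (x : EuclideanSpace ℝ (Fin d)) : ℝ :=
  (pdf X P volume x).toReal

/-- One step of noisy gradient descent of size `t`, from the random vector `X` with noise `ξ`:
`X - t ∇ (δF/δq)(q) (X) + √(2 λ t) ξ`, where `q` is the density of `X`. -/
noncomputable def noisyStep {d : ℕ} {Ω : Type*} [MeasurableSpace Ω] (P : Measure Ω)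
    (dF : (EuclideanSpace ℝ (Fin d) → ℝ) → EuclideanSpace ℝ (Fin d) → ℝ) (lam t : ℝ)
    (X ξ : Ω → EuclideanSpace ℝ (Fin d)) (w : Ω) : EuclideanSpace ℝ (Fin d) :=
  X w - t • ∇ (dF (density P X)) (X w) + √(2 * lam * t) • ξ w

/-- The one-step discretization error
`E ‖∇ (δF/δq)(q) (X) - ∇ (δF/δq)(q_t) (X_t)‖²`, where `X_t` is the noisy gradient step of size `t`
from `X` with noise `ξ`, and `q`, `q_t` are the densities of `X`, `X_t`. -/
noncomputable def discretizationError {d : ℕ} {Ω : Type*} [MeasurableSpace Ω] (P : Measure Ω)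
    (dF : (EuclideanSpace ℝ (Fin d) → ℝ) → EuclideanSpace ℝ (Fin d) → ℝ) (lam t : ℝ)
    (X ξ : Ω → EuclideanSpace ℝ (Fin d)) : ℝ :=
  ∫ w, ‖∇ (dF (density P X)) (X w)
    - ∇ (dF (density P (noisyStep P dF lam t X ξ))) (noisyStep P dF lam t X ξ w)‖ ^ 2 ∂P

end MeanFieldLangevin

/-!
A noisy gradient step of size `η` from `X` with density `q` is interpolated by
`X_t = X - t ∇(dF q)(X) + √(2 λ t) ξ`, `0 ≤ t ≤ η`, with density `q_t`. Put
`G_t = dF q_t + λ log q_t`, the functional derivative of the objective at `q_t`. Formally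

  `d/dt ℒ(q_t) = E⟨∇G_t(X_t), -∇(dF q)(X) - λ ∇log q_t(X_t)⟩`
  `≤ -½ E‖∇G_t(X_t)‖² + ½ E‖∇(dF q)(X) - ∇(dF q_t)(X_t)‖²`,

and the log-Sobolev inequality, tested with `√(q_t / p_{q_t})`, together with convexity gives
`ℒ(q_t) - ℒ(q_*) ≤ E‖∇G_t(X_t)‖² / (2 α λ)`. Grönwall's inequality on `[0, η]` yields
`ℒ(q_η) - c ≤ e^{-αλη} (ℒ(q_0) - c)` with `c = ℒ(q_*) + δ_η / (2 α λ)`, and iteration the theorem.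

Nothing is known about the regularity of `t ↦ F(q_t)`, so this is not differentiated. Convexity of
`F` and of the entropy gives instead, for `s < t`,

  `ℒ(q_t) - ℒ(q_s) ≤ ∫ G_t (q_t - q_s) = E G_t(X_t) - E G_t(X_s)` (`objective_sub_le`),

where `G_t` is a *fixed* smooth function, so `s ↦ E G_t(X_s)` can be differentiated under the
expectation (`hasDerivAt_integral_noisyMap`), and Gaussian integration by parts
(`integral_inner_noise`) brings in `∇log q_t` (`integral_inner_gradient_le`). A bound on the left
increments suffices for Grönwall's inequality if the objective is upper semicontinuous from the
right (`gronwall_of_left_increment`). At positive times this follows from the continuity of `q_t`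
in the `L¹` space with weight `1 + ‖x‖²` (`tendsto_integral_weight_abs_sub`) and the locally uniform
quadratic growth of `log q_t`. At time zero `log q_t` is not controlled: there `F` is handled by
`tendsto_integral_weight_abs_sub_zero` and the entropy by `eventually_entropy_stepDensity_le`, which
rests on the fact that the transition kernel has mass close to one also in the initial point.

The growth conditions that make all expectations finite hold since `q_t` is, for `t > 0`, a Gaussian
smoothing of a probability measure: it is smooth and positive, its logarithm grows at most
quadratically and its score at most linearly (`norm_integral_gaussianDensity_smul_le`).
-/

open Filter
open scoped Topology

set_option linter.unusedSectionVars false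

namespace MeanFieldLangevin

/-! ### Isotropic Gaussian densities -/

section Gaussian

variable {V : Type*} [NormedAddCommGroup V] [InnerProductSpace ℝ V]

/-- The density of the centred isotropic Gaussian distribution with covariance `v • 1`. -/
noncomputable def gaussianDensity (v : ℝ) (z : V) : ℝ :=
  ((2 * Real.pi * v) ^ (Module.finrank ℝ V / 2 : ℝ))⁻¹ * Real.exp (-‖z‖ ^ 2 / (2 * v))

/-- The maximum of `gaussianDensity v`. -/
noncomputable def gaussianConst (V : Type*) [NormedAddCommGroup V] [InnerProductSpace ℝ V]
    (v : ℝ) : ℝ :=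
  ((2 * Real.pi * v) ^ (Module.finrank ℝ V / 2 : ℝ))⁻¹

lemma gaussianDensity_eq (v : ℝ) (z : V) :
    gaussianDensity v z = gaussianConst V v * Real.exp (-‖z‖ ^ 2 / (2 * v)) := rfl

lemma gaussianConst_pos {v : ℝ} (hv : 0 < v) : 0 < gaussianConst V v := by
  unfold gaussianConst; positivity

lemma gaussianDensity_pos {v : ℝ} (hv : 0 < v) (z : V) : 0 < gaussianDensity v z :=
  mul_pos (gaussianConst_pos hv) (Real.exp_pos _)

lemma gaussianDensity_le {v : ℝ} (hv : 0 < v) (z : V) :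
    gaussianDensity v z ≤ gaussianConst V v := by
  rw [gaussianDensity_eq]
  refine mul_le_of_le_one_right (gaussianConst_pos hv).le (Real.exp_le_one_iff.2 ?_)
  rw [neg_div]
  exact neg_nonpos.2 (by positivity)

lemma contDiff_gaussianDensity (v : ℝ) : ContDiff ℝ ∞ (gaussianDensity v : V → ℝ) := by
  unfold gaussianDensity
  exact contDiff_const.mul (Real.contDiff_exp.comp
    (((contDiff_norm_sq ℝ).neg).div_const _))

lemma continuous_gaussianDensity (v : ℝ) : Continuous (gaussianDensity v : V → ℝ) :=
  (contDiff_gaussianDensity v).continuous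

lemma gaussianDensity_neg (v : ℝ) (z : V) : gaussianDensity v (-z) = gaussianDensity v z := by
  simp [gaussianDensity]

/-- The Peter-Paul inequality, as a lower bound for the norm of a perturbed vector. -/
lemma sub_div_le_norm_add_sq {ε : ℝ} (hε : 0 < ε) (a c : V) :
    (1 - ε) * ‖a‖ ^ 2 - ‖c‖ ^ 2 / ε ≤ ‖a + c‖ ^ 2 := by
  have h2 := norm_add_sq_real a c
  have h3 : 0 ≤ ‖ε • a + c‖ ^ 2 := by positivity
  rw [norm_add_sq_real, norm_smul, real_inner_smul_left, Real.norm_of_nonneg hε.le] at h3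
  have h4 : -(ε * ‖a‖ ^ 2) - ‖c‖ ^ 2 / ε ≤ 2 * inner ℝ a c := by
    rw [← sub_nonneg]
    have : 2 * inner ℝ a c - (-(ε * ‖a‖ ^ 2) - ‖c‖ ^ 2 / ε) =
        ((ε * ‖a‖) ^ 2 + 2 * (ε * inner ℝ a c) + ‖c‖ ^ 2) / ε := by
      field_simp; ring
    rw [this]; positivity
  have h5 : 0 ≤ ‖c‖ ^ 2 := by positivity
  nlinarith

/-- Comparison of a Gaussian density at `z` with a wider one at `a`. -/
lemma gaussianDensity_le_of_le {v ρ B : ℝ} (hv : 0 < v) (hρ : 0 < ρ) {z a : V}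
    (h : ρ * ‖a‖ ^ 2 - B ≤ ‖z‖ ^ 2) :
    gaussianDensity v z ≤
      (ρ ^ (Module.finrank ℝ V / 2 : ℝ))⁻¹ * Real.exp (B / (2 * v))
        * gaussianDensity (v / ρ) a := by
  rw [gaussianDensity, gaussianDensity]
  have e : (2 * Real.pi * (v / ρ)) ^ (Module.finrank ℝ V / 2 : ℝ) =
      (2 * Real.pi * v) ^ (Module.finrank ℝ V / 2 : ℝ) / ρ ^ (Module.finrank ℝ V / 2 : ℝ) := by
    rw [← Real.div_rpow (by positivity) hρ.le]; congr 1; ring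
  rw [e, inv_div]
  have hp := Real.rpow_pos_of_pos hρ (Module.finrank ℝ V / 2 : ℝ)
  have : (ρ ^ (Module.finrank ℝ V / 2 : ℝ))⁻¹ * Real.exp (B / (2 * v)) *
      (ρ ^ (Module.finrank ℝ V / 2 : ℝ) / (2 * Real.pi * v) ^ (Module.finrank ℝ V / 2 : ℝ) *
        Real.exp (-‖a‖ ^ 2 / (2 * (v / ρ)))) =
      ((2 * Real.pi * v) ^ (Module.finrank ℝ V / 2 : ℝ))⁻¹ *
        Real.exp (B / (2 * v) + -‖a‖ ^ 2 / (2 * (v / ρ))) := by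
    rw [Real.exp_add]; field_simp
  rw [this]
  refine mul_le_mul_of_nonneg_left (Real.exp_le_exp.2 ?_) (by positivity)
  have : B / (2 * v) + -‖a‖ ^ 2 / (2 * (v / ρ)) = (B - ρ * ‖a‖ ^ 2) / (2 * v) := by
    field_simp; ring
  rw [this]
  gcongr
  linarith

/-- Comparison of a shifted Gaussian with a wider centred one. -/
lemma gaussianDensity_add_le {v ε : ℝ} (hv : 0 < v) (hε : 0 < ε) (hε1 : ε < 1) (a c : V) :
    gaussianDensity v (a + c) ≤
      ((1 - ε) ^ (Module.finrank ℝ V / 2 : ℝ))⁻¹ * Real.exp (‖c‖ ^ 2 / ε / (2 * v))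
        * gaussianDensity (v / (1 - ε)) a :=
  gaussianDensity_le_of_le hv (by linarith) (sub_div_le_norm_add_sq hε a c)

variable [FiniteDimensional ℝ V] [MeasurableSpace V] [BorelSpace V]

lemma integral_gaussianDensity {v : ℝ} (hv : 0 < v) :
    ∫ z : V, gaussianDensity v z = 1 := by
  simp_rw [gaussianDensity_eq]
  rw [integral_const_mul]
  have h := GaussianFourier.integral_rexp_neg_mul_sq_norm (V := V) (b := 1 / (2 * v))
    (by positivity)
  have e : ∀ z : V, -(1 / (2 * v)) * ‖z‖ ^ 2 = -‖z‖ ^ 2 / (2 * v) := fun z => by ring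
  simp_rw [e] at h
  rw [h, gaussianConst, show Real.pi / (1 / (2 * v)) = 2 * Real.pi * v by field_simp]
  exact inv_mul_cancel₀ (by positivity)

lemma integrable_gaussianDensity {v : ℝ} (hv : 0 < v) :
    Integrable (gaussianDensity v : V → ℝ) := by
  by_contra h
  have := integral_gaussianDensity (V := V) hv
  rw [integral_undef h] at this
  exact zero_ne_one this

lemma isProbabilityMeasure_gaussianDensity {v : ℝ} (hv : 0 < v) :
    IsProbabilityMeasure
      ((volume : Measure V).withDensity fun z => ENNReal.ofReal (gaussianDensity v z)) := by
  constructor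
  rw [withDensity_apply _ MeasurableSet.univ, Measure.restrict_univ,
    ← ofReal_integral_eq_lintegral_ofReal (integrable_gaussianDensity hv)
      (ae_of_all _ fun z => (gaussianDensity_pos hv z).le), integral_gaussianDensity hv]
  simp

/-- `√v ξ` has density `gaussianDensity v` when `ξ` is standard Gaussian: the characteristic
functions agree. -/
lemma map_sqrt_smul_stdGaussian {v : ℝ} (hv : 0 < v) :
    (stdGaussian V).map (fun z => √v • z) =
      (volume : Measure V).withDensity fun z => ENNReal.ofReal (gaussianDensity v z) := by
  have : IsProbabilityMeasure ((stdGaussian V).map (fun z => √v • z)) :=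
    Measure.isProbabilityMeasure_map (by fun_prop)
  have := isProbabilityMeasure_gaussianDensity (V := V) hv
  apply Measure.ext_of_charFun
  ext t
  have hc := continuous_gaussianDensity (V := V) v
  rw [charFun_map_smul, charFun_stdGaussian, charFun_apply,
    integral_withDensity_eq_integral_toReal_smul (by fun_prop) (by simp)]
  have hb : 0 < ((1 / (2 * v) : ℝ) : ℂ).re := by
    rw [Complex.ofReal_re]; positivity
  have h := GaussianFourier.integral_cexp_neg_mul_sq_norm_add (V := V) hb Complex.I t
  have e : ∀ z : V, (ENNReal.ofReal (gaussianDensity v z)).toReal •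
      Complex.exp (inner ℝ z t * Complex.I) = (gaussianConst V v : ℂ) *
        Complex.exp (-((1 / (2 * v) : ℝ) : ℂ) * ‖z‖ ^ 2 + Complex.I * inner ℝ t z) := by
    intro z
    rw [ENNReal.toReal_ofReal (gaussianDensity_pos hv z).le, gaussianDensity_eq,
      Complex.real_smul, real_inner_comm, Complex.exp_add]
    push_cast
    rw [show Complex.I * (inner ℝ t z : ℂ) = (inner ℝ t z : ℂ) * Complex.I by ring, mul_assoc]
    congr 3
    ring
  simp_rw [e]
  rw [integral_const_mul, h, gaussianConst, norm_smul, Real.norm_of_nonneg (Real.sqrt_nonneg v)]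
  have hpi : (Real.pi : ℂ) / ((1 / (2 * v) : ℝ) : ℂ) = ((2 * Real.pi * v : ℝ) : ℂ) := by
    have : (v : ℂ) ≠ 0 := by exact_mod_cast hv.ne'
    push_cast
    field_simp
  rw [hpi, show ((Module.finrank ℝ V : ℂ) / 2) = ((Module.finrank ℝ V / 2 : ℝ) : ℂ) by
    push_cast; ring, ← Complex.ofReal_cpow (by positivity), ← mul_assoc, ← Complex.ofReal_mul,
    inv_mul_cancel₀ (by positivity), Complex.ofReal_one, one_mul]
  congr 1
  have hv' : (v : ℂ) ≠ 0 := by exact_mod_cast hv.ne'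
  push_cast
  rw [mul_pow, ← Complex.ofReal_pow (√v), Real.sq_sqrt hv.le, Complex.I_sq]
  field_simp
  norm_num

lemma integrable_norm_sq_stdGaussian : Integrable (fun z : V => ‖z‖ ^ 2) (stdGaussian V) :=
  IsGaussian.memLp_two_id.integrable_norm_pow (by norm_num)

end Gaussian

/-! ### Gaussian smoothing of a measure -/

section Smoothing

variable {V : Type*} [NormedAddCommGroup V] [InnerProductSpace ℝ V] [FiniteDimensional ℝ V]
  [MeasurableSpace V] [BorelSpace V]

/-- The density of `m Y + √v ξ`, where `Y` has law `μ` and `ξ` is an independent standard Gaussian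
vector. -/
noncomputable def smoothing (μ : Measure V) (m : V → V) (v : ℝ) (x : V) : ℝ :=
  ∫ y, gaussianDensity v (x - m y) ∂μ

/-- The joint law of `Y` and `m Y + √v ξ`. -/
lemma map_prodMk_add_sqrt_smul (μ : Measure V) [IsFiniteMeasure μ] {m : V → V}
    (hm : Measurable m) {v : ℝ} (hv : 0 < v) :
    (μ.prod (stdGaussian V)).map (fun p => (p.1, m p.1 + √v • p.2)) =
      (μ.prod volume).withDensity
        fun p => ENNReal.ofReal (gaussianDensity v (p.2 - m p.1)) := by
  have hk : Measurable fun z : V => ENNReal.ofReal (gaussianDensity v z) :=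
    (continuous_gaussianDensity v).measurable.ennreal_ofReal
  have hk2 : Measurable fun p : V × V => ENNReal.ofReal (gaussianDensity v (p.2 - m p.1)) :=
    hk.comp (measurable_snd.sub (hm.comp measurable_fst))
  refine Measure.ext_of_lintegral _ fun f hf => ?_
  rw [lintegral_map hf (by fun_prop), lintegral_prod _ (by fun_prop),
    lintegral_withDensity_eq_lintegral_mul _ hk2 hf,
    lintegral_prod _ (hk2.mul hf).aemeasurable]
  refine lintegral_congr fun y => ?_
  have h1 : ∫⁻ z, f (y, m y + √v • z) ∂(stdGaussian V) =
      ∫⁻ w, f (y, m y + w) ∂((stdGaussian V).map (fun z => √v • z)) := by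
    rw [lintegral_map (by fun_prop) (by fun_prop)]
  simp only [Pi.mul_apply]
  rw [h1, map_sqrt_smul_stdGaussian hv,
    lintegral_withDensity_eq_lintegral_mul _ hk (by fun_prop),
    ← lintegral_sub_right_eq_self _ (m y)]
  simp

variable {μ : Measure V} [IsFiniteMeasure μ] {m : V → V} {v : ℝ}

lemma measurable_gaussianDensity_sub (hm : Measurable m) :
    Measurable fun p : V × V => gaussianDensity v (p.2 - m p.1) :=
  (continuous_gaussianDensity v).measurable.comp (measurable_snd.sub (hm.comp measurable_fst))

lemma integrable_kernel_iff (hm : Measurable m) (hv : 0 < v) {f : V × V → ℝ}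
    (hf : Measurable f) :
    Integrable (fun p => gaussianDensity v (p.2 - m p.1) * f p) (μ.prod volume) ↔
      Integrable (fun p => f (p.1, m p.1 + √v • p.2)) (μ.prod (stdGaussian V)) := by
  have hk := (measurable_gaussianDensity_sub (v := v) hm).ennreal_ofReal
  have h1 := integrable_map_measure (μ := μ.prod (stdGaussian V)) (g := f)
    (f := fun p => (p.1, m p.1 + √v • p.2)) hf.aestronglyMeasurable (by fun_prop)
  rw [map_prodMk_add_sqrt_smul μ hm hv,
    integrable_withDensity_iff_integrable_smul' hk (by simp)] at h1
  simp_rw [ENNReal.toReal_ofReal (gaussianDensity_pos hv _).le, smul_eq_mul] at h1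
  exact h1

/-- Expectations of functions of `Y` and `m Y + √v ξ` as integrals against the Gaussian kernel. -/
lemma integral_kernel (hm : Measurable m) (hv : 0 < v) {f : V × V → ℝ} (hf : Measurable f) :
    ∫ p, f (p.1, m p.1 + √v • p.2) ∂(μ.prod (stdGaussian V)) =
      ∫ p, gaussianDensity v (p.2 - m p.1) * f p ∂(μ.prod volume) := by
  have hk := (measurable_gaussianDensity_sub (v := v) hm).ennreal_ofReal
  have h1 := integral_map (μ := μ.prod (stdGaussian V)) (f := f)
    (φ := fun p => (p.1, m p.1 + √v • p.2)) (by fun_prop) hf.aestronglyMeasurable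
  rw [map_prodMk_add_sqrt_smul μ hm hv,
    integral_withDensity_eq_integral_toReal_smul hk (by simp)] at h1
  simp_rw [ENNReal.toReal_ofReal (gaussianDensity_pos hv _).le, smul_eq_mul] at h1
  exact h1.symm

lemma integrable_gaussianDensity_sub (hm : Measurable m) (hv : 0 < v) (x : V) :
    Integrable (fun y => gaussianDensity v (x - m y)) μ := by
  refine Integrable.of_bound (C := gaussianConst V v)
    ((continuous_gaussianDensity v).measurable.comp (by fun_prop)).aestronglyMeasurable
    (ae_of_all _ fun y => ?_)
  rw [Real.norm_of_nonneg (gaussianDensity_pos hv _).le]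
  exact gaussianDensity_le hv _

lemma smoothing_nonneg (hv : 0 < v) (x : V) : 0 ≤ smoothing μ m v x :=
  integral_nonneg fun _ => (gaussianDensity_pos hv _).le

lemma measurable_smoothing (hm : Measurable m) : Measurable (smoothing μ m v) := by
  have : StronglyMeasurable fun p : V × V => gaussianDensity v (p.1 - m p.2) :=
    ((continuous_gaussianDensity v).measurable.comp (by fun_prop)).stronglyMeasurable
  exact this.integral_prod_right.measurable

/-- The law of `m Y + √v ξ` has density `smoothing μ m v`. -/
lemma map_add_sqrt_smul (hm : Measurable m) (hv : 0 < v) :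
    (μ.prod (stdGaussian V)).map (fun p => m p.1 + √v • p.2) =
      volume.withDensity fun x => ENNReal.ofReal (smoothing μ m v x) := by
  have hk := (measurable_gaussianDensity_sub (v := v) hm).ennreal_ofReal
  have h := Measure.map_map (μ := μ.prod (stdGaussian V)) measurable_snd
    (by fun_prop : Measurable fun p : V × V => (p.1, m p.1 + √v • p.2))
  refine Eq.trans h.symm ?_
  rw [map_prodMk_add_sqrt_smul μ hm hv]
  refine Measure.ext_of_lintegral _ fun f hf => ?_
  rw [lintegral_map hf measurable_snd,
    lintegral_withDensity_eq_lintegral_mul _ hk (by fun_prop),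
    lintegral_prod_symm _ (by fun_prop),
    lintegral_withDensity_eq_lintegral_mul _ (measurable_smoothing hm).ennreal_ofReal hf]
  refine lintegral_congr fun x => ?_
  simp only [Pi.mul_apply]
  have hkx : Measurable fun y => ENNReal.ofReal (gaussianDensity v (x - m y)) :=
    ((continuous_gaussianDensity v).measurable.comp (hm.const_sub x)).ennreal_ofReal
  rw [lintegral_mul_const _ hkx, smoothing, ofReal_integral_eq_lintegral_ofReal
    (integrable_gaussianDensity_sub hm hv x) (ae_of_all _ fun y => (gaussianDensity_pos hv _).le)]

lemma integrable_smoothing_mul_iff (hm : Measurable m) (hv : 0 < v) {f : V → ℝ}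
    (hf : Measurable f) :
    Integrable (fun x => smoothing μ m v x * f x) ↔
      Integrable (fun p => f (m p.1 + √v • p.2)) (μ.prod (stdGaussian V)) := by
  have h1 := integrable_map_measure (μ := μ.prod (stdGaussian V)) (g := f)
    (f := fun p => m p.1 + √v • p.2) hf.aestronglyMeasurable (by fun_prop)
  rw [map_add_sqrt_smul hm hv, integrable_withDensity_iff_integrable_smul'
    (measurable_smoothing hm).ennreal_ofReal (by simp)] at h1
  simp_rw [ENNReal.toReal_ofReal (smoothing_nonneg hv _), smul_eq_mul] at h1
  exact h1

lemma integral_smoothing_mul (hm : Measurable m) (hv : 0 < v) {f : V → ℝ} (hf : Measurable f) :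
    ∫ x, smoothing μ m v x * f x =
      ∫ p, f (m p.1 + √v • p.2) ∂(μ.prod (stdGaussian V)) := by
  have h1 := integral_map (μ := μ.prod (stdGaussian V)) (f := f)
    (φ := fun p => m p.1 + √v • p.2) (by fun_prop) hf.aestronglyMeasurable
  rw [map_add_sqrt_smul hm hv, integral_withDensity_eq_integral_toReal_smul
    (measurable_smoothing hm).ennreal_ofReal (by simp)] at h1
  simp_rw [ENNReal.toReal_ofReal (smoothing_nonneg hv _), smul_eq_mul] at h1
  exact h1

lemma integrable_smoothing (hm : Measurable m) (hv : 0 < v) : Integrable (smoothing μ m v) := by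
  simpa using (integrable_smoothing_mul_iff (μ := μ) hm hv (f := fun _ => 1)
    measurable_const).2 (integrable_const _)

lemma integrable_of_quadratic_growth {α : Type*} [MeasurableSpace α] {P : Measure α}
    [IsFiniteMeasure P] {X : α → V} (hX : Integrable (fun w => ‖X w‖ ^ 2) P)
    (hXm : AEMeasurable X P) {f : V → ℝ} (hf : Measurable f) {C : ℝ}
    (hC : ∀ x, |f x| ≤ C * (1 + ‖x‖ ^ 2)) : Integrable (fun w => f (X w)) P := by
  refine (((integrable_const 1).add hX).const_mul C).mono'
    (hf.comp_aemeasurable hXm).aestronglyMeasurable (ae_of_all _ fun w => ?_)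
  simpa using hC (X w)

lemma measurable_addSqrt (hm : Measurable m) (v : ℝ) :
    Measurable fun p : V × V => m p.1 + √v • p.2 := by fun_prop

lemma norm_add_sq_le_two (a b : V) : ‖a + b‖ ^ 2 ≤ 2 * ‖a‖ ^ 2 + 2 * ‖b‖ ^ 2 := by
  have h := norm_add_le a b
  nlinarith [norm_nonneg (a + b), sq_nonneg (‖a‖ - ‖b‖)]

lemma integrable_norm_sq_add_sqrt_smul (hm : Measurable m)
    (hi : Integrable (fun y => ‖m y‖ ^ 2) μ) (v : ℝ) :
    Integrable (fun p : V × V => ‖m p.1 + √v • p.2‖ ^ 2) (μ.prod (stdGaussian V)) := by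
  have h1 : Integrable (fun p : V × V => ‖m p.1‖ ^ 2) (μ.prod (stdGaussian V)) :=
    hi.comp_fst (stdGaussian V)
  have h2 : Integrable (fun p : V × V => ‖p.2‖ ^ 2) (μ.prod (stdGaussian V)) :=
    (integrable_norm_sq_stdGaussian (V := V)).comp_snd μ
  refine ((h1.const_mul 2).add (h2.const_mul (2 * √v ^ 2))).mono'
    ((measurable_addSqrt hm v).norm.pow_const 2).aestronglyMeasurable (ae_of_all _ fun p => ?_)
  rw [Real.norm_of_nonneg (by positivity)]
  refine (norm_add_sq_le_two _ _).trans (le_of_eq ?_)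
  rw [norm_smul, Real.norm_of_nonneg (Real.sqrt_nonneg v)]
  simp only [Pi.add_apply]
  ring

lemma integrable_smoothing_mul (hm : Measurable m) (hv : 0 < v)
    (hi : Integrable (fun y => ‖m y‖ ^ 2) μ) {f : V → ℝ} (hf : Measurable f) {C : ℝ}
    (hC : ∀ x, |f x| ≤ C * (1 + ‖x‖ ^ 2)) : Integrable (fun x => smoothing μ m v x * f x) :=
  (integrable_smoothing_mul_iff hm hv hf).2 (integrable_of_quadratic_growth
    (integrable_norm_sq_add_sqrt_smul hm hi v) (measurable_addSqrt hm v).aemeasurable hf hC)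

end Smoothing

section SmoothingProbability

variable {V : Type*} [NormedAddCommGroup V] [InnerProductSpace ℝ V] [FiniteDimensional ℝ V]
  [MeasurableSpace V] [BorelSpace V]
variable {μ : Measure V} [IsProbabilityMeasure μ] {m : V → V} {v : ℝ}

lemma smoothing_pos (hm : Measurable m) (hv : 0 < v) (x : V) : 0 < smoothing μ m v x := by
  rw [smoothing, integral_pos_iff_support_of_nonneg (fun y => (gaussianDensity_pos hv _).le)
    (integrable_gaussianDensity_sub hm hv x)]
  have : Function.support (fun y => gaussianDensity v (x - m y)) = Set.univ := by
    ext y; simp [(gaussianDensity_pos hv (x - m y)).ne']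
  simp [this]

lemma smoothing_le (hm : Measurable m) (hv : 0 < v) (x : V) :
    smoothing μ m v x ≤ gaussianConst V v := by
  have := integral_mono (integrable_gaussianDensity_sub (μ := μ) hm hv x)
    (integrable_const (gaussianConst V v)) (fun y => gaussianDensity_le hv (x - m y))
  simpa [smoothing] using this

lemma integral_smoothing (hm : Measurable m) (hv : 0 < v) : ∫ x, smoothing μ m v x = 1 := by
  simpa using integral_smoothing_mul (μ := μ) hm hv (f := fun _ => 1) measurable_const

end SmoothingProbability

/-! ### Smoothness of a Gaussian smoothing -/

section SmoothingRegularity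

variable {V : Type*} [NormedAddCommGroup V] [InnerProductSpace ℝ V]

lemma norm_le_sqrt_mul_exp {v : ℝ} (hv : 0 < v) (r : ℝ) :
    r ≤ √v * Real.exp (r ^ 2 / (4 * v)) := by
  have h1 : r / √v ≤ 1 + r ^ 2 / (4 * v) := by
    have h2 : r ^ 2 / (4 * v) = (r / √v) ^ 2 / 4 := by
      rw [div_pow, Real.sq_sqrt hv.le]; field_simp
    rw [h2]; nlinarith [sq_nonneg (r / √v - 2)]
  have h3 : r / √v ≤ Real.exp (r ^ 2 / (4 * v)) := by
    linarith [Real.add_one_le_exp (r ^ 2 / (4 * v))]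
  rwa [div_le_iff₀ (Real.sqrt_pos.2 hv), mul_comm] at h3

lemma gaussianDensity_mul_norm_le {v : ℝ} (hv : 0 < v) (z : V) :
    gaussianDensity v z * ‖z‖ ≤
      gaussianConst V v * √v * Real.exp (-‖z‖ ^ 2 / (4 * v)) := by
  rw [gaussianDensity_eq]
  have h := norm_le_sqrt_mul_exp hv ‖z‖
  have hc := gaussianConst_pos (V := V) hv
  calc gaussianConst V v * Real.exp (-‖z‖ ^ 2 / (2 * v)) * ‖z‖
      ≤ gaussianConst V v * Real.exp (-‖z‖ ^ 2 / (2 * v)) *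
        (√v * Real.exp (‖z‖ ^ 2 / (4 * v))) := by gcongr
    _ = gaussianConst V v * √v *
        (Real.exp (-‖z‖ ^ 2 / (2 * v)) * Real.exp (‖z‖ ^ 2 / (4 * v))) := by ring
    _ = _ := by
      rw [← Real.exp_add]; congr 2; field_simp; ring

lemma gaussianDensity_mul_norm_le' {v : ℝ} (hv : 0 < v) (z : V) :
    gaussianDensity v z * ‖z‖ ≤ gaussianConst V v * √v := by
  refine (gaussianDensity_mul_norm_le hv z).trans (mul_le_of_le_one_right ?_ ?_)
  · have := gaussianConst_pos (V := V) hv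
    positivity
  · refine Real.exp_le_one_iff.2 ?_
    rw [neg_div]
    exact neg_nonpos.2 (by positivity)

lemma hasFDerivAt_gaussianDensity (v : ℝ) (z : V) :
    HasFDerivAt (gaussianDensity v) ((-(1 / v) * gaussianDensity v z) • innerSL ℝ z) z := by
  have h1 : HasFDerivAt (fun z : V => -‖z‖ ^ 2 / (2 * v)) (-((1 / v) • innerSL ℝ z)) z := by
    have h2 := (hasStrictFDerivAt_norm_sq z).hasFDerivAt.mul_const (-(1 / (2 * v)))
    refine (h2.congr_fderiv ?_).congr_of_eventuallyEq (Filter.Eventually.of_forall fun y => ?_)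
    · ext w
      simp
      ring
    · simp only; ring
  refine (h1.exp.const_mul (gaussianConst V v)).congr_fderiv ?_
  ext w
  simp [gaussianDensity_eq]
  ring

variable [FiniteDimensional ℝ V] [MeasurableSpace V] [BorelSpace V]

lemma integrable_exp_neg_mul_norm_sq {c : ℝ} (hc : 0 < c) :
    Integrable (fun z : V => Real.exp (-c * ‖z‖ ^ 2)) := by
  by_contra h
  have h1 := GaussianFourier.integral_rexp_neg_mul_sq_norm (V := V) hc
  rw [integral_undef h] at h1
  have : 0 < (Real.pi / c) ^ (Module.finrank ℝ V / 2 : ℝ) := by positivity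
  exact this.ne h1

lemma integrable_norm_pow_mul_exp_neg {c : ℝ} (hc : 0 < c) (n : ℕ) :
    Integrable (fun z : V => ‖z‖ ^ n * Real.exp (-c * ‖z‖ ^ 2)) := by
  have hi := (integrable_exp_neg_mul_norm_sq (V := V) hc).add
    ((integrable_exp_neg_mul_norm_sq (V := V) (half_pos hc)).const_mul
      ((n.factorial : ℝ) * (2 / c) ^ n))
  refine hi.mono' (by fun_prop) (ae_of_all _ fun z => ?_)
  rw [Real.norm_of_nonneg (by positivity)]
  have h1 := Real.pow_div_factorial_le_exp (c / 2 * ‖z‖ ^ 2) (by positivity) n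
  rw [div_le_iff₀ (by positivity)] at h1
  have h2 : (‖z‖ ^ 2) ^ n ≤ n.factorial * (2 / c) ^ n * Real.exp (c / 2 * ‖z‖ ^ 2) := by
    calc (‖z‖ ^ 2) ^ n = (2 / c) ^ n * (c / 2 * ‖z‖ ^ 2) ^ n := by
          rw [← mul_pow]; congr 1; field_simp
      _ ≤ (2 / c) ^ n * (Real.exp (c / 2 * ‖z‖ ^ 2) * n.factorial) := by gcongr
      _ = _ := by ring
  have h3 : ‖z‖ ^ n ≤ 1 + (‖z‖ ^ 2) ^ n := by
    rw [← pow_mul, mul_comm 2 n, pow_mul]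
    nlinarith [sq_nonneg (‖z‖ ^ n - 1)]
  have h4 : Real.exp (c / 2 * ‖z‖ ^ 2) * Real.exp (-c * ‖z‖ ^ 2) =
      Real.exp (-(c / 2) * ‖z‖ ^ 2) := by
    rw [← Real.exp_add]; congr 1; ring
  calc ‖z‖ ^ n * Real.exp (-c * ‖z‖ ^ 2)
      ≤ (1 + n.factorial * (2 / c) ^ n * Real.exp (c / 2 * ‖z‖ ^ 2)) *
        Real.exp (-c * ‖z‖ ^ 2) := by gcongr; linarith
    _ = Real.exp (-c * ‖z‖ ^ 2) + n.factorial * (2 / c) ^ n *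
        (Real.exp (c / 2 * ‖z‖ ^ 2) * Real.exp (-c * ‖z‖ ^ 2)) := by ring
    _ = _ := by rw [h4]; rfl

variable {μ : Measure V} [IsProbabilityMeasure μ] {m : V → V} {v : ℝ}

lemma hasFDerivAt_smoothing (hm : Measurable m) (hv : 0 < v) (x : V) :
    HasFDerivAt (smoothing μ m v)
      (∫ y, (-(1 / v) * gaussianDensity v (x - m y)) • innerSL ℝ (x - m y) ∂μ) x := by
  have hc := continuous_gaussianDensity (V := V) v
  refine hasFDerivAt_integral_of_dominated_of_fderiv_le (s := Set.univ)
    (F := fun x y => gaussianDensity v (x - m y))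
    (F' := fun x y => (-(1 / v) * gaussianDensity v (x - m y)) • innerSL ℝ (x - m y))
    (bound := fun _ => 1 / v * (gaussianConst V v * √v)) Filter.univ_mem
    (Filter.Eventually.of_forall fun x =>
      (integrable_gaussianDensity_sub hm hv x).aestronglyMeasurable)
    (integrable_gaussianDensity_sub hm hv x) ?_ ?_ (integrable_const _) ?_
  · have : Continuous fun z : V => (-(1 / v) * gaussianDensity v z) • innerSL ℝ z := by fun_prop
    exact (this.measurable.comp (by fun_prop : Measurable fun y => x - m y)).aestronglyMeasurable
  · refine ae_of_all _ fun y z _ => ?_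
    rw [norm_smul, innerSL_apply_norm, norm_mul, norm_neg,
      Real.norm_of_nonneg (gaussianDensity_pos hv _).le, Real.norm_of_nonneg (by positivity),
      mul_assoc]
    exact mul_le_mul_of_nonneg_left (gaussianDensity_mul_norm_le' hv _) (by positivity)
  · refine ae_of_all _ fun y z _ => ?_
    exact (hasFDerivAt_comp_sub _).2 (hasFDerivAt_gaussianDensity v (z - m y))

lemma integrable_gaussianDensity_smul (hm : Measurable m) (hv : 0 < v) (x : V) :
    Integrable (fun y => gaussianDensity v (x - m y) • (x - m y)) μ := by
  have hc := continuous_gaussianDensity (V := V) v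
  refine Integrable.of_bound (C := gaussianConst V v * √v)
    ((by fun_prop : Measurable fun z : V => gaussianDensity v z • z).comp
      (by fun_prop : Measurable fun y => x - m y)).aestronglyMeasurable
    (ae_of_all _ fun y => ?_)
  rw [norm_smul, Real.norm_of_nonneg (gaussianDensity_pos hv _).le]
  exact gaussianDensity_mul_norm_le' hv _

lemma hasGradientAt_smoothing (hm : Measurable m) (hv : 0 < v) (x : V) :
    HasGradientAt (smoothing μ m v)
      (-(1 / v) • ∫ y, gaussianDensity v (x - m y) • (x - m y) ∂μ) x := by
  rw [hasGradientAt_iff_hasFDerivAt]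
  refine (hasFDerivAt_smoothing hm hv x).congr_fderiv ?_
  have hi := integrable_gaussianDensity_smul (μ := μ) hm hv x
  have hi2 : Integrable
      (fun y => (-(1 / v) * gaussianDensity v (x - m y)) • innerSL ℝ (x - m y)) μ := by
    have := (innerSL ℝ (E := V)).integrable_comp (hi.smul (-(1 / v)))
    refine this.congr (ae_of_all _ fun y => ?_)
    simp [mul_smul]
  ext w
  rw [ContinuousLinearMap.integral_apply hi2]
  simp only [InnerProductSpace.toDual_apply_apply]
  rw [real_inner_comm, real_inner_smul_right, ← integral_inner hi, ← integral_const_mul]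
  refine integral_congr_ae (ae_of_all _ fun y => ?_)
  simp only [smul_apply, innerSL_apply_apply, smul_eq_mul,
    real_inner_smul_right, real_inner_comm w]
  ring

lemma gradient_smoothing (hm : Measurable m) (hv : 0 < v) (x : V) :
    ∇ (smoothing μ m v) x = -(1 / v) • ∫ y, gaussianDensity v (x - m y) • (x - m y) ∂μ :=
  (hasGradientAt_smoothing hm hv x).gradient

/-- A Gaussian smoothing is smooth: it is the Fourier transform of the product of a Gaussian with
a bounded function. -/
lemma contDiff_smoothing (hm : Measurable m) (hv : 0 < v) : ContDiff ℝ ∞ (smoothing μ m v) := by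
  set c : ℝ := 2 * Real.pi ^ 2 * v with hcdef
  have hc : 0 < c := by positivity
  have hcre : 0 < (c : ℂ).re := by simpa using hc
  let G : V → ℂ := fun ξ => Complex.exp (-(c : ℂ) * ‖ξ‖ ^ 2)
  let φ : V → ℂ := fun ξ => ∫ y, (Real.fourierChar (inner ℝ ξ (m y)) : ℂ) ∂μ
  have hGn : ∀ ξ, ‖G ξ‖ = Real.exp (-c * ‖ξ‖ ^ 2) := by
    intro ξ
    simp only [G, Complex.norm_exp]
    congr 1
    rw [← Complex.ofReal_pow, ← Complex.ofReal_neg, ← Complex.ofReal_mul, Complex.ofReal_re]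
  have hGc : Continuous G := by fun_prop
  have hφm : StronglyMeasurable fun p : V × V => (Real.fourierChar (inner ℝ p.1 (m p.2)) : ℂ) := by
    have h1 : Measurable fun p : V × V => inner ℝ p.1 (m p.2) := by fun_prop
    exact ((continuous_subtype_val.comp Real.continuous_fourierChar).measurable.comp
      h1).stronglyMeasurable
  have hφ : StronglyMeasurable φ := hφm.integral_prod_right
  have hφn : ∀ ξ, ‖φ ξ‖ ≤ 1 := by
    intro ξ
    refine (norm_integral_le_integral_norm _).trans (le_of_eq ?_)
    have : ∀ y, ‖(Real.fourierChar (inner ℝ ξ (m y)) : ℂ)‖ = 1 := fun y => Circle.norm_coe _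
    simp_rw [this]
    simp
  have hF : ContDiff ℝ ∞ (FourierTransform.fourier (fun ξ => φ ξ * G ξ)) := by
    refine Real.contDiff_fourier (N := ⊤) fun n _ => ?_
    refine (integrable_norm_pow_mul_exp_neg (V := V) hc n).mono'
      ((by fun_prop : Measurable fun ξ : V => ‖ξ‖ ^ n).aestronglyMeasurable.mul
        (hφ.aestronglyMeasurable.mul hGc.aestronglyMeasurable).norm) (ae_of_all _ fun ξ => ?_)
    rw [Real.norm_of_nonneg (by positivity), norm_mul, hGn]
    gcongr
    exact mul_le_of_le_one_left (Real.exp_pos _).le (hφn ξ)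
  have hG1 : ∀ w : V, FourierTransform.fourier G w = (gaussianDensity v w : ℂ) := by
    intro w
    have h := fourier_gaussian_innerProductSpace (V := V) hcre w
    rw [show FourierTransform.fourier G w = _ from h, gaussianDensity]
    have hpi : (Real.pi : ℂ) ≠ 0 := by exact_mod_cast Real.pi_ne_zero
    have hvc : (v : ℂ) ≠ 0 := by exact_mod_cast hv.ne'
    have e1 : (Real.pi : ℂ) / (c : ℂ) = ((2 * Real.pi * v)⁻¹ : ℝ) := by
      rw [hcdef]; push_cast; field_simp
    have e2 : -(Real.pi : ℂ) ^ 2 * ‖w‖ ^ 2 / c = ((-‖w‖ ^ 2 / (2 * v) : ℝ) : ℂ) := by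
      rw [hcdef]; push_cast; field_simp
    rw [e1, e2, show ((Module.finrank ℝ V : ℂ) / 2) = ((Module.finrank ℝ V / 2 : ℝ) : ℂ) by
      push_cast; ring, ← Complex.ofReal_cpow (by positivity), ← Complex.ofReal_exp,
      ← Complex.ofReal_mul, Real.inv_rpow (by positivity)]
  have hS : ∀ x, smoothing μ m v x = (FourierTransform.fourier (fun ξ => φ ξ * G ξ) x).re := by
    intro x
    have hint : Integrable (fun p : V × V => (Real.fourierChar (-inner ℝ p.1 x) : ℂ) *
        ((Real.fourierChar (inner ℝ p.1 (m p.2)) : ℂ) * G p.1)) (volume.prod μ) := by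
      have hGi : Integrable (fun p : V × V => Real.exp (-c * ‖p.1‖ ^ 2)) (volume.prod μ) :=
        (integrable_exp_neg_mul_norm_sq (V := V) hc).comp_fst μ
      have h0 : Continuous fun p : V × V => (Real.fourierChar (-inner ℝ p.1 x) : ℂ) :=
        (continuous_subtype_val.comp Real.continuous_fourierChar).comp (by fun_prop)
      refine hGi.mono' (h0.aestronglyMeasurable.mul (hφm.aestronglyMeasurable.mul
        (hGc.comp continuous_fst).aestronglyMeasurable)) (ae_of_all _ fun p => ?_)
      rw [norm_mul, norm_mul, hGn, Circle.norm_coe, Circle.norm_coe, one_mul, one_mul]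
    have h1 : FourierTransform.fourier (fun ξ => φ ξ * G ξ) x =
        ∫ y, FourierTransform.fourier G (x - m y) ∂μ := by
      rw [Real.fourier_eq]
      simp_rw [Real.fourier_eq]
      have e : ∀ ξ : V, Real.fourierChar (-inner ℝ ξ x) • (φ ξ * G ξ) =
          ∫ y, (Real.fourierChar (-inner ℝ ξ x) : ℂ) *
            ((Real.fourierChar (inner ℝ ξ (m y)) : ℂ) * G ξ) ∂μ := by
        intro ξ
        rw [integral_const_mul, integral_mul_const]
        rfl
      simp_rw [e]
      rw [integral_integral_swap hint]
      refine integral_congr_ae (ae_of_all _ fun y => ?_)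
      refine integral_congr_ae (ae_of_all _ fun ξ => ?_)
      simp only [Circle.smul_def, smul_eq_mul]
      rw [← mul_assoc, ← Circle.coe_mul, ← AddChar.map_add_eq_mul, inner_sub_right]
      congr 3
      ring
    rw [h1]
    simp_rw [hG1]
    rw [integral_complex_ofReal, Complex.ofReal_re, smoothing]
  have : smoothing μ m v =
      Complex.reCLM ∘ FourierTransform.fourier (fun ξ => φ ξ * G ξ) := by
    ext x; simp [hS]
  rw [this]
  exact Complex.reCLM.contDiff.comp hF

end SmoothingRegularity

/-! ### Growth of the log-density and integration by parts -/

section SmoothingBounds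

variable {V : Type*} [NormedAddCommGroup V] [InnerProductSpace ℝ V] [FiniteDimensional ℝ V]
  [MeasurableSpace V] [BorelSpace V]
variable {μ : Measure V} [IsProbabilityMeasure μ] {m : V → V} {v : ℝ}

/-- Lower bound for a Gaussian smoothing: the points `y` with `‖m y‖ ≤ R` carry half of the mass,
and for them `‖x - m y‖² ≤ 2 (‖x‖² + R²)`. -/
lemma smoothing_ge (hm : Measurable m) (hv : 0 < v) {R : ℝ}
    (hR : 1 / 2 ≤ μ.real {y | ‖m y‖ ≤ R}) (x : V) :
    gaussianConst V v / 2 * Real.exp (-(‖x‖ ^ 2 + R ^ 2) / v) ≤ smoothing μ m v x := by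
  have hS : MeasurableSet {y | ‖m y‖ ≤ R} := measurableSet_le hm.norm measurable_const
  set b : ℝ := gaussianConst V v * Real.exp (-(‖x‖ ^ 2 + R ^ 2) / v)
  have hb : 0 ≤ b := (mul_pos (gaussianConst_pos hv) (Real.exp_pos _)).le
  have h1 : ∫ y, Set.indicator {y | ‖m y‖ ≤ R} (fun _ => b) y ∂μ ≤ smoothing μ m v x := by
    refine integral_mono ((integrable_const b).indicator hS)
      (integrable_gaussianDensity_sub hm hv x) fun y => ?_
    by_cases hy : ‖m y‖ ≤ R
    · rw [Set.indicator_of_mem (show y ∈ {y | ‖m y‖ ≤ R} from hy), gaussianDensity_eq]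
      refine mul_le_mul_of_nonneg_left (Real.exp_le_exp.2 ?_) (gaussianConst_pos hv).le
      rw [div_le_div_iff₀ hv (by positivity)]
      have h2 : ‖x - m y‖ ^ 2 ≤ 2 * (‖x‖ ^ 2 + R ^ 2) := by
        have h3 := norm_sub_le x (m y)
        have h4 := norm_nonneg (x - m y)
        have h5 := norm_nonneg (m y)
        nlinarith [sq_nonneg (‖x‖ - ‖m y‖), norm_nonneg x]
      nlinarith
    · rw [Set.indicator_of_notMem (show y ∉ {y | ‖m y‖ ≤ R} from hy)]
      exact (gaussianDensity_pos hv _).le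
  rw [integral_indicator_const _ hS, smul_eq_mul] at h1
  calc gaussianConst V v / 2 * Real.exp (-(‖x‖ ^ 2 + R ^ 2) / v) = 1 / 2 * b := by
        simp only [b]; ring
    _ ≤ μ.real {y | ‖m y‖ ≤ R} * b := by gcongr
    _ ≤ _ := h1

lemma abs_log_smoothing_le (hm : Measurable m) (hv : 0 < v) {R : ℝ}
    (hR : 1 / 2 ≤ μ.real {y | ‖m y‖ ≤ R}) (x : V) :
    |Real.log (smoothing μ m v x)| ≤
      |Real.log (gaussianConst V v)| + Real.log 2 + (‖x‖ ^ 2 + R ^ 2) / v := by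
  have hc := gaussianConst_pos (V := V) hv
  have h1 := Real.log_le_log (smoothing_pos (μ := μ) hm hv x) (smoothing_le hm hv x)
  have h2 := Real.log_le_log (by positivity) (smoothing_ge hm hv hR x)
  rw [Real.log_mul (by positivity) (Real.exp_pos _).ne', Real.log_exp,
    Real.log_div hc.ne' two_ne_zero, neg_div] at h2
  have h3 : 0 ≤ (‖x‖ ^ 2 + R ^ 2) / v := by positivity
  have h4 : 0 ≤ Real.log 2 := Real.log_nonneg (by norm_num)
  have h5 := neg_abs_le (Real.log (gaussianConst V v))
  have h6 := le_abs_self (Real.log (gaussianConst V v))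
  rw [abs_le]
  constructor <;> linarith

/-- The score of a Gaussian smoothing grows at most linearly: points `y` with `‖x - m y‖` much
larger than `1 + ‖x‖` contribute less than the lower bound `smoothing_ge`. -/
lemma norm_integral_gaussianDensity_smul_le (hm : Measurable m) (hv : 0 < v) {R : ℝ} (hR0 : 0 ≤ R)
    (hR : 1 / 2 ≤ μ.real {y | ‖m y‖ ≤ R}) (x : V) :
    ‖∫ y, gaussianDensity v (x - m y) • (x - m y) ∂μ‖ ≤
      (2 * (1 + R) * (1 + ‖x‖) + 2 * √v) * smoothing μ m v x := by
  have hc := gaussianConst_pos (V := V) hv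
  set a : ℝ := 2 * (1 + R) * (1 + ‖x‖) with ha
  set e : ℝ := Real.exp (-(‖x‖ ^ 2 + R ^ 2) / v)
  have hpt : ∀ z : V, gaussianDensity v z * ‖z‖ ≤
      a * gaussianDensity v z + gaussianConst V v * √v * e := by
    intro z
    have hg := gaussianDensity_pos hv z
    by_cases hz : ‖z‖ ≤ a
    · have : 0 ≤ gaussianConst V v * √v * e := by positivity
      nlinarith
    · have h1 := gaussianDensity_mul_norm_le hv z
      have h2 : Real.exp (-‖z‖ ^ 2 / (4 * v)) ≤ e := by
        refine Real.exp_le_exp.2 ?_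
        rw [div_le_div_iff₀ (by positivity) hv]
        have h3 : a ^ 2 ≤ ‖z‖ ^ 2 := by
          have : 0 ≤ a := by positivity
          exact pow_le_pow_left₀ this (not_le.1 hz).le 2
        have h4 : 4 * (‖x‖ ^ 2 + R ^ 2) ≤ a ^ 2 := by
          have hx := norm_nonneg x
          have : ‖x‖ ^ 2 + R ^ 2 ≤ ((1 + R) * (1 + ‖x‖)) ^ 2 := by
            have : ‖x‖ + R ≤ (1 + R) * (1 + ‖x‖) := by nlinarith [mul_nonneg hR0 hx]
            nlinarith [mul_nonneg hR0 hx]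
          nlinarith
        nlinarith
      have h5 : gaussianConst V v * √v * Real.exp (-‖z‖ ^ 2 / (4 * v)) ≤
          gaussianConst V v * √v * e := by gcongr
      have : 0 ≤ a * gaussianDensity v z := by positivity
      linarith
  have hi := integrable_gaussianDensity_sub (μ := μ) hm hv x
  have h1 : ‖∫ y, gaussianDensity v (x - m y) • (x - m y) ∂μ‖ ≤
      ∫ y, (a * gaussianDensity v (x - m y) + gaussianConst V v * √v * e) ∂μ := by
    refine norm_integral_le_of_norm_le ((hi.const_mul a).add (integrable_const _))
      (ae_of_all _ fun y => ?_)
    rw [norm_smul, Real.norm_of_nonneg (gaussianDensity_pos hv _).le]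
    exact hpt _
  rw [integral_add (hi.const_mul a) (integrable_const _), integral_const_mul, integral_const,
    probReal_univ, one_smul] at h1
  have h2 := smoothing_ge hm hv hR x
  have h3 : gaussianConst V v * √v * e = 2 * √v * (gaussianConst V v / 2 * e) := by ring
  rw [h3] at h1
  have h4 : 2 * √v * (gaussianConst V v / 2 * e) ≤ 2 * √v * smoothing μ m v x := by gcongr
  rw [add_mul]
  exact h1.trans (add_le_add le_rfl h4)

lemma contDiff_log_smoothing (hm : Measurable m) (hv : 0 < v) :
    ContDiff ℝ ∞ fun x => Real.log (smoothing μ m v x) :=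
  (contDiff_smoothing hm hv).log fun x => (smoothing_pos hm hv x).ne'

lemma hasGradientAt_log_smoothing (hm : Measurable m) (hv : 0 < v) (x : V) :
    HasGradientAt (fun x => Real.log (smoothing μ m v x))
      ((smoothing μ m v x)⁻¹ • ∇ (smoothing μ m v) x) x := by
  have h := hasGradientAt_smoothing (μ := μ) hm hv x
  rw [← h.gradient, hasGradientAt_iff_hasFDerivAt] at h
  rw [hasGradientAt_iff_hasFDerivAt]
  refine (h.log (smoothing_pos hm hv x).ne').congr_fderiv ?_
  ext w
  simp

lemma norm_gradient_log_smoothing_le (hm : Measurable m) (hv : 0 < v) {R : ℝ} (hR0 : 0 ≤ R)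
    (hR : 1 / 2 ≤ μ.real {y | ‖m y‖ ≤ R}) (x : V) :
    ‖∇ (fun x => Real.log (smoothing μ m v x)) x‖ ≤
      (2 * (1 + R) + 2 * √v) / v * (1 + ‖x‖) := by
  have hq := smoothing_pos (μ := μ) hm hv x
  rw [(hasGradientAt_log_smoothing hm hv x).gradient, gradient_smoothing hm hv, norm_smul,
    norm_smul, norm_inv, Real.norm_of_nonneg hq.le, norm_neg, Real.norm_of_nonneg (by positivity)]
  have h := norm_integral_gaussianDensity_smul_le hm hv hR0 hR x
  calc (smoothing μ m v x)⁻¹ * (1 / v * ‖∫ y, gaussianDensity v (x - m y) • (x - m y) ∂μ‖)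
      ≤ (smoothing μ m v x)⁻¹ * (1 / v *
        ((2 * (1 + R) * (1 + ‖x‖) + 2 * √v) * smoothing μ m v x)) := by gcongr
    _ = (2 * (1 + R) * (1 + ‖x‖) + 2 * √v) / v := by field_simp
    _ ≤ (2 * (1 + R) * (1 + ‖x‖) + 2 * √v * (1 + ‖x‖)) / v := by
        have : 2 * √v ≤ 2 * √v * (1 + ‖x‖) :=
          le_mul_of_one_le_right (by positivity) (by linarith [norm_nonneg x])
        exact div_le_div_of_nonneg_right (by linarith) hv.le
    _ = _ := by ring

/-- Tightness: a square integrable `m` is bounded by some `R` with probability at least `1 / 2`. -/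
lemma half_le_measureReal_norm_le (hm : Measurable m) {B : ℝ} (hB : 0 < B)
    (hi : Integrable (fun y => ‖m y‖ ^ 2) μ) (hI : ∫ y, ‖m y‖ ^ 2 ∂μ ≤ B) :
    1 / 2 ≤ μ.real {y | ‖m y‖ ≤ √(2 * B)} := by
  have h1 := mul_meas_ge_le_integral_of_nonneg (ae_of_all μ fun y => sq_nonneg ‖m y‖) hi (2 * B)
  have h2 : μ.real {y | 2 * B ≤ ‖m y‖ ^ 2} ≤ 1 / 2 := by
    have : 2 * B * μ.real {y | 2 * B ≤ ‖m y‖ ^ 2} ≤ B := h1.trans hI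
    nlinarith
  have hS : MeasurableSet {y | 2 * B ≤ ‖m y‖ ^ 2} :=
    measurableSet_le measurable_const (hm.norm.pow_const 2)
  have h3 := probReal_compl_eq_one_sub (μ := μ) hS
  have h4 : μ.real {y | 2 * B ≤ ‖m y‖ ^ 2}ᶜ ≤ μ.real {y | ‖m y‖ ≤ √(2 * B)} := by
    refine measureReal_mono fun y hy => ?_
    simp only [Set.mem_compl_iff, Set.mem_ofPred_eq, not_le] at hy ⊢
    exact Real.le_sqrt_of_sq_le hy.le
  linarith

/-- Gaussian integration by parts: `E⟨W(X), ξ⟩ = -√v E⟨W(X), ∇ log q(X)⟩` for `X = m Y + √v ξ` with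
density `q`. -/
lemma integral_inner_noise (hm : Measurable m) (hv : 0 < v)
    (hi : Integrable (fun y => ‖m y‖ ^ 2) μ) {W : V → V} (hW : Measurable W) {C : ℝ}
    (hC : ∀ x, ‖W x‖ ≤ C * (1 + ‖x‖)) :
    ∫ p, inner ℝ (W (m p.1 + √v • p.2)) p.2 ∂(μ.prod (stdGaussian V)) =
      -√v * ∫ p, inner ℝ (W (m p.1 + √v • p.2))
        (∇ (fun x => Real.log (smoothing μ m v x)) (m p.1 + √v • p.2))
          ∂(μ.prod (stdGaussian V)) := by
  have hsv : 0 < √v := Real.sqrt_pos.2 hv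
  have hX := integrable_norm_sq_add_sqrt_smul hm hi v
  have hZ : Integrable (fun p : V × V => ‖p.2‖ ^ 2) (μ.prod (stdGaussian V)) :=
    (integrable_norm_sq_stdGaussian (V := V)).comp_snd μ
  let f : V × V → ℝ := fun p => inner ℝ (W p.2) (p.2 - m p.1) / √v
  have hfm : Measurable f := by fun_prop
  have hfe : ∀ p : V × V, f (p.1, m p.1 + √v • p.2) = inner ℝ (W (m p.1 + √v • p.2)) p.2 := by
    intro p
    simp only [f, add_sub_cancel_left, real_inner_smul_right]
    field_simp
  have hfi : Integrable (fun p => f (p.1, m p.1 + √v • p.2)) (μ.prod (stdGaussian V)) := by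
    simp_rw [hfe]
    refine (((((integrable_const 1).add hX).const_mul (2 * C ^ 2)).add hZ)).mono'
      (by fun_prop) (ae_of_all _ fun p => ?_)
    simp only [Pi.add_apply]
    have h1 := norm_inner_le_norm (𝕜 := ℝ) (W (m p.1 + √v • p.2)) p.2
    have h2 := hC (m p.1 + √v • p.2)
    have h3 : ‖W (m p.1 + √v • p.2)‖ ^ 2 ≤ C ^ 2 * (1 + ‖m p.1 + √v • p.2‖) ^ 2 := by
      rw [← mul_pow]; exact pow_le_pow_left₀ (norm_nonneg _) h2 2
    have h4 : (1 + ‖m p.1 + √v • p.2‖) ^ 2 ≤ 2 * (1 + ‖m p.1 + √v • p.2‖ ^ 2) := by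
      nlinarith [sq_nonneg (1 - ‖m p.1 + √v • p.2‖)]
    have h5 : C ^ 2 * (1 + ‖m p.1 + √v • p.2‖) ^ 2 ≤
        C ^ 2 * (2 * (1 + ‖m p.1 + √v • p.2‖ ^ 2)) := by gcongr
    nlinarith [sq_nonneg (‖W (m p.1 + √v • p.2)‖ - ‖p.2‖), sq_nonneg ‖W (m p.1 + √v • p.2)‖,
      sq_nonneg ‖p.2‖]
  have hki := (integrable_kernel_iff (μ := μ) hm hv hfm).2 hfi
  have hgm : Measurable (∇ (fun x => Real.log (smoothing μ m v x))) := by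
    unfold gradient
    exact (LinearIsometryEquiv.continuous _).measurable.comp
      ((contDiff_log_smoothing hm hv).continuous_fderiv (by simp)).measurable
  have h1 := integral_kernel (μ := μ) hm hv hfm
  simp_rw [hfe] at h1
  rw [h1, integral_prod_symm _ hki]
  have h2 := integral_smoothing_mul (μ := μ) hm hv (f := fun x => inner ℝ (W x)
    (∇ (fun x => Real.log (smoothing μ m v x)) x)) (by fun_prop)
  rw [← h2, ← integral_const_mul]
  refine integral_congr_ae (ae_of_all _ fun x => ?_)
  have hq := smoothing_pos (μ := μ) hm hv x
  simp only [f]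
  rw [(hasGradientAt_log_smoothing hm hv x).gradient, gradient_smoothing hm hv,
    real_inner_smul_right, real_inner_smul_right,
    ← integral_inner (integrable_gaussianDensity_smul hm hv x)]
  simp_rw [real_inner_smul_right]
  have e : ∀ y, gaussianDensity v (x - m y) * (inner ℝ (W x) (x - m y) / √v) =
      (√v)⁻¹ * (gaussianDensity v (x - m y) * inner ℝ (W x) (x - m y)) := fun y => by ring
  simp_rw [e]
  rw [integral_const_mul]
  have hvv : √v * √v = v := Real.mul_self_sqrt hv.le
  field_simp
  rw [pow_two, hvv]
  field_simp

end SmoothingBounds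

/-! ### Dissipation along the noisy gradient step -/

section NoisyStep

variable {V : Type*} [NormedAddCommGroup V] [InnerProductSpace ℝ V] [FiniteDimensional ℝ V]
  [MeasurableSpace V] [BorelSpace V]

/-- The gradient step `y - s b(y)`. -/
def driftMap (b : V → V) (s : ℝ) (y : V) : V := y - s • b y

/-- The noisy gradient step `y - s b(y) + √(2 λ s) z`, as a function of the pair of the position and
the noise. -/
noncomputable def noisyMap (b : V → V) (lam s : ℝ) (p : V × V) : V :=
  driftMap b s p.1 + √(2 * lam * s) • p.2

/-- The smooth version of the density of `noisyMap b lam s` when the position has law `μ` and the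
noise is standard Gaussian. -/
noncomputable def stepDensity (μ : Measure V) (b : V → V) (lam s : ℝ) (x : V) : ℝ :=
  smoothing μ (driftMap b s) (2 * lam * s) x

variable {μ : Measure V} [IsFiniteMeasure μ] {b : V → V} {lam : ℝ} {C : ℝ}

lemma measurable_driftMap (hb : Measurable b) (s : ℝ) : Measurable (driftMap b s) := by
  unfold driftMap; fun_prop

lemma measurable_noisyMap (hb : Measurable b) (lam s : ℝ) : Measurable (noisyMap b lam s) :=
  measurable_addSqrt (measurable_driftMap hb s) _

lemma norm_driftMap_sq_le (hC : ∀ y, ‖b y‖ ≤ C * (1 + ‖y‖)) (s : ℝ) (y : V) :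
    ‖driftMap b s y‖ ^ 2 ≤ (2 + 4 * s ^ 2 * C ^ 2) * (1 + ‖y‖ ^ 2) := by
  have h1 : ‖b y‖ ^ 2 ≤ C ^ 2 * (1 + ‖y‖) ^ 2 := by
    rw [← mul_pow]; exact pow_le_pow_left₀ (norm_nonneg _) (hC y) 2
  have h2 : (1 + ‖y‖) ^ 2 ≤ 2 * (1 + ‖y‖ ^ 2) := by nlinarith [sq_nonneg (1 - ‖y‖)]
  have h3 : ‖b y‖ ^ 2 ≤ C ^ 2 * (2 * (1 + ‖y‖ ^ 2)) := h1.trans (by gcongr)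
  have h4 := norm_add_sq_le_two y (-(s • b y))
  rw [norm_neg, norm_smul, mul_pow, Real.norm_eq_abs, sq_abs, ← sub_eq_add_neg] at h4
  have h5 : s ^ 2 * ‖b y‖ ^ 2 ≤ s ^ 2 * (C ^ 2 * (2 * (1 + ‖y‖ ^ 2))) := by gcongr
  unfold driftMap
  nlinarith

lemma integrable_norm_driftMap_sq (hb : Measurable b) (hC : ∀ y, ‖b y‖ ≤ C * (1 + ‖y‖))
    (hμ : Integrable (fun y => ‖y‖ ^ 2) μ) (s : ℝ) :
    Integrable (fun y => ‖driftMap b s y‖ ^ 2) μ := by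
  refine (((integrable_const 1).add hμ).const_mul (2 + 4 * s ^ 2 * C ^ 2)).mono'
    ((measurable_driftMap hb s).norm.pow_const 2).aestronglyMeasurable (ae_of_all _ fun y => ?_)
  rw [Real.norm_of_nonneg (by positivity)]
  exact norm_driftMap_sq_le hC s y

lemma integrable_norm_noisyMap_sq (hb : Measurable b) (hC : ∀ y, ‖b y‖ ≤ C * (1 + ‖y‖))
    (hμ : Integrable (fun y => ‖y‖ ^ 2) μ) (s : ℝ) :
    Integrable (fun p => ‖noisyMap b lam s p‖ ^ 2) (μ.prod (stdGaussian V)) :=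
  integrable_norm_sq_add_sqrt_smul (measurable_driftMap hb s)
    (integrable_norm_driftMap_sq hb hC hμ s) _

lemma integrable_one_add_norms_sq (hμ : Integrable (fun y => ‖y‖ ^ 2) μ) :
    Integrable (fun p : V × V => (1 + ‖p.1‖ + ‖p.2‖) ^ 2) (μ.prod (stdGaussian V)) := by
  have h1 : Integrable (fun p : V × V => ‖p.1‖ ^ 2) (μ.prod (stdGaussian V)) :=
    hμ.comp_fst (stdGaussian V)
  have h2 : Integrable (fun p : V × V => ‖p.2‖ ^ 2) (μ.prod (stdGaussian V)) :=
    (integrable_norm_sq_stdGaussian (V := V)).comp_snd μ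
  refine ((((integrable_const 1).add h1).add h2).const_mul 3).mono' (by fun_prop)
    (ae_of_all _ fun p => ?_)
  rw [Real.norm_of_nonneg (by positivity)]
  simp only [Pi.add_apply]
  nlinarith [sq_nonneg (1 - ‖p.1‖), sq_nonneg (1 - ‖p.2‖), sq_nonneg (‖p.1‖ - ‖p.2‖)]

lemma norm_noisyMap_le (hC0 : 0 ≤ C) (hC : ∀ y, ‖b y‖ ≤ C * (1 + ‖y‖)) {s T : ℝ}
    (hlam : 0 ≤ lam) (hs : 0 ≤ s) (hsT : s ≤ T) (p : V × V) :
    ‖noisyMap b lam s p‖ ≤ (1 + T * C + √(2 * lam * T)) * (1 + ‖p.1‖ + ‖p.2‖) := by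
  have h1 : ‖noisyMap b lam s p‖ ≤ ‖p.1‖ + s * ‖b p.1‖ + √(2 * lam * s) * ‖p.2‖ := by
    unfold noisyMap driftMap
    refine (norm_add_le _ _).trans (add_le_add ((norm_sub_le _ _).trans (le_of_eq ?_)) ?_)
    · rw [norm_smul, Real.norm_of_nonneg hs]
    · rw [norm_smul, Real.norm_of_nonneg (Real.sqrt_nonneg _)]
  have h2 : s * ‖b p.1‖ ≤ T * (C * (1 + ‖p.1‖)) :=
    mul_le_mul hsT (hC _) (norm_nonneg _) (hs.trans hsT)
  have h3 : √(2 * lam * s) * ‖p.2‖ ≤ √(2 * lam * T) * ‖p.2‖ := by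
    gcongr
  have h4 : 0 ≤ T * C := mul_nonneg (hs.trans hsT) hC0
  have h5 := Real.sqrt_nonneg (2 * lam * T)
  have h6 := norm_nonneg p.1
  have h7 := norm_nonneg p.2
  nlinarith [mul_nonneg h4 h6, mul_nonneg h4 h7, mul_nonneg h5 h6, mul_nonneg h5 h7]

lemma hasDerivAt_noisyMap (b : V → V) (hlam : 0 < lam) {s : ℝ} (hs : 0 < s) (p : V × V) :
    HasDerivAt (fun s => noisyMap b lam s p)
      (-b p.1 + (lam / √(2 * lam * s)) • p.2) s := by
  have h1 : HasDerivAt (fun s : ℝ => √(2 * lam * s)) (lam / √(2 * lam * s)) s := by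
    have h := ((hasDerivAt_id s).const_mul (2 * lam)).sqrt
      (show 2 * lam * s ≠ 0 by positivity)
    refine h.congr_deriv ?_
    simp only [id]
    field_simp
  have h2 : HasDerivAt (fun s : ℝ => p.1 - s • b p.1) (-b p.1) s := by
    simpa using ((hasDerivAt_id s).smul_const (b p.1)).const_sub p.1
  exact h2.add (h1.smul_const p.2)

lemma continuous_gradient {G : V → ℝ} (hG : ContDiff ℝ ∞ G) : Continuous (∇ G) := by
  unfold gradient
  exact (LinearIsometryEquiv.continuous _).comp (hG.continuous_fderiv (by simp))

/-- The weak form of the Fokker-Planck equation, before integration by parts: differentiation of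
`E G(X_s)` under the expectation. -/
lemma hasDerivAt_integral_noisyMap (hb : Measurable b) (hC0 : 0 ≤ C)
    (hC : ∀ y, ‖b y‖ ≤ C * (1 + ‖y‖)) (hμ : Integrable (fun y => ‖y‖ ^ 2) μ) (hlam : 0 < lam)
    {G : V → ℝ} (hG : ContDiff ℝ ∞ G) {K K' : ℝ} (hK0 : 0 ≤ K)
    (hK : ∀ x, ‖∇ G x‖ ≤ K * (1 + ‖x‖)) (hK' : ∀ x, |G x| ≤ K' * (1 + ‖x‖ ^ 2))
    {t : ℝ} (ht : 0 < t) :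
    Integrable (fun p => inner ℝ (∇ G (noisyMap b lam t p))
        (-b p.1 + (lam / √(2 * lam * t)) • p.2)) (μ.prod (stdGaussian V)) ∧
    HasDerivAt (fun s => ∫ p, G (noisyMap b lam s p) ∂(μ.prod (stdGaussian V)))
      (∫ p, inner ℝ (∇ G (noisyMap b lam t p)) (-b p.1 + (lam / √(2 * lam * t)) • p.2)
        ∂(μ.prod (stdGaussian V))) t := by
  have hmeas := fun s => measurable_noisyMap hb lam s
  have hGc := (continuous_gradient hG).measurable
  set A : ℝ := 1 + 2 * t * C + √(2 * lam * (2 * t)) with hA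
  set B : ℝ := C + lam / √(lam * t) with hB
  have hA0 : 0 ≤ A := by positivity
  have hB0 : 0 ≤ B := by positivity
  refine hasDerivAt_integral_of_dominated_loc_of_deriv_le (s := Set.Ioo (t / 2) (2 * t))
    (F := fun s p => G (noisyMap b lam s p))
    (F' := fun s p => inner ℝ (∇ G (noisyMap b lam s p))
      (-b p.1 + (lam / √(2 * lam * s)) • p.2))
    (bound := fun p => K * (1 + A) * B * (1 + ‖p.1‖ + ‖p.2‖) ^ 2)
    (Ioo_mem_nhds (by linarith) (by linarith))
    (Filter.Eventually.of_forall fun s => (hG.continuous.measurable.comp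
      (hmeas s)).aestronglyMeasurable)
    (integrable_of_quadratic_growth (integrable_norm_noisyMap_sq hb hC hμ t)
      (hmeas t).aemeasurable hG.continuous.measurable hK') ?_ ?_
    ((integrable_one_add_norms_sq hμ).const_mul _) ?_
  · have h1 := hGc.comp (hmeas t)
    have : Measurable fun p : V × V => inner ℝ (∇ G (noisyMap b lam t p))
      (-b p.1 + (lam / √(2 * lam * t)) • p.2) := h1.inner (by fun_prop)
    exact this.aestronglyMeasurable
  · refine ae_of_all _ fun p s hs => ?_
    have hs0 : 0 < s := by linarith [hs.1]
    set n : ℝ := 1 + ‖p.1‖ + ‖p.2‖ with hn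
    have hn1 : 1 ≤ n := by rw [hn]; linarith [norm_nonneg p.1, norm_nonneg p.2]
    have h1 : ‖∇ G (noisyMap b lam s p)‖ ≤ K * (1 + A) * n := by
      have h2 := norm_noisyMap_le hC0 hC hlam.le hs0.le hs.2.le p
      calc _ ≤ K * (1 + ‖noisyMap b lam s p‖) := hK _
        _ ≤ K * (1 * n + A * n) := by rw [one_mul]; gcongr
        _ = _ := by ring
    have h2 : ‖-b p.1 + (lam / √(2 * lam * s)) • p.2‖ ≤ B * n := by
      refine (norm_add_le _ _).trans ?_
      rw [norm_neg, norm_smul, Real.norm_of_nonneg (by positivity)]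
      have h3 : lam / √(2 * lam * s) ≤ lam / √(lam * t) := by
        have : lam * t ≤ 2 * lam * s := by nlinarith [hs.1]
        gcongr
      have h4 : lam / √(2 * lam * s) * ‖p.2‖ ≤ lam / √(lam * t) * ‖p.2‖ := by gcongr
      have h5 := hC p.1
      have h6 : 0 ≤ lam / √(lam * t) := by positivity
      have h7 := norm_nonneg p.1
      have h8 := norm_nonneg p.2
      rw [hB, hn]
      nlinarith [mul_nonneg hC0 h8, mul_nonneg h6 h7]
    calc _ ≤ ‖∇ G (noisyMap b lam s p)‖ * ‖-b p.1 + (lam / √(2 * lam * s)) • p.2‖ :=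
          norm_inner_le_norm _ _
      _ ≤ (K * (1 + A) * n) * (B * n) := by gcongr
      _ = _ := by ring
  · refine ae_of_all _ fun p s hs => ?_
    have hs0 : 0 < s := by linarith [hs.1]
    have h1 : HasGradientAt G (∇ G (noisyMap b lam s p)) (noisyMap b lam s p) :=
      (hG.differentiable (by simp) _).hasGradientAt
    have h2 : HasDerivAt (fun s => G (noisyMap b lam s p)) _ s :=
      h1.hasFDerivAt.comp_hasDerivAt s (hasDerivAt_noisyMap b hlam hs0 p)
    exact h2.congr_deriv (by simp)

lemma integrable_norm_comp_noisyMap_sq (hb : Measurable b)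
    (hC : ∀ y, ‖b y‖ ≤ C * (1 + ‖y‖)) (hμ : Integrable (fun y => ‖y‖ ^ 2) μ) (s : ℝ)
    {W : V → V} (hW : Measurable W) {K : ℝ} (hK : ∀ x, ‖W x‖ ≤ K * (1 + ‖x‖)) :
    Integrable (fun p => ‖W (noisyMap b lam s p)‖ ^ 2) (μ.prod (stdGaussian V)) := by
  refine integrable_of_quadratic_growth (f := fun x => ‖W x‖ ^ 2) (C := 2 * K ^ 2)
    (integrable_norm_noisyMap_sq hb hC hμ s) (measurable_noisyMap hb lam s).aemeasurable
    (hW.norm.pow_const 2) fun x => ?_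
  rw [abs_of_nonneg (by positivity)]
  have h1 : ‖W x‖ ^ 2 ≤ K ^ 2 * (1 + ‖x‖) ^ 2 := by
    rw [← mul_pow]; exact pow_le_pow_left₀ (norm_nonneg _) (hK x) 2
  have h2 : (1 + ‖x‖) ^ 2 ≤ 2 * (1 + ‖x‖ ^ 2) := by nlinarith [sq_nonneg (1 - ‖x‖)]
  calc _ ≤ K ^ 2 * (1 + ‖x‖) ^ 2 := h1
    _ ≤ K ^ 2 * (2 * (1 + ‖x‖ ^ 2)) := by gcongr
    _ = _ := by ring

/-- The dissipation estimate: for `G = f + λ log q_t` the derivative of `E G(X_s)` at `s = t` is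
`E⟨∇G(X_t), -∇G(X_t) + (∇f(X_t) - b(X))⟩`, at most
`-½ E‖∇G(X_t)‖² + ½ E‖b(X) - ∇f(X_t)‖²`. -/
lemma integral_inner_gradient_le {μ : Measure V} [IsProbabilityMeasure μ] (hb : Measurable b)
    (hC : ∀ y, ‖b y‖ ≤ C * (1 + ‖y‖)) (hμ : Integrable (fun y => ‖y‖ ^ 2) μ) (hlam : 0 < lam)
    {t : ℝ} (ht : 0 < t) {f : V → ℝ} (hf : ContDiff ℝ ∞ f) {Cf K : ℝ}
    (hCf : ∀ x, ‖∇ f x‖ ≤ Cf * (1 + ‖x‖))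
    (hK : ∀ x, ‖∇ (fun x => f x + lam * Real.log (stepDensity μ b lam t x)) x‖ ≤ K * (1 + ‖x‖)) :
    ∫ p, inner ℝ (∇ (fun x => f x + lam * Real.log (stepDensity μ b lam t x))
        (noisyMap b lam t p)) (-b p.1 + (lam / √(2 * lam * t)) • p.2) ∂(μ.prod (stdGaussian V)) ≤
      -(1 / 2) * ∫ p, ‖∇ (fun x => f x + lam * Real.log (stepDensity μ b lam t x))
        (noisyMap b lam t p)‖ ^ 2 ∂(μ.prod (stdGaussian V)) +
      1 / 2 * ∫ p, ‖b p.1 - ∇ f (noisyMap b lam t p)‖ ^ 2 ∂(μ.prod (stdGaussian V)) := by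
  have hv : 0 < 2 * lam * t := by positivity
  have hm := measurable_driftMap hb t
  have hsv : 0 < √(2 * lam * t) := Real.sqrt_pos.2 hv
  have hlog := contDiff_log_smoothing (μ := μ) hm hv
  set ℓ : V → ℝ := fun x => Real.log (stepDensity μ b lam t x)
  have hℓs : ContDiff ℝ ∞ ℓ := hlog
  have hGe : ∀ x, ∇ (fun x => f x + lam * ℓ x) x = ∇ f x + lam • ∇ ℓ x := by
    intro x
    have h1 : HasGradientAt f (∇ f x) x := (hf.differentiable (by simp) _).hasGradientAt
    have h2 : HasGradientAt ℓ (∇ ℓ x) x := (hℓs.differentiable (by simp) _).hasGradientAt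
    refine HasGradientAt.gradient ?_
    rw [hasGradientAt_iff_hasFDerivAt] at h1 h2 ⊢
    refine (h1.add (h2.const_mul lam)).congr_fderiv ?_
    ext w
    simp
  have hGs : ContDiff ℝ ∞ (fun x => f x + lam * ℓ x) := hf.add (contDiff_const.mul hℓs)
  set H : V → V := ∇ (fun x => f x + lam * ℓ x)
  have hHm : Measurable H := (continuous_gradient hGs).measurable
  have hfm : Measurable (∇ f) := (continuous_gradient hf).measurable
  have hXm := measurable_noisyMap hb lam t
  have hb1 : Integrable (fun p : V × V => ‖b p.1‖ ^ 2) (μ.prod (stdGaussian V)) := by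
    have : Integrable (fun p : V × V => ‖p.1‖ ^ 2) (μ.prod (stdGaussian V)) :=
      hμ.comp_fst (stdGaussian V)
    refine integrable_of_quadratic_growth (f := fun x => ‖b x‖ ^ 2) (C := 2 * C ^ 2)
      this measurable_fst.aemeasurable (hb.norm.pow_const 2) fun x => ?_
    rw [abs_of_nonneg (by positivity)]
    have h1 : ‖b x‖ ^ 2 ≤ C ^ 2 * (1 + ‖x‖) ^ 2 := by
      rw [← mul_pow]; exact pow_le_pow_left₀ (norm_nonneg _) (hC x) 2
    have h2 : (1 + ‖x‖) ^ 2 ≤ 2 * (1 + ‖x‖ ^ 2) := by nlinarith [sq_nonneg (1 - ‖x‖)]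
    calc _ ≤ C ^ 2 * (1 + ‖x‖) ^ 2 := h1
      _ ≤ C ^ 2 * (2 * (1 + ‖x‖ ^ 2)) := by gcongr
      _ = _ := by ring
  have hz : Integrable (fun p : V × V => ‖p.2‖ ^ 2) (μ.prod (stdGaussian V)) :=
    (integrable_norm_sq_stdGaussian (V := V)).comp_snd μ
  have hH2 : Integrable (fun p => ‖H (noisyMap b lam t p)‖ ^ 2) (μ.prod (stdGaussian V)) :=
    integrable_norm_comp_noisyMap_sq hb hC hμ t hHm hK
  have hf2 : Integrable (fun p => ‖∇ f (noisyMap b lam t p)‖ ^ 2) (μ.prod (stdGaussian V)) :=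
    integrable_norm_comp_noisyMap_sq hb hC hμ t hfm hCf
  have inner_int : ∀ {u w : V × V → V}, Measurable u → Measurable w →
      Integrable (fun p => ‖u p‖ ^ 2) (μ.prod (stdGaussian V)) →
      Integrable (fun p => ‖w p‖ ^ 2) (μ.prod (stdGaussian V)) →
      Integrable (fun p => inner ℝ (u p) (w p)) (μ.prod (stdGaussian V)) := by
    intro u w hu hw hu2 hw2
    refine (hu2.add hw2).mono' (hu.inner hw).aestronglyMeasurable (ae_of_all _ fun p => ?_)
    have := norm_inner_le_norm (𝕜 := ℝ) (u p) (w p)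
    simp only [Pi.add_apply]
    nlinarith [sq_nonneg (‖u p‖ - ‖w p‖), sq_nonneg ‖u p‖, sq_nonneg ‖w p‖]
  have hHX := hHm.comp hXm
  have hfX := hfm.comp hXm
  have hbf : Integrable (fun p => ‖b p.1 - ∇ f (noisyMap b lam t p)‖ ^ 2)
      (μ.prod (stdGaussian V)) := by
    refine ((hb1.const_mul 2).add (hf2.const_mul 2)).mono'
      (((hb.comp measurable_fst).sub hfX).norm.pow_const 2).aestronglyMeasurable
      (ae_of_all _ fun p => ?_)
    rw [Real.norm_of_nonneg (by positivity)]
    have := norm_add_sq_le_two (b p.1) (-∇ f (noisyMap b lam t p))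
    rwa [norm_neg, ← sub_eq_add_neg] at this
  have stein := integral_inner_noise (μ := μ) hm hv (integrable_norm_driftMap_sq hb hC hμ t)
    hHm hK
  have i1 := inner_int hHX (hb.comp measurable_fst) hH2 hb1
  have i2 := inner_int hHX measurable_snd hH2 hz
  have i3 : Integrable (fun p => inner ℝ (H (noisyMap b lam t p)) (∇ ℓ (noisyMap b lam t p)))
      (μ.prod (stdGaussian V)) := by
    have e : ∀ x, ∇ ℓ x = lam⁻¹ • (H x - ∇ f x) := by
      intro x; rw [hGe, add_sub_cancel_left, smul_smul, inv_mul_cancel₀ hlam.ne', one_smul]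
    simp_rw [e, real_inner_smul_right, inner_sub_right]
    exact ((inner_int hHX hHX hH2 hH2).sub (inner_int hHX hfX hH2 hf2)).const_mul _
  simp only [Function.comp_apply] at i1 i2
  have i1n : Integrable (fun p => -inner ℝ (H (noisyMap b lam t p)) (b p.1))
      (μ.prod (stdGaussian V)) := i1.neg
  have i3n : Integrable (fun p => -(lam * inner ℝ (H (noisyMap b lam t p))
      (∇ ℓ (noisyMap b lam t p)))) (μ.prod (stdGaussian V)) := (i3.const_mul lam).neg
  have e1 : ∫ p, inner ℝ (H (noisyMap b lam t p)) (-b p.1 + (lam / √(2 * lam * t)) • p.2)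
      ∂(μ.prod (stdGaussian V)) = -(∫ p, inner ℝ (H (noisyMap b lam t p)) (b p.1)
      ∂(μ.prod (stdGaussian V))) + (lam / √(2 * lam * t)) *
        ∫ p, inner ℝ (H (noisyMap b lam t p)) p.2 ∂(μ.prod (stdGaussian V)) := by
    simp_rw [inner_add_right, inner_neg_right, real_inner_smul_right]
    rw [integral_add i1n (i2.const_mul _), integral_neg, integral_const_mul]
  have e2 : (lam / √(2 * lam * t)) *
        ∫ p, inner ℝ (H (noisyMap b lam t p)) p.2 ∂(μ.prod (stdGaussian V)) =
      -(lam * ∫ p, inner ℝ (H (noisyMap b lam t p)) (∇ ℓ (noisyMap b lam t p))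
        ∂(μ.prod (stdGaussian V))) := by
    have : ∫ p, inner ℝ (H (noisyMap b lam t p)) p.2 ∂(μ.prod (stdGaussian V)) =
        -√(2 * lam * t) * ∫ p, inner ℝ (H (noisyMap b lam t p)) (∇ ℓ (noisyMap b lam t p))
        ∂(μ.prod (stdGaussian V)) := stein
    rw [this]
    field_simp
  rw [e1, e2, ← integral_neg, ← integral_const_mul, ← integral_neg,
    ← integral_add i1n i3n, ← integral_const_mul, ← integral_const_mul,
    ← integral_add (hH2.const_mul _) (hbf.const_mul _)]
  refine integral_mono (i1n.add i3n)
    ((hH2.const_mul _).add (hbf.const_mul _)) fun p => ?_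
  have h1 := hGe (noisyMap b lam t p)
  have h2 := norm_sub_sq_real (H (noisyMap b lam t p))
    (∇ f (noisyMap b lam t p) - b p.1)
  have h3 : inner ℝ (H (noisyMap b lam t p)) (H (noisyMap b lam t p)) =
      inner ℝ (H (noisyMap b lam t p)) (∇ f (noisyMap b lam t p)) +
      lam * inner ℝ (H (noisyMap b lam t p)) (∇ ℓ (noisyMap b lam t p)) := by
    rw [← real_inner_smul_right, ← inner_add_right, ← h1]
  rw [real_inner_self_eq_norm_sq] at h3
  rw [inner_sub_right, norm_sub_rev (∇ f (noisyMap b lam t p)) (b p.1)] at h2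
  have h4 := sq_nonneg ‖H (noisyMap b lam t p) - (∇ f (noisyMap b lam t p) - b p.1)‖
  simp only
  linarith

end NoisyStep

/-! ### Continuity in time of the density -/

section Scheffe

/-- Scheffé's lemma: pointwise convergence of non-negative functions together with convergence of
the integrals implies convergence in `L¹`. -/
lemma tendsto_integral_abs_sub {α ι : Type*} [MeasurableSpace α] {μ : Measure α} {l : Filter ι}
    [l.IsCountablyGenerated] {f : ι → α → ℝ} {g : α → ℝ} (hf : ∀ᶠ i in l, Integrable (f i) μ)
    (hf0 : ∀ᶠ i in l, ∀ x, 0 ≤ f i x) (hg : Integrable g μ) (hg0 : ∀ x, 0 ≤ g x)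
    (hfg : ∀ x, Tendsto (fun i => f i x) l (𝓝 (g x)))
    (hint : Tendsto (fun i => ∫ x, f i x ∂μ) l (𝓝 (∫ x, g x ∂μ))) :
    Tendsto (fun i => ∫ x, |f i x - g x| ∂μ) l (𝓝 0) := by
  have h1 : Tendsto (fun i => ∫ x, max (g x - f i x) 0 ∂μ) l (𝓝 (∫ _, (0 : ℝ) ∂μ)) := by
    refine tendsto_integral_filter_of_dominated_convergence g ?_ ?_ hg ?_
    · filter_upwards [hf] with i hi using
        ((hg.sub hi).aestronglyMeasurable.sup aestronglyMeasurable_const)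
    · filter_upwards [hf0] with i hi
      refine ae_of_all _ fun x => ?_
      rw [Real.norm_of_nonneg (le_max_right _ _)]
      exact max_le (by linarith [hi x]) (hg0 x)
    · refine ae_of_all _ fun x => ?_
      have := ((tendsto_const_nhds (x := g x)).sub (hfg x)).max (tendsto_const_nhds (x := (0 : ℝ)))
      simpa using this
  have h2 : Tendsto (fun i => ∫ x, f i x ∂μ - ∫ x, g x ∂μ + 2 * ∫ x, max (g x - f i x) 0 ∂μ) l
      (𝓝 0) := by
    have := (hint.sub_const (∫ x, g x ∂μ)).add (h1.const_mul 2)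
    simpa using this
  refine h2.congr' ?_
  filter_upwards [hf] with i hi
  have hm : Integrable (fun x => max (g x - f i x) 0) μ := (hg.sub hi).pos_part
  have hd : Integrable (fun x => f i x - g x) μ := hi.sub hg
  rw [← integral_sub hi hg, ← integral_const_mul, ← integral_add hd (hm.const_mul 2)]
  refine integral_congr_ae (ae_of_all _ fun x => ?_)
  simp only
  rcases le_total (g x) (f i x) with h | h
  · rw [max_eq_right (by linarith), abs_of_nonneg (by linarith)]; simp
  · rw [max_eq_left (by linarith), abs_of_nonpos (by linarith)]; simp; ring

end Scheffe

section WeightedContinuity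

variable {V : Type*} [NormedAddCommGroup V] [InnerProductSpace ℝ V] [FiniteDimensional ℝ V]
  [MeasurableSpace V] [BorelSpace V]
variable {μ : Measure V} [IsFiniteMeasure μ] {b : V → V} {lam : ℝ} {C : ℝ}

lemma continuous_noisyMap_right (b : V → V) (lam : ℝ) (p : V × V) :
    Continuous fun s => noisyMap b lam s p := by
  unfold noisyMap driftMap
  fun_prop

/-- Right continuity of the second moment of the noisy step. -/
lemma tendsto_integral_weight_noisyMap (hb : Measurable b) (hC0 : 0 ≤ C)
    (hC : ∀ y, ‖b y‖ ≤ C * (1 + ‖y‖)) (hμ : Integrable (fun y => ‖y‖ ^ 2) μ) (hlam : 0 < lam)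
    {t : ℝ} (ht : 0 ≤ t) :
    Tendsto (fun s => ∫ p, (1 + ‖noisyMap b lam s p‖ ^ 2) ∂(μ.prod (stdGaussian V))) (𝓝[>] t)
      (𝓝 (∫ p, (1 + ‖noisyMap b lam t p‖ ^ 2) ∂(μ.prod (stdGaussian V)))) := by
  refine tendsto_integral_filter_of_dominated_convergence
    (fun p => 1 + (1 + (t + 1) * C + √(2 * lam * (t + 1))) ^ 2 * (1 + ‖p.1‖ + ‖p.2‖) ^ 2)
    (Eventually.of_forall fun s => ?_) ?_ ?_ ?_
  · exact ((measurable_noisyMap hb lam s).norm.pow_const 2).const_add 1 |>.aestronglyMeasurable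
  · have : ∀ᶠ s in 𝓝[>] t, s < t + 1 := nhdsWithin_le_nhds (Iio_mem_nhds (by linarith))
    filter_upwards [this, self_mem_nhdsWithin] with s hs hst
    refine ae_of_all _ fun p => ?_
    rw [Real.norm_of_nonneg (by positivity), ← mul_pow]
    have := norm_noisyMap_le hC0 hC hlam.le (ht.trans (le_of_lt hst)) hs.le p
    gcongr
  · exact (integrable_const 1).add ((integrable_one_add_norms_sq hμ).const_mul _)
  · refine ae_of_all _ fun p => ?_
    have h := ((continuous_noisyMap_right b lam p).norm.pow 2).const_add 1
    exact (h.tendsto t).mono_left nhdsWithin_le_nhds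

lemma integral_stepDensity_mul (hb : Measurable b) (hlam : 0 < lam) {s : ℝ} (hs : 0 < s)
    {f : V → ℝ} (hf : Measurable f) :
    ∫ x, stepDensity μ b lam s x * f x =
      ∫ p, f (noisyMap b lam s p) ∂(μ.prod (stdGaussian V)) :=
  integral_smoothing_mul (measurable_driftMap hb s) (by positivity) hf

lemma integrable_stepDensity_mul (hb : Measurable b) (hlam : 0 < lam)
    (hC : ∀ y, ‖b y‖ ≤ C * (1 + ‖y‖)) (hμ : Integrable (fun y => ‖y‖ ^ 2) μ) {s : ℝ} (hs : 0 < s)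
    {f : V → ℝ} (hf : Measurable f) {K : ℝ} (hK : ∀ x, |f x| ≤ K * (1 + ‖x‖ ^ 2)) :
    Integrable (fun x => stepDensity μ b lam s x * f x) :=
  integrable_smoothing_mul (measurable_driftMap hb s) (by positivity)
    (integrable_norm_driftMap_sq hb hC hμ s) hf hK

lemma measurable_stepDensity (hb : Measurable b) (lam s : ℝ) :
    Measurable (stepDensity μ b lam s) :=
  measurable_smoothing (measurable_driftMap hb s)

lemma stepDensity_nonneg (hlam : 0 < lam) {s : ℝ} (hs : 0 < s) (x : V) :
    0 ≤ stepDensity μ b lam s x := smoothing_nonneg (by positivity) x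

lemma continuousAt_gaussianConst {v : ℝ} (hv : 0 < v) : ContinuousAt (gaussianConst V) v := by
  have h1 : ContinuousAt (fun v : ℝ => (2 * Real.pi * v) ^ (Module.finrank ℝ V / 2 : ℝ)) v :=
    ContinuousAt.rpow_const (by fun_prop) (Or.inl (by positivity))
  exact h1.inv₀ (by positivity)

lemma tendsto_stepDensity (hb : Measurable b) (hlam : 0 < lam) {t : ℝ} (ht : 0 < t) (x : V) :
    Tendsto (fun s => stepDensity μ b lam s x) (𝓝 t) (𝓝 (stepDensity μ b lam t x)) := by
  have hv : 0 < 2 * lam * t := by positivity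
  have hcont : ContinuousAt (fun s => gaussianConst V (2 * lam * s)) t :=
    ContinuousAt.comp (g := gaussianConst V) (f := fun s => 2 * lam * s)
      (continuousAt_gaussianConst hv) (by fun_prop)
  refine tendsto_integral_filter_of_dominated_convergence
    (fun _ => gaussianConst V (2 * lam * t) + 1) (Eventually.of_forall fun s => ?_) ?_
    (integrable_const _) ?_
  · exact ((continuous_gaussianDensity _).measurable.comp
      ((measurable_driftMap hb s).const_sub x)).aestronglyMeasurable
  · have h1 : ∀ᶠ s in 𝓝 t, gaussianConst V (2 * lam * s) < gaussianConst V (2 * lam * t) + 1 :=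
      hcont.eventually_lt_const (by linarith)
    filter_upwards [h1, Ioi_mem_nhds ht] with s hs hs0
    have hs0' : 0 < 2 * lam * s := mul_pos (by positivity) hs0
    refine ae_of_all _ fun y => ?_
    rw [Real.norm_of_nonneg (gaussianDensity_pos hs0' _).le]
    exact (gaussianDensity_le hs0' _).trans hs.le
  · refine ae_of_all _ fun y => ?_
    have h2 : ContinuousAt (fun s => Real.exp (-‖x - driftMap b s y‖ ^ 2 / (2 * (2 * lam * s)))) t := by
      unfold driftMap
      refine Real.continuous_exp.continuousAt.comp (ContinuousAt.div (by fun_prop) (by fun_prop) ?_)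
      positivity
    exact (hcont.mul h2).tendsto

/-- Continuity in weighted `L¹` of the density of the noisy step at positive times. -/
lemma tendsto_integral_weight_abs_sub (hb : Measurable b) (hC0 : 0 ≤ C)
    (hC : ∀ y, ‖b y‖ ≤ C * (1 + ‖y‖)) (hμ : Integrable (fun y => ‖y‖ ^ 2) μ) (hlam : 0 < lam)
    {t : ℝ} (ht : 0 < t) :
    Tendsto (fun s => ∫ x, (1 + ‖x‖ ^ 2) * |stepDensity μ b lam s x - stepDensity μ b lam t x|)
      (𝓝[>] t) (𝓝 0) := by
  have hw : Measurable fun x : V => 1 + ‖x‖ ^ 2 := by fun_prop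
  have hwb : ∀ x : V, |1 + ‖x‖ ^ 2| ≤ 1 * (1 + ‖x‖ ^ 2) := fun x => by
    rw [one_mul, abs_of_nonneg (by positivity)]
  have hpos : ∀ᶠ s in 𝓝[>] t, 0 < s := by
    filter_upwards [self_mem_nhdsWithin] with s hs using ht.trans hs
  have h := tendsto_integral_abs_sub (l := 𝓝[>] t) (μ := (volume : Measure V))
    (f := fun s x => stepDensity μ b lam s x * (1 + ‖x‖ ^ 2))
    (g := fun x => stepDensity μ b lam t x * (1 + ‖x‖ ^ 2))
    (hpos.mono fun s hs => integrable_stepDensity_mul hb hlam hC hμ hs hw hwb)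
    (hpos.mono fun s hs x => mul_nonneg (stepDensity_nonneg hlam hs x) (by positivity))
    (integrable_stepDensity_mul hb hlam hC hμ ht hw hwb)
    (fun x => mul_nonneg (stepDensity_nonneg hlam ht x) (by positivity))
    (fun x => ((tendsto_stepDensity hb hlam ht x).mono_left nhdsWithin_le_nhds).mul_const _)
    (by
      rw [integral_stepDensity_mul hb hlam ht hw]
      refine (tendsto_integral_weight_noisyMap hb hC0 hC hμ hlam ht.le).congr' ?_
      filter_upwards [hpos] with s hs using (integral_stepDensity_mul hb hlam hs hw).symm)
  refine h.congr fun s => integral_congr_ae (ae_of_all _ fun x => ?_)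
  simp only
  rw [← sub_mul, abs_mul, abs_of_nonneg (by positivity : 0 ≤ 1 + ‖x‖ ^ 2), mul_comm]

lemma gaussianDensity_smul {r : ℝ} (hr : 0 < r) (z : V) :
    gaussianDensity (r ^ 2) (r • z) = (r ^ Module.finrank ℝ V)⁻¹ * gaussianDensity 1 z := by
  rw [gaussianDensity, gaussianDensity, Real.mul_rpow (by positivity) (by positivity), mul_inv,
    norm_smul, Real.norm_of_nonneg hr.le]
  have h1 : (r ^ 2) ^ (Module.finrank ℝ V / 2 : ℝ) = r ^ Module.finrank ℝ V := by
    rw [← Real.rpow_natCast r 2, ← Real.rpow_mul hr.le, ← Real.rpow_natCast]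
    congr 1; push_cast; ring
  have h2 : -(r * ‖z‖) ^ 2 / (2 * r ^ 2) = -‖z‖ ^ 2 / (2 * 1) := by field_simp
  rw [h1, h2]
  ring_nf

/-- Change of variables `y = x + r u` in the kernel integral, with `r = √(2 λ s)`. -/
lemma integral_mul_kernel_eq {r : ℝ} (hr : 0 < r) (lam : ℝ) (φ : V → ℝ) (b : V → V)
    (x : V) :
    ∫ y, φ y * gaussianDensity (r ^ 2) (x - driftMap b (r ^ 2 / (2 * lam)) y) =
      ∫ u, φ (x + r • u) * gaussianDensity 1 (-u + (r / (2 * lam)) • b (x + r • u)) := by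
  rw [← integral_add_left_eq_self _ x]
  have h := Measure.integral_comp_smul (volume : Measure V) (fun y => φ (x + y) *
    gaussianDensity (r ^ 2) (x - driftMap b (r ^ 2 / (2 * lam)) (x + y))) r
  rw [abs_of_nonneg (by positivity), smul_eq_mul] at h
  have hrn : 0 < r ^ Module.finrank ℝ V := by positivity
  have h2 := congrArg (fun a => r ^ Module.finrank ℝ V * a) h
  rw [← mul_assoc, mul_inv_cancel₀ hrn.ne', one_mul, ← integral_const_mul] at h2
  rw [← h2]
  refine integral_congr_ae (ae_of_all _ fun u => ?_)
  have : x - driftMap b (r ^ 2 / (2 * lam)) (x + r • u) =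
      r • (-u + (r / (2 * lam)) • b (x + r • u)) := by
    unfold driftMap
    rw [smul_add, smul_neg, smul_smul]
    have : r * (r / (2 * lam)) = r ^ 2 / (2 * lam) := by ring
    rw [this]
    abel
  beta_reduce
  rw [this, gaussianDensity_smul hr]
  field_simp

/-- The transition kernel of the noisy step is an approximate identity as a function of the initial
point. -/
lemma tendsto_integral_mul_kernel (hb : Continuous b) (hlam : 0 < lam) {φ : V → ℝ}
    (hφ : Continuous φ) (hφc : HasCompactSupport φ) (x : V) :
    Tendsto (fun s => ∫ y, φ y * gaussianDensity (2 * lam * s) (x - driftMap b s y)) (𝓝[>] 0)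
      (𝓝 (φ x)) := by
  have hg := continuous_gaussianDensity (V := V) 1
  have hg2 := continuous_gaussianDensity (V := V) (1 / (1 - 1 / 2))
  obtain ⟨M, hM⟩ := hφc.exists_bound_of_continuous hφ
  obtain ⟨B, hB⟩ := (hφc.isCompact.image hb).isBounded.exists_norm_le
  have hM0 : 0 ≤ M := (norm_nonneg _).trans (hM 0)
  have key : Tendsto (fun r : ℝ => ∫ u, φ (x + r • u) *
      gaussianDensity 1 (-u + (r / (2 * lam)) • b (x + r • u))) (𝓝[>] 0) (𝓝 (φ x)) := by
    have e : φ x = ∫ u : V, φ x * gaussianDensity 1 u := by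
      rw [integral_const_mul, integral_gaussianDensity one_pos, mul_one]
    rw [e]
    -- dominate by the wider Gaussian of variance `2`, the drift being bounded on the support of `φ`
    set D : ℝ := M * (((1 - 1 / 2) ^ (Module.finrank ℝ V / 2 : ℝ))⁻¹ *
      Real.exp ((1 / (2 * lam) * B) ^ 2 / (1 / 2) / (2 * 1))) with hD
    refine tendsto_integral_filter_of_dominated_convergence
      (fun u => D * gaussianDensity (1 / (1 - 1 / 2)) u) (Eventually.of_forall fun r => ?_) ?_
      ((integrable_gaussianDensity (by norm_num)).const_mul D) ?_
    · exact Continuous.aestronglyMeasurable (by fun_prop)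
    · have h1 : ∀ᶠ r : ℝ in 𝓝[>] 0, r < 1 := nhdsWithin_le_nhds (Iio_mem_nhds one_pos)
      filter_upwards [h1, self_mem_nhdsWithin] with r hr hr0
      have hr0' : 0 < r := hr0
      refine ae_of_all _ fun u => ?_
      by_cases hu : x + r • u ∈ tsupport φ
      · have h2 := gaussianDensity_add_le (v := 1) (ε := 1 / 2) one_pos (by norm_num) (by norm_num)
          (-u) ((r / (2 * lam)) • b (x + r • u))
        rw [gaussianDensity_neg] at h2
        have h3 : ‖(r / (2 * lam)) • b (x + r • u)‖ ≤ 1 / (2 * lam) * B := by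
          rw [norm_smul, Real.norm_of_nonneg (by positivity)]
          have := hB _ (Set.mem_image_of_mem b hu)
          gcongr
        have h4 := gaussianDensity_pos (one_pos) (-u + (r / (2 * lam)) • b (x + r • u))
        have h5 := gaussianDensity_pos (v := 1 / (1 - 1 / 2)) (by norm_num) u
        rw [norm_mul, Real.norm_of_nonneg h4.le, hD, mul_assoc M]
        refine mul_le_mul (hM _) (h2.trans ?_) h4.le hM0
        gcongr
      · rw [image_eq_zero_of_notMem_tsupport hu]
        have h5 := gaussianDensity_pos (v := 1 / (1 - 1 / 2)) (by norm_num) u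
        rw [zero_mul, norm_zero]
        positivity
    · refine ae_of_all _ fun u => ?_
      have hc : Continuous fun r : ℝ => φ (x + r • u) *
          gaussianDensity 1 (-u + (r / (2 * lam)) • b (x + r • u)) := by fun_prop
      have := (hc.tendsto 0).mono_left (nhdsWithin_le_nhds (s := Set.Ioi 0))
      simpa [gaussianDensity_neg] using this
  have hr : Tendsto (fun s => √(2 * lam * s)) (𝓝[>] 0) (𝓝[>] 0) := by
    refine tendsto_nhdsWithin_iff.2 ⟨?_, ?_⟩
    · have : Continuous fun s => √(2 * lam * s) := by fun_prop
      simpa using (this.tendsto 0).mono_left (nhdsWithin_le_nhds (s := Set.Ioi 0))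
    · filter_upwards [self_mem_nhdsWithin] with s hs
      have : 0 < s := hs
      exact Real.sqrt_pos.2 (by positivity)
  refine (key.comp hr).congr' ?_
  filter_upwards [self_mem_nhdsWithin] with s hs
  have hs0 : 0 < s := hs
  have hv : 0 < 2 * lam * s := by positivity
  have h := integral_mul_kernel_eq (Real.sqrt_pos.2 hv) lam φ b x
  rw [Real.sq_sqrt hv.le, mul_div_cancel_left₀ _ (by positivity : 2 * lam ≠ 0)] at h
  exact h.symm

end WeightedContinuity

/-! ### Continuity of the density at time zero -/

section InitialContinuity

variable {V : Type*} [NormedAddCommGroup V] [InnerProductSpace ℝ V] [FiniteDimensional ℝ V]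
  [MeasurableSpace V] [BorelSpace V]
variable {b : V → V} {lam : ℝ} {C : ℝ}

/-- The measure with real-valued density `q`. -/
noncomputable def densityMeasure (q : V → ℝ) : Measure V :=
  volume.withDensity fun x => ENNReal.ofReal (q x)

lemma isFiniteMeasure_densityMeasure {q : V → ℝ} (hq : Integrable q) :
    IsFiniteMeasure (densityMeasure q) :=
  isFiniteMeasure_withDensity_ofReal hq.hasFiniteIntegral

lemma integral_densityMeasure {q : V → ℝ} (hq : Measurable q) (hq0 : ∀ x, 0 ≤ q x) (f : V → ℝ) :
    ∫ x, f x ∂(densityMeasure q) = ∫ x, q x * f x := by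
  rw [densityMeasure, integral_withDensity_eq_integral_toReal_smul hq.ennreal_ofReal (by simp)]
  simp_rw [ENNReal.toReal_ofReal (hq0 _), smul_eq_mul]

lemma integrable_densityMeasure_iff {q : V → ℝ} (hq : Measurable q) (hq0 : ∀ x, 0 ≤ q x)
    {f : V → ℝ} : Integrable f (densityMeasure q) ↔ Integrable fun x => q x * f x := by
  rw [densityMeasure, integrable_withDensity_iff_integrable_smul' hq.ennreal_ofReal (by simp)]
  simp_rw [ENNReal.toReal_ofReal (hq0 _), smul_eq_mul]

lemma stepDensity_densityMeasure {q : V → ℝ} (hq : Measurable q) (hq0 : ∀ x, 0 ≤ q x) (s : ℝ)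
    (x : V) : stepDensity (densityMeasure q) b lam s x =
      ∫ y, q y * gaussianDensity (2 * lam * s) (x - driftMap b s y) :=
  integral_densityMeasure hq hq0 _

lemma integrable_mul_kernel (hb : Measurable b) (hlam : 0 < lam) {q : V → ℝ} (hq : Integrable q)
    {s : ℝ} (hs : 0 < s) (x : V) :
    Integrable fun y => q y * gaussianDensity (2 * lam * s) (x - driftMap b s y) := by
  have hv : 0 < 2 * lam * s := by positivity
  refine hq.mul_bdd (c := gaussianConst V (2 * lam * s))
    ((continuous_gaussianDensity _).measurable.comp
      ((measurable_driftMap hb s).const_sub x)).aestronglyMeasurable (ae_of_all _ fun y => ?_)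
  rw [Real.norm_of_nonneg (gaussianDensity_pos hv _).le]
  exact gaussianDensity_le hv _

/-- Stability of the noisy step in weighted `L¹`, for step sizes at most `1`. -/
lemma exists_integral_weight_stepDensity_le (hb : Measurable b) (hC0 : 0 ≤ C)
    (hC : ∀ y, ‖b y‖ ≤ C * (1 + ‖y‖)) (hlam : 0 < lam) :
    ∃ D : ℝ, 0 ≤ D ∧ ∀ (μ : Measure V) [IsFiniteMeasure μ], Integrable (fun y => ‖y‖ ^ 2) μ →
      ∀ s, 0 < s → s ≤ 1 →
        ∫ x, stepDensity μ b lam s x * (1 + ‖x‖ ^ 2) ≤ D * ∫ y, (1 + ‖y‖ ^ 2) ∂μ := by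
  set A : ℝ := 1 + 1 * C + √(2 * lam * 1)
  refine ⟨(1 + 3 * A ^ 2) * ∫ z : V, (1 + ‖z‖ ^ 2) ∂(stdGaussian V),
    mul_nonneg (by positivity) (integral_nonneg fun z => by positivity), fun μ _ hμ s hs hs1 => ?_⟩
  rw [integral_stepDensity_mul hb hlam hs (by fun_prop)]
  have h1 := integral_prod_mul (μ := μ) (ν := stdGaussian V) (fun y : V => 1 + ‖y‖ ^ 2)
    (fun z : V => 1 + ‖z‖ ^ 2)
  have hi := ((integrable_const 1).add hμ).mul_prod
    ((integrable_const 1).add (integrable_norm_sq_stdGaussian (V := V)))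
  calc ∫ p, (1 + ‖noisyMap b lam s p‖ ^ 2) ∂(μ.prod (stdGaussian V))
      ≤ ∫ p : V × V, (1 + 3 * A ^ 2) * ((1 + ‖p.1‖ ^ 2) * (1 + ‖p.2‖ ^ 2))
          ∂(μ.prod (stdGaussian V)) := by
        refine integral_mono ((integrable_const 1).add (integrable_norm_noisyMap_sq hb hC hμ s))
          (hi.const_mul _) fun p => ?_
        have h2 := norm_noisyMap_le hC0 hC hlam.le hs.le hs1 p
        have h3 : ‖noisyMap b lam s p‖ ^ 2 ≤ A ^ 2 * (1 + ‖p.1‖ + ‖p.2‖) ^ 2 := by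
          rw [← mul_pow]; exact pow_le_pow_left₀ (norm_nonneg _) h2 2
        have h4 : (1 + ‖p.1‖ + ‖p.2‖) ^ 2 ≤ 3 * ((1 + ‖p.1‖ ^ 2) * (1 + ‖p.2‖ ^ 2)) := by
          nlinarith [sq_nonneg (1 - ‖p.1‖), sq_nonneg (1 - ‖p.2‖), sq_nonneg (‖p.1‖ - ‖p.2‖),
            mul_nonneg (sq_nonneg ‖p.1‖) (sq_nonneg ‖p.2‖)]
        have h5 : A ^ 2 * (1 + ‖p.1‖ + ‖p.2‖) ^ 2 ≤
          A ^ 2 * (3 * ((1 + ‖p.1‖ ^ 2) * (1 + ‖p.2‖ ^ 2))) := by gcongr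
        have h6 : 1 ≤ (1 + ‖p.1‖ ^ 2) * (1 + ‖p.2‖ ^ 2) := by
          nlinarith [sq_nonneg ‖p.1‖, sq_nonneg ‖p.2‖,
            mul_nonneg (sq_nonneg ‖p.1‖) (sq_nonneg ‖p.2‖)]
        simp only
        linarith
    _ = (1 + 3 * A ^ 2) * ((∫ y, (1 + ‖y‖ ^ 2) ∂μ) * ∫ z : V, (1 + ‖z‖ ^ 2) ∂(stdGaussian V)) := by
        rw [integral_const_mul, h1]
    _ = _ := by ring

lemma noisyMap_zero (b : V → V) (lam : ℝ) (p : V × V) : noisyMap b lam 0 p = p.1 := by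
  simp [noisyMap, driftMap]

/-- Continuity at time zero for continuous initial densities of compact support. -/
lemma tendsto_integral_weight_of_hasCompactSupport (hb : Continuous b) (hC0 : 0 ≤ C)
    (hC : ∀ y, ‖b y‖ ≤ C * (1 + ‖y‖)) (hlam : 0 < lam) {φ : V → ℝ} (hφ : Continuous φ)
    (hφc : HasCompactSupport φ) (hφ0 : ∀ x, 0 ≤ φ x) :
    Tendsto (fun s => ∫ x, (1 + ‖x‖ ^ 2) * |stepDensity (densityMeasure φ) b lam s x - φ x|)
      (𝓝[>] 0) (𝓝 0) := by
  have hφi : Integrable φ := hφ.integrable_of_hasCompactSupport hφc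
  have := isFiniteMeasure_densityMeasure hφi
  have hφ2 : Integrable (fun y => ‖y‖ ^ 2) (densityMeasure φ) :=
    (integrable_densityMeasure_iff hφ.measurable hφ0).2
      ((by fun_prop : Continuous fun x => φ x * ‖x‖ ^ 2).integrable_of_hasCompactSupport
        hφc.mul_right)
  have hw : Measurable fun x : V => 1 + ‖x‖ ^ 2 := by fun_prop
  have hwb : ∀ x : V, |1 + ‖x‖ ^ 2| ≤ 1 * (1 + ‖x‖ ^ 2) := fun x => by
    rw [one_mul, abs_of_nonneg (by positivity)]
  have hpos : ∀ᶠ s : ℝ in 𝓝[>] 0, 0 < s := self_mem_nhdsWithin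
  have h := tendsto_integral_abs_sub (l := 𝓝[>] 0) (μ := (volume : Measure V))
    (f := fun s x => stepDensity (densityMeasure φ) b lam s x * (1 + ‖x‖ ^ 2))
    (g := fun x => φ x * (1 + ‖x‖ ^ 2))
    (hpos.mono fun s hs => integrable_stepDensity_mul hb.measurable hlam hC hφ2 hs hw hwb)
    (hpos.mono fun s hs x => mul_nonneg (stepDensity_nonneg hlam hs x) (by positivity))
    ((by fun_prop : Continuous fun x => φ x * (1 + ‖x‖ ^ 2)).integrable_of_hasCompactSupport
        hφc.mul_right)
    (fun x => mul_nonneg (hφ0 x) (by positivity))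
    (fun x => by
      have := tendsto_integral_mul_kernel hb hlam hφ hφc x
      simp_rw [← stepDensity_densityMeasure hφ.measurable hφ0] at this
      exact this.mul_const _)
    (by
      have h1 := tendsto_integral_weight_noisyMap hb.measurable hC0 hC hφ2 hlam le_rfl
      simp_rw [noisyMap_zero] at h1
      rw [integral_fun_fst (fun y : V => 1 + ‖y‖ ^ 2), probReal_univ, one_smul,
        integral_densityMeasure hφ.measurable hφ0] at h1
      refine h1.congr' ?_
      filter_upwards [hpos] with s hs using
        (integral_stepDensity_mul hb.measurable hlam hs hw).symm)
  refine h.congr fun s => integral_congr_ae (ae_of_all _ fun x => ?_)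
  simp only
  rw [← sub_mul, abs_mul, abs_of_nonneg (by positivity : 0 ≤ 1 + ‖x‖ ^ 2), mul_comm]

/-- Continuity at time zero, in weighted `L¹`, of the density of the noisy step. The initial density
is approximated by a continuous one of compact support, the error being propagated by
`exists_integral_weight_stepDensity_le`. -/
lemma tendsto_integral_weight_abs_sub_zero (hb : Continuous b) (hC0 : 0 ≤ C)
    (hC : ∀ y, ‖b y‖ ≤ C * (1 + ‖y‖)) (hlam : 0 < lam) {q : V → ℝ} (hq : Measurable q)
    (hq0 : ∀ x, 0 ≤ q x) (hqi : Integrable q) (hq2 : Integrable fun x => ‖x‖ ^ 2 * q x) :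
    Tendsto (fun s => ∫ x, (1 + ‖x‖ ^ 2) * |stepDensity (densityMeasure q) b lam s x - q x|)
      (𝓝[>] 0) (𝓝 0) := by
  obtain ⟨D, hD0, hD⟩ := exists_integral_weight_stepDensity_le hb.measurable hC0 hC hlam
  have hw0 : ∀ x : V, 0 < 1 + ‖x‖ ^ 2 := fun x => by positivity
  have hw : Measurable fun x : V => 1 + ‖x‖ ^ 2 := by fun_prop
  have hwb : ∀ x : V, |1 + ‖x‖ ^ 2| ≤ 1 * (1 + ‖x‖ ^ 2) := fun x => by
    rw [one_mul, abs_of_nonneg (by positivity)]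
  have hwq : Integrable fun x => (1 + ‖x‖ ^ 2) * q x := by
    refine (hqi.add hq2).congr (ae_of_all _ fun x => ?_)
    simp only [Pi.add_apply]; ring
  rw [Metric.tendsto_nhds]
  intro ε hε
  obtain ⟨ψ, hψc, hψi, hψ, -⟩ := hwq.exists_hasCompactSupport_integral_sub_le
    (show 0 < ε / (2 * (D + 1)) by positivity)
  -- `ψ` approximates `(1 + ‖x‖²) q`, so its positive part has to be divided by the weight
  set φ : V → ℝ := fun x => max (ψ x) 0 * (1 + ‖x‖ ^ 2)⁻¹ with hφdef
  have hφ0 : ∀ x, 0 ≤ φ x := fun x => mul_nonneg (le_max_right _ _) (by positivity)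
  have hφ : Continuous φ :=
    (hψ.max continuous_const).mul (Continuous.inv₀ (by fun_prop) fun x => (hw0 x).ne')
  have hφc : HasCompactSupport φ := by
    refine hψc.mono fun x hx => ?_
    simp only [hφdef, Function.mem_support] at hx ⊢
    intro h0
    simp [h0] at hx
  have hφi : Integrable φ := hφ.integrable_of_hasCompactSupport hφc
  have hwφ : Integrable fun x => (1 + ‖x‖ ^ 2) * φ x :=
    (by fun_prop : Continuous fun x => (1 + ‖x‖ ^ 2) * φ x).integrable_of_hasCompactSupport
      hφc.mul_left
  -- the distance between the initial densities
  set u : V → ℝ := fun x => |q x - φ x| with hudef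
  have hu : Measurable u := by
    have := hq.sub hφ.measurable
    exact this.norm
  have hu0 : ∀ x, 0 ≤ u x := fun x => abs_nonneg _
  have hui : Integrable u := (hqi.sub hφi).abs
  have hwu : Integrable fun x => (1 + ‖x‖ ^ 2) * u x := by
    refine (hwq.sub hwφ).abs.congr (ae_of_all _ fun x => ?_)
    simp only [hudef, Pi.sub_apply]
    rw [← mul_sub, abs_mul, abs_of_pos (hw0 x)]
  have hu_le : ∫ x, (1 + ‖x‖ ^ 2) * u x ≤ ε / (2 * (D + 1)) := by
    refine le_trans (integral_mono hwu ?_ fun x => ?_) hψi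
    · exact (hwq.sub (hψ.integrable_of_hasCompactSupport hψc)).norm
    · simp only [hudef]
      rw [← abs_of_pos (hw0 x), ← abs_mul, abs_of_pos (hw0 x), mul_sub, hφdef, Real.norm_eq_abs]
      have : (1 + ‖x‖ ^ 2) * (max (ψ x) 0 * (1 + ‖x‖ ^ 2)⁻¹) = max (ψ x) 0 := by
        field_simp
      simp only
      rw [this]
      have h1 : 0 ≤ (1 + ‖x‖ ^ 2) * q x := mul_nonneg (hw0 x).le (hq0 x)
      have h2 := abs_max_sub_max_le_abs ((1 + ‖x‖ ^ 2) * q x) (ψ x) 0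
      rwa [max_eq_left h1] at h2
  have i1 := isFiniteMeasure_densityMeasure hqi
  have i2 := isFiniteMeasure_densityMeasure hφi
  have i3 := isFiniteMeasure_densityMeasure hui
  have second : ∀ {g : V → ℝ}, Measurable g → (∀ x, 0 ≤ g x) → Integrable g →
      Integrable (fun x => (1 + ‖x‖ ^ 2) * g x) →
      Integrable (fun y => ‖y‖ ^ 2) (densityMeasure g) := by
    intro g hg hg0 hgi hwg
    refine (integrable_densityMeasure_iff hg hg0).2 ((hwg.sub hgi).congr (ae_of_all _ fun x => ?_))
    simp only [Pi.sub_apply]; ring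
  have mq := second hq hq0 hqi hwq
  have mφ := second hφ.measurable hφ0 hφi hwφ
  have mu := second hu hu0 hui hwu
  have hev := (Metric.tendsto_nhds.1
    (tendsto_integral_weight_of_hasCompactSupport hb hC0 hC hlam hφ hφc hφ0)) (ε / 2) (half_pos hε)
  have hle1 : ∀ᶠ s : ℝ in 𝓝[>] 0, s < 1 := nhdsWithin_le_nhds (Iio_mem_nhds one_pos)
  filter_upwards [hev, hle1, self_mem_nhdsWithin] with s hs hs1 hs0
  have hs0' : 0 < s := hs0
  rw [Real.dist_eq, sub_zero, abs_of_nonneg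
    (integral_nonneg fun x => mul_nonneg (hw0 x).le (abs_nonneg _))] at hs ⊢
  have hdiff : ∀ x, |stepDensity (densityMeasure q) b lam s x -
      stepDensity (densityMeasure φ) b lam s x| ≤ stepDensity (densityMeasure u) b lam s x := by
    intro x
    rw [stepDensity_densityMeasure hq hq0, stepDensity_densityMeasure hφ.measurable hφ0,
      stepDensity_densityMeasure hu hu0, ← integral_sub
      (integrable_mul_kernel hb.measurable hlam hqi hs0' x)
      (integrable_mul_kernel hb.measurable hlam hφi hs0' x)]
    refine (abs_integral_le_integral_abs).trans (le_of_eq (integral_congr_ae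
      (ae_of_all _ fun y => ?_)))
    simp only [hudef]
    rw [← sub_mul, abs_mul, abs_of_pos (gaussianDensity_pos (by positivity) _)]
  have iq := integrable_stepDensity_mul hb.measurable hlam hC mq hs0' hw hwb
  have iφ := integrable_stepDensity_mul hb.measurable hlam hC mφ hs0' hw hwb
  have iu := integrable_stepDensity_mul hb.measurable hlam hC mu hs0' hw hwb
  have hDu := hD (densityMeasure u) mu s hs0' hs1.le
  rw [integral_densityMeasure hu hu0] at hDu
  have iabs : ∀ {f g : V → ℝ}, Integrable (fun x => f x * (1 + ‖x‖ ^ 2)) →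
      Integrable (fun x => g x * (1 + ‖x‖ ^ 2)) →
      Integrable (fun x => (1 + ‖x‖ ^ 2) * |f x - g x|) := by
    intro f g hf hg
    refine (hf.sub hg).abs.congr (ae_of_all _ fun x => ?_)
    simp only [Pi.sub_apply]
    rw [← sub_mul, abs_mul, abs_of_pos (hw0 x), mul_comm]
  have jq : Integrable fun x => q x * (1 + ‖x‖ ^ 2) := by simpa only [mul_comm] using hwq
  have jφ : Integrable fun x => φ x * (1 + ‖x‖ ^ 2) := by simpa only [mul_comm] using hwφ
  calc ∫ x, (1 + ‖x‖ ^ 2) * |stepDensity (densityMeasure q) b lam s x - q x|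
      ≤ ∫ x, (stepDensity (densityMeasure u) b lam s x * (1 + ‖x‖ ^ 2) +
          (1 + ‖x‖ ^ 2) * |stepDensity (densityMeasure φ) b lam s x - φ x| +
          (1 + ‖x‖ ^ 2) * u x) := by
        refine integral_mono (iabs iq jq) ((iu.add (iabs iφ jφ)).add hwu) fun x => ?_
        simp only
        rw [mul_comm (stepDensity (densityMeasure u) b lam s x), ← mul_add, ← mul_add]
        refine mul_le_mul_of_nonneg_left ?_ (hw0 x).le
        have h1 := hdiff x
        have h2 := abs_sub_le (stepDensity (densityMeasure q) b lam s x)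
          (stepDensity (densityMeasure φ) b lam s x) (q x)
        have h3 := abs_sub_le (stepDensity (densityMeasure φ) b lam s x) (φ x) (q x)
        have h4 : |φ x - q x| = u x := abs_sub_comm _ _
        linarith
    _ = (∫ x, stepDensity (densityMeasure u) b lam s x * (1 + ‖x‖ ^ 2)) +
          (∫ x, (1 + ‖x‖ ^ 2) * |stepDensity (densityMeasure φ) b lam s x - φ x|) +
          ∫ x, (1 + ‖x‖ ^ 2) * u x := by
        rw [← integral_add iu (iabs iφ jφ)]
        exact integral_add (iu.add (iabs iφ jφ)) hwu
    _ < ε := by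
        have e1 : ∫ x, u x * (1 + ‖x‖ ^ 2) = ∫ x, (1 + ‖x‖ ^ 2) * u x := by
          simp_rw [mul_comm]
        rw [e1] at hDu
        have h5 : D * ∫ x, (1 + ‖x‖ ^ 2) * u x ≤ D * (ε / (2 * (D + 1))) := by gcongr
        have h6 : D * (ε / (2 * (D + 1))) + ε / (2 * (D + 1)) = ε / 2 := by field_simp
        linarith

end InitialContinuity

/-! ### The log-density of the noisy step -/

section LogDensity

variable {V : Type*} [NormedAddCommGroup V] [InnerProductSpace ℝ V] [FiniteDimensional ℝ V]
  [MeasurableSpace V] [BorelSpace V]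
variable {μ : Measure V} [IsProbabilityMeasure μ] {b : V → V} {lam : ℝ} {C : ℝ}

lemma stepDensity_pos (hb : Measurable b) (hlam : 0 < lam) {s : ℝ} (hs : 0 < s) (x : V) :
    0 < stepDensity μ b lam s x := smoothing_pos (measurable_driftMap hb s) (by positivity) x

lemma integral_stepDensity (hb : Measurable b) (hlam : 0 < lam) {s : ℝ} (hs : 0 < s) :
    ∫ x, stepDensity μ b lam s x = 1 :=
  integral_smoothing (measurable_driftMap hb s) (by positivity)

/-- The laws of the gradient steps of size at most `T` are tight. -/
lemma exists_half_le_measureReal_driftMap (hb : Measurable b)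
    (hC : ∀ y, ‖b y‖ ≤ C * (1 + ‖y‖)) (hμ : Integrable (fun y => ‖y‖ ^ 2) μ) (T : ℝ) :
    ∃ R : ℝ, 0 ≤ R ∧ ∀ s, 0 ≤ s → s ≤ T → 1 / 2 ≤ μ.real {y | ‖driftMap b s y‖ ≤ R} := by
  set B : ℝ := (2 + 4 * T ^ 2 * C ^ 2) * (1 + ∫ y, ‖y‖ ^ 2 ∂μ) with hB
  have hI : 0 ≤ ∫ y, ‖y‖ ^ 2 ∂μ := integral_nonneg fun y => by positivity
  refine ⟨√(2 * B), Real.sqrt_nonneg _, fun s hs hsT => half_le_measureReal_norm_le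
    (measurable_driftMap hb s) (by positivity) (integrable_norm_driftMap_sq hb hC hμ s) ?_⟩
  have h1 : B = ∫ y, (2 + 4 * T ^ 2 * C ^ 2) * (1 + ‖y‖ ^ 2) ∂μ := by
    rw [integral_const_mul, integral_add (integrable_const _) hμ]
    simp [hB]
  rw [h1]
  refine integral_mono (integrable_norm_driftMap_sq hb hC hμ s)
    (((integrable_const 1).add hμ).const_mul _) fun y => (norm_driftMap_sq_le hC s y).trans ?_
  gcongr

/-- Quadratic growth of the log-density of the noisy step, uniformly for step sizes in a compact
subset of `(0, ∞)`. -/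
lemma exists_abs_log_stepDensity_le (hb : Measurable b)
    (hC : ∀ y, ‖b y‖ ≤ C * (1 + ‖y‖)) (hμ : Integrable (fun y => ‖y‖ ^ 2) μ) (hlam : 0 < lam)
    {t : ℝ} (ht : 0 < t) (T : ℝ) :
    ∃ K : ℝ, ∀ s, t ≤ s → s ≤ T → ∀ x, |Real.log (stepDensity μ b lam s x)| ≤ K * (1 + ‖x‖ ^ 2) := by
  obtain ⟨R, hR0, hR⟩ := exists_half_le_measureReal_driftMap hb hC hμ T
  have hcont : ContinuousOn (fun s => Real.log (gaussianConst V (2 * lam * s))) (Set.Icc t T) := by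
    intro s hs
    have hs0 : 0 < s := ht.trans_le hs.1
    have h1 : ContinuousAt (fun s => gaussianConst V (2 * lam * s)) s :=
      ContinuousAt.comp (g := gaussianConst V) (f := fun s => 2 * lam * s)
        (continuousAt_gaussianConst (by positivity)) (by fun_prop)
    exact (h1.log (gaussianConst_pos (by positivity)).ne').continuousWithinAt
  obtain ⟨L, hL⟩ := isCompact_Icc.exists_bound_of_continuousOn hcont
  refine ⟨|L| + Real.log 2 + (1 + R ^ 2) / (2 * lam * t), fun s hts hsT x => ?_⟩
  have hs0 : 0 < s := ht.trans_le hts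
  have h1 := abs_log_smoothing_le (μ := μ) (measurable_driftMap hb s)
    (by positivity : 0 < 2 * lam * s) (hR s hs0.le hsT) x
  have h2 : |Real.log (gaussianConst V (2 * lam * s))| ≤ |L| := (hL s ⟨hts, hsT⟩).trans (le_abs_self L)
  have h3 : (‖x‖ ^ 2 + R ^ 2) / (2 * lam * s) ≤ (1 + R ^ 2) / (2 * lam * t) * (1 + ‖x‖ ^ 2) := by
    rw [div_mul_eq_mul_div]
    have : ‖x‖ ^ 2 + R ^ 2 ≤ (1 + R ^ 2) * (1 + ‖x‖ ^ 2) := by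
      nlinarith [mul_nonneg (sq_nonneg R) (sq_nonneg ‖x‖)]
    gcongr
  have h4 : 0 ≤ Real.log 2 := Real.log_nonneg (by norm_num)
  have h5 : 0 ≤ (|L| + Real.log 2) * ‖x‖ ^ 2 := by positivity
  calc _ ≤ _ := h1
    _ ≤ |L| + Real.log 2 + (1 + R ^ 2) / (2 * lam * t) * (1 + ‖x‖ ^ 2) := by gcongr
    _ ≤ _ := by nlinarith

/-- Linear growth of the score of the noisy step. -/
lemma exists_norm_gradient_log_stepDensity_le (hb : Measurable b)
    (hC : ∀ y, ‖b y‖ ≤ C * (1 + ‖y‖)) (hμ : Integrable (fun y => ‖y‖ ^ 2) μ) (hlam : 0 < lam)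
    {s : ℝ} (hs : 0 < s) :
    ∃ K : ℝ, 0 ≤ K ∧
      ∀ x, ‖∇ (fun x => Real.log (stepDensity μ b lam s x)) x‖ ≤ K * (1 + ‖x‖) := by
  obtain ⟨R, hR0, hR⟩ := exists_half_le_measureReal_driftMap hb hC hμ s
  exact ⟨_, by positivity, norm_gradient_log_smoothing_le (measurable_driftMap hb s)
    (by positivity : 0 < 2 * lam * s) hR0 (hR s hs.le le_rfl)⟩

lemma contDiff_log_stepDensity (hb : Measurable b) (hlam : 0 < lam) {s : ℝ} (hs : 0 < s) :
    ContDiff ℝ ∞ fun x => Real.log (stepDensity μ b lam s x) :=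
  contDiff_log_smoothing (measurable_driftMap hb s) (by positivity)

end LogDensity

/-! ### The entropy at time zero -/

section EntropyAtZero

variable {V : Type*} [NormedAddCommGroup V] [InnerProductSpace ℝ V] [FiniteDimensional ℝ V]
  [MeasurableSpace V] [BorelSpace V]
variable {b : V → V} {lam : ℝ} {C : ℝ}

lemma isProbabilityMeasure_densityMeasure {q : V → ℝ} (hq0 : ∀ x, 0 ≤ q x)
    (hq1 : ∫ x, q x = 1) : IsProbabilityMeasure (densityMeasure q) := by
  have hqi : Integrable q := by
    by_contra h
    rw [integral_undef h] at hq1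
    exact zero_ne_one hq1
  constructor
  rw [densityMeasure, withDensity_apply _ MeasurableSet.univ, Measure.restrict_univ,
    ← ofReal_integral_eq_lintegral_ofReal hqi (ae_of_all _ hq0), hq1, ENNReal.ofReal_one]

/-- The expectation of `w(X_s) / q(X)`, bounded through the mass of the transition kernel in the
initial point: the density `q` of `X` cancels. -/
lemma lintegral_div_kernel_le {m : V → V} (hm : Measurable m) {v : ℝ} (hv : 0 < v) {q : V → ℝ}
    [IsFiniteMeasure (densityMeasure q)] (hq : Measurable q) (hq0 : ∀ x, 0 ≤ q x) {w : V → ℝ}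
    (hwm : Measurable w) (hw0 : ∀ x, 0 ≤ w x) {g : V → ENNReal}
    (h : ∀ x, ENNReal.ofReal (w x) * ∫⁻ y, ENNReal.ofReal (gaussianDensity v (x - m y)) ≤ g x) :
    ∫⁻ p, ENNReal.ofReal (w (m p.1 + √v • p.2) / q p.1)
      ∂((densityMeasure q).prod (stdGaussian V)) ≤ ∫⁻ x, g x := by
  have hf : Measurable fun z : V × V => ENNReal.ofReal (w z.2 / q z.1) := by fun_prop
  have hk : Measurable fun p : V × V => ENNReal.ofReal (gaussianDensity v (p.2 - m p.1)) :=
    (measurable_gaussianDensity_sub hm).ennreal_ofReal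
  have h1 := lintegral_map (μ := (densityMeasure q).prod (stdGaussian V)) hf
    (g := fun p : V × V => (p.1, m p.1 + √v • p.2)) (by fun_prop)
  rw [map_prodMk_add_sqrt_smul _ hm hv, lintegral_withDensity_eq_lintegral_mul _ hk hf,
    lintegral_prod_symm _ (hk.mul hf).aemeasurable] at h1
  refine h1.symm.le.trans (lintegral_mono fun x => le_trans ?_ (h x))
  simp only [Pi.mul_apply]
  have hmx : Measurable fun y => ENNReal.ofReal (gaussianDensity v (x - m y)) :=
    ((continuous_gaussianDensity v).measurable.comp (hm.const_sub x)).ennreal_ofReal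
  have hmx2 : Measurable fun y =>
      ENNReal.ofReal (gaussianDensity v (x - m y)) * ENNReal.ofReal (w x / q y) :=
    hmx.mul (by fun_prop)
  rw [densityMeasure, lintegral_withDensity_eq_lintegral_mul _ hq.ennreal_ofReal hmx2,
    ← lintegral_const_mul' _ _ ENNReal.ofReal_ne_top]
  refine lintegral_mono fun y => ?_
  simp only [Pi.mul_apply]
  rw [← ENNReal.ofReal_mul (gaussianDensity_pos hv _).le,
    ← ENNReal.ofReal_mul (hq0 y), ← ENNReal.ofReal_mul (hw0 x)]
  refine ENNReal.ofReal_le_ofReal ?_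
  have hg := gaussianDensity_pos hv (x - m y)
  rcases (hq0 y).eq_or_lt with h0 | h0
  · rw [← h0, zero_mul]; exact mul_nonneg (hw0 x) hg.le
  · refine le_of_eq ?_
    field_simp

/-- The entropy of the noisy step exceeds the initial one by at most `κ E(1 + ‖X_s‖²)`, if the mass
`∫ K_s(y, x) dy` of the transition kernel in the *initial* point is at most `exp (κ (1 + ‖x‖²))`.
This is Gibbs' inequality for the joint density `q(y) K_s(y, x)` against
`q_s(x) exp (- κ (1 + ‖x‖²)) K_s(y, x)`. -/
lemma integral_stepDensity_mul_log_le (hb : Measurable b)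
    (hC : ∀ y, ‖b y‖ ≤ C * (1 + ‖y‖)) (hlam : 0 < lam) {q : V → ℝ} (hq : Measurable q)
    (hq0 : ∀ x, 0 ≤ q x) (hq1 : ∫ x, q x = 1) (hq2 : Integrable fun x => ‖x‖ ^ 2 * q x)
    (hqe : Integrable fun x => q x * Real.log (q x)) {s : ℝ} (hs : 0 < s) {κ : ℝ}
    (hκ : ∀ x, ∫⁻ y, ENNReal.ofReal (gaussianDensity (2 * lam * s) (x - driftMap b s y)) ≤
      ENNReal.ofReal (Real.exp (κ * (1 + ‖x‖ ^ 2)))) :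
    ∫ x, stepDensity (densityMeasure q) b lam s x *
        Real.log (stepDensity (densityMeasure q) b lam s x) ≤
      (∫ x, q x * Real.log (q x)) +
        κ * ∫ p, (1 + ‖noisyMap b lam s p‖ ^ 2) ∂((densityMeasure q).prod (stdGaussian V)) := by
  have hP := isProbabilityMeasure_densityMeasure hq0 hq1
  set μ := densityMeasure q with hμdef
  have hv : 0 < 2 * lam * s := by positivity
  have hm := measurable_driftMap hb s
  have hμ2 : Integrable (fun y => ‖y‖ ^ 2) μ := by
    refine (integrable_densityMeasure_iff hq hq0).2 ?_
    simpa only [mul_comm] using hq2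
  set qs : V → ℝ := stepDensity μ b lam s with hqs
  have hqs0 : ∀ x, 0 < qs x := stepDensity_pos hb hlam hs
  have hqsm : Measurable qs := measurable_stepDensity hb lam s
  obtain ⟨K, hK⟩ := exists_abs_log_stepDensity_le hb hC hμ2 hlam hs s
  have hK' := hK s le_rfl le_rfl
  rw [← hqs] at hK'
  set w : V → ℝ := fun x => qs x * Real.exp (-(κ * (1 + ‖x‖ ^ 2))) with hw
  have hw0 : ∀ x, 0 < w x := fun x => mul_pos (hqs0 x) (Real.exp_pos _)
  have hwm : Measurable w := by fun_prop
  have hqi : Integrable qs := integrable_smoothing hm hv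
  -- the integral of the ratio of the two joint densities is at most one
  have hL : ∫⁻ p, ENNReal.ofReal (w (noisyMap b lam s p) / q p.1) ∂(μ.prod (stdGaussian V)) ≤ 1 := by
    have h1 : ∀ x, ENNReal.ofReal (w x) *
        ∫⁻ y, ENNReal.ofReal (gaussianDensity (2 * lam * s) (x - driftMap b s y)) ≤
        ENNReal.ofReal (qs x) := by
      intro x
      calc _ ≤ ENNReal.ofReal (w x) * ENNReal.ofReal (Real.exp (κ * (1 + ‖x‖ ^ 2))) := by
            gcongr
            exact hκ x
        _ = ENNReal.ofReal (qs x) := by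
            rw [← ENNReal.ofReal_mul (hw0 x).le, hw]
            simp only
            rw [mul_assoc, ← Real.exp_add, neg_add_cancel, Real.exp_zero, mul_one]
    refine (lintegral_div_kernel_le hm hv hq hq0 hwm (fun x => (hw0 x).le) h1).trans (le_of_eq ?_)
    rw [← ofReal_integral_eq_lintegral_ofReal hqi (ae_of_all _ fun x => (hqs0 x).le), hqs,
      integral_stepDensity hb hlam hs, ENNReal.ofReal_one]
  have hXm := measurable_noisyMap hb lam s
  have hr0 : ∀ p : V × V, 0 ≤ w (noisyMap b lam s p) / q p.1 :=
    fun p => div_nonneg (hw0 _).le (hq0 _)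
  have hrm : Measurable fun p : V × V => w (noisyMap b lam s p) / q p.1 := by fun_prop
  have hri : Integrable (fun p : V × V => w (noisyMap b lam s p) / q p.1)
      (μ.prod (stdGaussian V)) := by
    refine ⟨hrm.aestronglyMeasurable, ?_⟩
    rw [hasFiniteIntegral_iff_ofReal (ae_of_all _ hr0)]
    exact hL.trans_lt ENNReal.one_lt_top
  have hr1 : ∫ p, w (noisyMap b lam s p) / q p.1 ∂(μ.prod (stdGaussian V)) ≤ 1 := by
    rw [integral_eq_lintegral_of_nonneg_ae (ae_of_all _ hr0) hrm.aestronglyMeasurable]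
    exact ENNReal.toReal_le_of_le_ofReal zero_le_one (by rwa [ENNReal.ofReal_one])
  have hX2 := integrable_norm_noisyMap_sq (lam := lam) hb hC hμ2 s
  have hi1 : Integrable (fun p : V × V => Real.log (q p.1)) (μ.prod (stdGaussian V)) :=
    Integrable.comp_fst ((integrable_densityMeasure_iff hq hq0).2 hqe) _
  have hi2 : Integrable (fun p => Real.log (qs (noisyMap b lam s p))) (μ.prod (stdGaussian V)) :=
    integrable_of_quadratic_growth hX2 hXm.aemeasurable hqsm.log hK'
  have hi3 : Integrable (fun p => κ * (1 + ‖noisyMap b lam s p‖ ^ 2)) (μ.prod (stdGaussian V)) :=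
    ((integrable_const 1).add hX2).const_mul κ
  have hqpos : ∀ᵐ p ∂(μ.prod (stdGaussian V)), 0 < q p.1 := by
    have h1 : ∀ᵐ y ∂μ, 0 < q y := by
      rw [hμdef, densityMeasure, ae_withDensity_iff hq.ennreal_ofReal]
      refine ae_of_all _ fun y hy => ?_
      by_contra h
      exact hy (ENNReal.ofReal_of_nonpos (not_lt.1 h))
    exact Measure.quasiMeasurePreserving_fst.ae h1
  have e1 : ∫ x, qs x * Real.log (qs x) =
      ∫ p, Real.log (qs (noisyMap b lam s p)) ∂(μ.prod (stdGaussian V)) :=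
    integral_stepDensity_mul hb hlam hs hqsm.log
  have e2 : ∫ x, q x * Real.log (q x) = ∫ p, Real.log (q p.1) ∂(μ.prod (stdGaussian V)) := by
    rw [integral_fun_fst (fun y : V => Real.log (q y)), probReal_univ, one_smul, hμdef,
      integral_densityMeasure hq hq0]
  have key : ∫ p, Real.log (qs (noisyMap b lam s p)) ∂(μ.prod (stdGaussian V)) ≤
      ∫ p, (Real.log (q p.1) + κ * (1 + ‖noisyMap b lam s p‖ ^ 2) +
        (w (noisyMap b lam s p) / q p.1 - 1)) ∂(μ.prod (stdGaussian V)) := by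
    refine integral_mono_ae hi2 ((hi1.add hi3).add (hri.sub (integrable_const 1))) ?_
    filter_upwards [hqpos] with p hp
    have h1 := Real.log_le_sub_one_of_pos (div_pos (hw0 (noisyMap b lam s p)) hp)
    rw [Real.log_div (hw0 _).ne' hp.ne', hw] at h1
    simp only at h1
    rw [Real.log_mul (hqs0 _).ne' (Real.exp_pos _).ne', Real.log_exp] at h1
    simp only [hw]
    linarith
  have e3 : ∫ p, (Real.log (q p.1) + κ * (1 + ‖noisyMap b lam s p‖ ^ 2) +
        (w (noisyMap b lam s p) / q p.1 - 1)) ∂(μ.prod (stdGaussian V)) =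
      ∫ p, Real.log (q p.1) ∂(μ.prod (stdGaussian V)) +
      κ * ∫ p, (1 + ‖noisyMap b lam s p‖ ^ 2) ∂(μ.prod (stdGaussian V)) +
      (∫ p, w (noisyMap b lam s p) / q p.1 ∂(μ.prod (stdGaussian V)) - 1) := by
    have a1 := integral_add (hi1.add hi3) (hri.sub (integrable_const 1))
    have a2 := integral_add hi1 hi3
    have a3 := integral_sub hri (integrable_const (μ := μ.prod (stdGaussian V)) (1 : ℝ))
    rw [integral_const_mul] at a2
    simp only [integral_const, probReal_univ, one_smul] at a3
    rw [← a2, ← a3]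
    exact a1
  rw [e1, e2]
  linarith

/-- The mass of the transition kernel in the initial point, bounded with Peter-Paul parameter
`ε = √s`. -/
lemma lintegral_kernel_le (hC : ∀ y, ‖b y‖ ≤ C * (1 + ‖y‖)) (hlam : 0 < lam) {e : ℝ}
    (he : 0 < e) {ρ : ℝ} (hρ : ρ = 1 - e - 4 * C ^ 2 * e ^ 3) (hρ0 : 0 < ρ) (hρ1 : ρ ≤ 1) (x : V) :
    ∫⁻ y, ENNReal.ofReal (gaussianDensity (2 * lam * e ^ 2) (x - driftMap b (e ^ 2) y)) ≤
      ENNReal.ofReal (Real.exp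
        ((C ^ 2 / lam * e - Module.finrank ℝ V / 2 * Real.log ρ) * (1 + ‖x‖ ^ 2))) := by
  have hv : 0 < 2 * lam * e ^ 2 := by positivity
  set B : ℝ := 4 * C ^ 2 * e ^ 3 * (1 + ‖x‖ ^ 2) with hB
  set D : ℝ := (ρ ^ (Module.finrank ℝ V / 2 : ℝ))⁻¹ * Real.exp (B / (2 * (2 * lam * e ^ 2))) with hD
  have hD0 : 0 < D := by positivity
  have hpt : ∀ y, gaussianDensity (2 * lam * e ^ 2) (x - driftMap b (e ^ 2) y) ≤
      D * gaussianDensity (2 * lam * e ^ 2 / ρ) (x - y) := by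
    intro y
    refine gaussianDensity_le_of_le hv hρ0 ?_
    have h1 := sub_div_le_norm_add_sq he (x - y) (e ^ 2 • b y)
    have h2 : x - y + e ^ 2 • b y = x - driftMap b (e ^ 2) y := by unfold driftMap; abel
    rw [h2, norm_smul, Real.norm_of_nonneg (by positivity)] at h1
    have h3 : ‖b y‖ ^ 2 ≤ C ^ 2 * (1 + ‖y‖) ^ 2 := by
      rw [← mul_pow]; exact pow_le_pow_left₀ (norm_nonneg _) (hC y) 2
    have h4 : (1 + ‖y‖) ^ 2 ≤ 4 * ((1 + ‖x‖ ^ 2) + ‖x - y‖ ^ 2) := by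
      have h5 := norm_sub_le x (x - y)
      rw [sub_sub_cancel] at h5
      nlinarith [sq_nonneg (1 - ‖y‖), sq_nonneg (‖x‖ - ‖x - y‖), norm_nonneg y]
    have h6 : C ^ 2 * (1 + ‖y‖) ^ 2 ≤ C ^ 2 * (4 * ((1 + ‖x‖ ^ 2) + ‖x - y‖ ^ 2)) := by gcongr
    have h7 : (e ^ 2 * ‖b y‖) ^ 2 / e = e ^ 3 * ‖b y‖ ^ 2 := by field_simp
    rw [h7] at h1
    have h8 : e ^ 3 * ‖b y‖ ^ 2 ≤ e ^ 3 * (C ^ 2 * (4 * ((1 + ‖x‖ ^ 2) + ‖x - y‖ ^ 2))) := by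
      gcongr
      exact h3.trans h6
    rw [hρ, hB]
    nlinarith
  have hmass : ∫⁻ y, ENNReal.ofReal (gaussianDensity (2 * lam * e ^ 2 / ρ) (x - y)) = 1 := by
    rw [lintegral_sub_left_eq_self (fun z : V => ENNReal.ofReal
        (gaussianDensity (2 * lam * e ^ 2 / ρ) z)) x,
      ← ofReal_integral_eq_lintegral_ofReal (integrable_gaussianDensity (by positivity))
        (ae_of_all _ fun z => (gaussianDensity_pos (by positivity) z).le),
      integral_gaussianDensity (by positivity), ENNReal.ofReal_one]
  calc _ ≤ ∫⁻ y, ENNReal.ofReal D *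
        ENNReal.ofReal (gaussianDensity (2 * lam * e ^ 2 / ρ) (x - y)) := by
        refine lintegral_mono fun y => ?_
        rw [← ENNReal.ofReal_mul hD0.le]
        exact ENNReal.ofReal_le_ofReal (hpt y)
    _ = ENNReal.ofReal D := by
        rw [lintegral_const_mul' _ _ ENNReal.ofReal_ne_top, hmass, mul_one]
    _ ≤ _ := by
        refine ENNReal.ofReal_le_ofReal ?_
        have h1 : (ρ ^ (Module.finrank ℝ V / 2 : ℝ))⁻¹ =
            Real.exp (-(Module.finrank ℝ V / 2 * Real.log ρ)) := by
          rw [Real.rpow_def_of_pos hρ0, ← Real.exp_neg, mul_comm]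
        have h2 : B / (2 * (2 * lam * e ^ 2)) = C ^ 2 / lam * e * (1 + ‖x‖ ^ 2) := by
          rw [hB]; field_simp; ring
        rw [hD, h1, h2, ← Real.exp_add]
        refine Real.exp_le_exp.2 ?_
        have h3 : 0 ≤ -(Module.finrank ℝ V / 2 * Real.log ρ) := by
          have := Real.log_nonpos hρ0.le hρ1
          have h4 : 0 ≤ (Module.finrank ℝ V / 2 : ℝ) := by positivity
          nlinarith
        nlinarith [mul_nonneg h3 (sq_nonneg ‖x‖)]

/-- Upper semicontinuity of the entropy at time zero. -/
lemma eventually_entropy_stepDensity_le (hb : Measurable b) (hC0 : 0 ≤ C)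
    (hC : ∀ y, ‖b y‖ ≤ C * (1 + ‖y‖)) (hlam : 0 < lam) {q : V → ℝ} (hq : Measurable q)
    (hq0 : ∀ x, 0 ≤ q x) (hq1 : ∫ x, q x = 1) (hq2 : Integrable fun x => ‖x‖ ^ 2 * q x)
    (hqe : Integrable fun x => q x * Real.log (q x)) {ε : ℝ} (hε : 0 < ε) :
    ∀ᶠ s in 𝓝[>] 0, ∫ x, stepDensity (densityMeasure q) b lam s x *
        Real.log (stepDensity (densityMeasure q) b lam s x) ≤ (∫ x, q x * Real.log (q x)) + ε := by
  have hP := isProbabilityMeasure_densityMeasure hq0 hq1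
  have hμ2 : Integrable (fun y => ‖y‖ ^ 2) (densityMeasure q) := by
    refine (integrable_densityMeasure_iff hq hq0).2 ?_
    simpa only [mul_comm] using hq2
  let ρ : ℝ → ℝ := fun s => 1 - √s - 4 * C ^ 2 * √s ^ 3
  let κ : ℝ → ℝ := fun s => C ^ 2 / lam * √s - Module.finrank ℝ V / 2 * Real.log (ρ s)
  have hρc : Continuous ρ := by fun_prop
  have hρ0 : ρ 0 = 1 := by simp [ρ]
  have hκ : Tendsto κ (𝓝[>] 0) (𝓝 0) := by
    have h1 : ContinuousAt κ 0 := by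
      have h2 : ContinuousAt (fun s => Real.log (ρ s)) 0 :=
        hρc.continuousAt.log (by rw [hρ0]; exact one_ne_zero)
      have h3 : ContinuousAt (fun s : ℝ => C ^ 2 / lam * √s) 0 := by fun_prop
      exact h3.sub (continuousAt_const.mul h2)
    have h4 : κ 0 = 0 := by simp [κ, hρ0]
    have h5 := h1.tendsto
    rw [h4] at h5
    exact h5.mono_left nhdsWithin_le_nhds
  have hlim := hκ.mul (tendsto_integral_weight_noisyMap hb hC0 hC hμ2 hlam le_rfl)
  rw [zero_mul] at hlim
  have hρpos : ∀ᶠ s in 𝓝[>] 0, 0 < ρ s :=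
    nhdsWithin_le_nhds (hρc.continuousAt.eventually_const_lt (by rw [hρ0]; exact one_pos))
  filter_upwards [hlim.eventually_lt_const hε, hρpos, self_mem_nhdsWithin] with s h1 h2 h3
  have hs : 0 < s := h3
  have hsq : √s ^ 2 = s := Real.sq_sqrt hs.le
  have h4 := integral_stepDensity_mul_log_le (κ := κ s) hb hC hlam hq hq0 hq1 hq2 hqe hs
    (fun x => by
      have hρ1 : ρ s ≤ 1 := by
        have : 0 ≤ √s + 4 * C ^ 2 * √s ^ 3 := by positivity
        simp only [ρ]; linarith
      have := lintegral_kernel_le hC hlam (Real.sqrt_pos.2 hs) (ρ := ρ s) rfl h2 hρ1 x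
      rwa [hsq] at this)
  linarith

end EntropyAtZero

/-! ### Grönwall's inequality from left increments -/

section Gronwall

/-- A function with `limsup (h t - h s) / (t - s) ≤ 0` as `s ↑ t`, for all `t`, which is upper
semicontinuous from the right takes a value at `η` no larger than at `0`. -/
lemma le_of_left_increment_of_right_usc {h : ℝ → ℝ} {η : ℝ} (hη : 0 < η)
    (hleft : ∀ t, 0 < t → t ≤ η → ∀ ε, 0 < ε → ∀ᶠ s in 𝓝[<] t, h t - h s ≤ ε * (t - s))
    (hright : ∀ t, 0 ≤ t → t < η → ∀ ε, 0 < ε → ∀ᶠ s in 𝓝[>] t, h s ≤ h t + ε) :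
    h η ≤ h 0 := by
  refine le_of_forall_pos_le_add fun ε hε => ?_
  set g : ℝ → ℝ := fun t => h t - ε / η * t with hg
  have hεη : 0 < ε / η := div_pos hε hη
  suffices g η ≤ g 0 by
    simp only [hg, mul_zero, sub_zero] at this
    rw [div_mul_cancel₀ _ hη.ne'] at this
    linarith
  -- the infimum `τ` of the set `S` belongs to `S` by semicontinuity, and is zero because otherwise
  -- the left increments would give a smaller element of `S`
  set S : Set ℝ := {t | 0 ≤ t ∧ t ≤ η ∧ g η ≤ g t} with hS
  have hηS : η ∈ S := ⟨hη.le, le_rfl, le_rfl⟩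
  have hbdd : BddBelow S := ⟨0, fun t ht => ht.1⟩
  set τ := sInf S with hτ
  have hτ0 : 0 ≤ τ := le_csInf ⟨η, hηS⟩ fun t ht => ht.1
  have hτη : τ ≤ η := csInf_le hbdd hηS
  have hτS : g η ≤ g τ := by
    by_contra hlt
    have hlt' : g τ < g η := not_le.1 hlt
    have hne : τ < η := lt_of_le_of_ne hτη fun h => by rw [h] at hlt'; exact lt_irrefl _ hlt'
    have h1 := hright τ hτ0 hne ((g η - g τ) / 2) (by linarith)
    obtain ⟨u, hu, hu2⟩ := mem_nhdsGT_iff_exists_Ioo_subset.1 h1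
    obtain ⟨s, hsS, hsu⟩ := exists_lt_of_csInf_lt ⟨η, hηS⟩ hu
    have hτs : τ ≤ s := csInf_le hbdd hsS
    rcases hτs.eq_or_lt with h2 | h2
    · rw [← h2] at hsS; exact hlt hsS.2.2
    · have h3 : h s ≤ h τ + (g η - g τ) / 2 := hu2 ⟨h2, hsu⟩
      have h4 := hsS.2.2
      have h5 : ε / η * τ ≤ ε / η * s := by gcongr
      simp only [hg] at h3 h4 hlt'
      linarith
  rcases hτ0.eq_or_lt with h0 | h0
  · rwa [← h0] at hτS
  · exfalso
    have h1 := hleft τ h0 hτη (ε / η) hεη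
    have h2 : ∀ᶠ s in 𝓝[<] τ, s < τ := self_mem_nhdsWithin
    have h3 : ∀ᶠ s in 𝓝[<] τ, 0 < s := nhdsWithin_le_nhds (Ioi_mem_nhds h0)
    obtain ⟨s, hs, hsτ', hs0'⟩ := (h1.and (h2.and h3)).exists
    have hsS : s ∈ S := by
      refine ⟨hs0'.le, (hsτ'.le).trans hτη, ?_⟩
      simp only [hg] at hτS ⊢
      linarith
    exact absurd (csInf_le hbdd hsS) (not_le.2 hsτ')

/-- Grönwall's inequality for a function that need not be continuous: the increments to the left of
`t` are dominated by those of a function differentiable at `t`, and the function is upper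
semicontinuous from the right. -/
lemma gronwall_of_left_increment {f : ℝ → ℝ} {a c η : ℝ} (hη : 0 < η)
    (hleft : ∀ t, 0 < t → t ≤ η → ∃ (A : ℝ → ℝ) (D : ℝ), HasDerivAt A D t ∧ D ≤ -a * (f t - c) ∧
      ∀ s, 0 < s → s < t → f t - f s ≤ A t - A s)
    (hright : ∀ t, 0 ≤ t → t < η → ∀ ε, 0 < ε → ∀ᶠ s in 𝓝[>] t, f s ≤ f t + ε) :
    f η - c ≤ Real.exp (-(a * η)) * (f 0 - c) := by
  have key : Real.exp (a * η) * (f η - c) ≤ Real.exp (a * 0) * (f 0 - c) := by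
    -- compare with `ψ`, in which the increments of `f` at `t` are replaced by those of `A`
    refine le_of_left_increment_of_right_usc (h := fun t => Real.exp (a * t) * (f t - c)) hη ?_ ?_
    · intro t ht htη ε hε
      obtain ⟨A, D, hA, hD, hf⟩ := hleft t ht htη
      set ψ : ℝ → ℝ := fun s => Real.exp (a * s) * (A s - A t + (f t - c)) with hψ
      have hψd : HasDerivAt ψ (Real.exp (a * t) * a * (A t - A t + (f t - c)) +
          Real.exp (a * t) * D) t := by
        have h1 : HasDerivAt (fun s => Real.exp (a * s)) (Real.exp (a * t) * a) t := by
          simpa using ((hasDerivAt_id t).const_mul a).exp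
        exact h1.mul ((hA.sub_const (A t)).add_const (f t - c))
      have hneg : Real.exp (a * t) * a * (A t - A t + (f t - c)) + Real.exp (a * t) * D < ε := by
        have h2 : Real.exp (a * t) * D ≤ Real.exp (a * t) * (-a * (f t - c)) := by gcongr
        nlinarith
      have hslope := (hasDerivAt_iff_tendsto_slope.1 hψd).eventually_lt_const hneg
      have hslope' : ∀ᶠ s in 𝓝[<] t, slope ψ t s < ε :=
        hslope.filter_mono (nhdsWithin_mono _ fun s hs => ne_of_lt hs)
      filter_upwards [hslope', self_mem_nhdsWithin, nhdsWithin_le_nhds (Ioi_mem_nhds ht)]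
        with s hs hst hs0
      have hst' : s < t := hst
      rw [slope_def_field, div_lt_iff_of_neg (by linarith)] at hs
      have h3 := hf s hs0 hst'
      have h4 : ψ s ≤ Real.exp (a * s) * (f s - c) := by
        simp only [hψ]
        gcongr
        linarith
      have h5 : ψ t = Real.exp (a * t) * (f t - c) := by simp [hψ]
      linarith
    · intro t ht htη ε hε
      have h1 := hright t ht htη (ε / 2 * Real.exp (-(a * t))) (by positivity)
      have hc : Continuous fun s => Real.exp (a * s) *
          (f t + ε / 2 * Real.exp (-(a * t)) - c) := by fun_prop
      have h2 : Real.exp (a * t) * (f t + ε / 2 * Real.exp (-(a * t)) - c) <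
          Real.exp (a * t) * (f t - c) + ε := by
        have h3 : Real.exp (a * t) * Real.exp (-(a * t)) = 1 := by
          rw [← Real.exp_add, add_neg_cancel, Real.exp_zero]
        have : Real.exp (a * t) * (f t + ε / 2 * Real.exp (-(a * t)) - c) =
          Real.exp (a * t) * (f t - c) + ε / 2 * (Real.exp (a * t) * Real.exp (-(a * t))) := by ring
        rw [this, h3]
        linarith
      have h4 : ∀ᶠ s in 𝓝[>] t, Real.exp (a * s) *
          (f t + ε / 2 * Real.exp (-(a * t)) - c) < Real.exp (a * t) * (f t - c) + ε :=
        nhdsWithin_le_nhds (hc.continuousAt.eventually_lt_const h2)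
      filter_upwards [h1, h4] with s hs1 hs2
      refine le_trans ?_ hs2.le
      gcongr
  rw [mul_zero, Real.exp_zero, one_mul] at key
  have h := mul_le_mul_of_nonneg_left key (Real.exp_pos (-(a * η))).le
  rwa [← mul_assoc, ← Real.exp_add, neg_add_cancel, Real.exp_zero, one_mul] at h

end Gronwall

/-! ### Convexity and the log-Sobolev inequality -/

section Gibbs

/-- Gibbs' inequality. -/
lemma integral_mul_log_le {α : Type*} [MeasurableSpace α] {ν : Measure α} {u w : α → ℝ}
    (hu0 : ∀ x, 0 ≤ u x) (hu : Integrable u ν) (hw0 : ∀ x, 0 < w x) (hw : Integrable w ν)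
    (huw : ∫ x, u x ∂ν = ∫ x, w x ∂ν) (hlu : Integrable (fun x => u x * Real.log (u x)) ν)
    (hlw : Integrable (fun x => u x * Real.log (w x)) ν) :
    ∫ x, u x * Real.log (w x) ∂ν ≤ ∫ x, u x * Real.log (u x) ∂ν := by
  have h : ∫ x, (u x * Real.log (w x) + (u x - w x)) ∂ν ≤ ∫ x, u x * Real.log (u x) ∂ν := by
    refine integral_mono (hlw.add (hu.sub hw)) hlu fun x => ?_
    simp only
    rcases (hu0 x).eq_or_lt with h0 | h0
    · rw [← h0]; simp [(hw0 x).le]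
    · have h1 := Real.log_le_sub_one_of_pos (div_pos (hw0 x) h0)
      rw [Real.log_div (hw0 x).ne' h0.ne'] at h1
      have h2 := mul_le_mul_of_nonneg_left h1 h0.le
      have h3 : u x * (w x / u x - 1) = w x - u x := by field_simp
      rw [h3] at h2
      linarith
  have e1 := integral_add hlw (hu.sub hw)
  have e2 := integral_sub hu hw
  simp only [Pi.sub_apply] at e1
  rw [e1, e2, huw] at h
  linarith

variable {d : ℕ} {F : (EuclideanSpace ℝ (Fin d) → ℝ) → ℝ}
  {dF : (EuclideanSpace ℝ (Fin d) → ℝ) → EuclideanSpace ℝ (Fin d) → ℝ} {lam : ℝ}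
  {q q' : EuclideanSpace ℝ (Fin d) → ℝ}

lemma integrable_mul_of_quadratic (hq : q ∈ densities d) {f : EuclideanSpace ℝ (Fin d) → ℝ}
    (hf : Measurable f) {K : ℝ} (hK : ∀ x, |f x| ≤ K * (1 + ‖x‖ ^ 2)) :
    Integrable fun x => q x * f x := by
  obtain ⟨hqm, hq0, hqi, -, hq2, -⟩ := hq
  refine ((hqi.add hq2).const_mul K).mono' (hqm.mul hf).aestronglyMeasurable
    (ae_of_all _ fun x => ?_)
  rw [norm_mul, Real.norm_of_nonneg (hq0 x), Real.norm_eq_abs]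
  have := mul_le_mul_of_nonneg_left (hK x) (hq0 x)
  simp only [Pi.add_apply]
  linarith

/-- Convexity of `F` and of the entropy bound the increment of the objective by a linear
functional. Here `w` is a positive version of the density `q`. -/
lemma objective_sub_le (hF : PotentialAssumption F dF lam) (hlam : 0 < lam)
    (hq : q ∈ densities d) (hq' : q' ∈ densities d) {w : EuclideanSpace ℝ (Fin d) → ℝ}
    (hw : Measurable w) (hw0 : ∀ x, 0 < w x) (hqw : q =ᵐ[volume] w) {K : ℝ}
    (hK : ∀ x, |Real.log (w x)| ≤ K * (1 + ‖x‖ ^ 2)) :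
    objective F lam q - objective F lam q' ≤
      (∫ x, q x * (dF q x + lam * Real.log (w x))) -
        ∫ x, q' x * (dF q x + lam * Real.log (w x)) := by
  obtain ⟨C, hC⟩ := hF.growth
  have hdm : Measurable (dF q) := (hF.smooth q hq).continuous.measurable
  have hcv := hF.convex q hq q' hq'
  have i1 := integrable_mul_of_quadratic hq hdm (hC q hq)
  have i2 := integrable_mul_of_quadratic hq' hdm (hC q hq)
  have i3 := integrable_mul_of_quadratic hq hw.log hK
  have i4 := integrable_mul_of_quadratic hq' hw.log hK
  have e1 : ∫ x, dF q x * (q' x - q x) = (∫ x, q' x * dF q x) - ∫ x, q x * dF q x := by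
    rw [← integral_sub i2 i1]
    congr 1; ext x; ring
  have hent : ∫ x, q x * Real.log (q x) = ∫ x, q x * Real.log (w x) := by
    refine integral_congr_ae ?_
    filter_upwards [hqw] with x hx
    rw [hx]
  have hwi : Integrable w := hq.2.2.1.congr hqw
  have hgibbs := integral_mul_log_le (ν := volume) hq'.2.1 hq'.2.2.1 hw0 hwi
    (by rw [hq'.2.2.2.1, ← integral_congr_ae hqw, hq.2.2.2.1]) hq'.2.2.2.2.2 i4
  have e2 : ∀ r : EuclideanSpace ℝ (Fin d) → ℝ, Integrable (fun x => r x * dF q x) →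
      Integrable (fun x => r x * Real.log (w x)) →
      ∫ x, r x * (dF q x + lam * Real.log (w x)) =
        (∫ x, r x * dF q x) + lam * ∫ x, r x * Real.log (w x) := by
    intro r h1 h2
    rw [← integral_const_mul, ← integral_add h1 (h2.const_mul lam)]
    congr 1; ext x; ring
  rw [e2 q i1 i3, e2 q' i2 i4, objective, objective, hent]
  have := mul_le_mul_of_nonneg_left hgibbs hlam.le
  linarith

/-- The log-Sobolev inequality for the proximal Gibbs distribution, tested with the square root of
the density ratio `w / p_q`, together with convexity, bounds the optimality gap by the
Fisher information. -/
lemma objective_sub_le_fisher (hF : PotentialAssumption F dF lam) (hlam : 0 < lam) {α : ℝ}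
    (hα : 0 < α) (hLSI : LogSobolev (proximalGibbs dF lam q) α)
    (hq : q ∈ densities d) (hq' : q' ∈ densities d) {w : EuclideanSpace ℝ (Fin d) → ℝ}
    (hw : Measurable w) (hw0 : ∀ x, 0 < w x) (hqw : q =ᵐ[volume] w) {K : ℝ}
    (hK : ∀ x, |Real.log (w x)| ≤ K * (1 + ‖x‖ ^ 2))
    (hws : ContDiff ℝ ∞ fun x => Real.log (w x))
    (hfisher : Integrable fun x =>
      w x * ‖∇ (fun x => dF q x + lam * Real.log (w x)) x‖ ^ 2) :
    objective F lam q - objective F lam q' ≤ 1 / (2 * α * lam) *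
      ∫ x, w x * ‖∇ (fun x => dF q x + lam * Real.log (w x)) x‖ ^ 2 := by
  obtain ⟨C, hC⟩ := hF.growth
  have hds := hF.smooth q hq
  have hdm : Measurable (dF q) := hds.continuous.measurable
  have hcv := hF.convex q hq q' hq'
  have hgi := hF.normalizable q hq
  have i1 := integrable_mul_of_quadratic hq hdm (hC q hq)
  have i2 := integrable_mul_of_quadratic hq' hdm (hC q hq)
  have i3 := integrable_mul_of_quadratic hq hw.log hK
  have hwi : Integrable w := hq.2.2.1.congr hqw
  have hw1 : ∫ x, w x = 1 := by rw [← integral_congr_ae hqw, hq.2.2.2.1]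
  set Z : ℝ := ∫ y, gibbsWeight dF lam q y with hZdef
  have hZ : 0 < Z := by
    refine (integral_pos_iff_support_of_nonneg (fun x => (Real.exp_pos _).le) hgi).2 ?_
    have : Function.support (gibbsWeight dF lam q) = Set.univ := by
      ext x; simp [gibbsWeight, (Real.exp_pos _).ne']
    change 0 < volume (Function.support (gibbsWeight dF lam q))
    rw [this]
    exact Measure.measure_univ_pos.2 (NeZero.ne _)
  have hp : ∀ x, proximalGibbs dF lam q x = Real.exp (-(1 / lam) * dF q x) / Z := fun x => rfl
  have hp0 : ∀ x, 0 < proximalGibbs dF lam q x := fun x => by rw [hp]; positivity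
  have hlogp : ∀ x, Real.log (proximalGibbs dF lam q x) = -(1 / lam) * dF q x - Real.log Z :=
    fun x => by rw [hp, Real.log_div (Real.exp_pos _).ne' hZ.ne', Real.log_exp]
  have hpi : Integrable (proximalGibbs dF lam q) := hgi.div_const Z
  have hp1 : ∫ x, proximalGibbs dF lam q x = 1 := by
    have : ∫ x, proximalGibbs dF lam q x = (∫ x, gibbsWeight dF lam q x) / Z :=
      integral_div Z _
    rw [this, ← hZdef, div_self hZ.ne']
  set G : EuclideanSpace ℝ (Fin d) → ℝ := fun x => dF q x + lam * Real.log (w x) with hG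
  have hGs : ContDiff ℝ ∞ G := hds.add (contDiff_const.mul hws)
  -- the test function `√(w / p_q)`
  set g : EuclideanSpace ℝ (Fin d) → ℝ :=
    fun x => Real.exp (1 / (2 * lam) * G x + Real.log Z / 2) with hgdef
  have hgs : ContDiff ℝ ∞ g :=
    Real.contDiff_exp.comp ((contDiff_const.mul hGs).add contDiff_const)
  have hg2 : ∀ x, g x ^ 2 = Real.exp (1 / lam * G x + Real.log Z) := by
    intro x
    rw [hgdef, ← Real.exp_nat_mul]
    congr 1
    push_cast
    field_simp
  have hg2p : ∀ x, g x ^ 2 * proximalGibbs dF lam q x = w x := by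
    intro x
    rw [hg2, hp, Real.exp_add, Real.exp_log hZ, mul_assoc, mul_div_cancel₀ _ hZ.ne',
      ← Real.exp_add]
    have : 1 / lam * G x + -(1 / lam) * dF q x = Real.log (w x) := by
      simp only [hG]; field_simp; ring
    rw [this, Real.exp_log (hw0 x)]
  have hglog : ∀ x, g x ^ 2 * Real.log (g x ^ 2) * proximalGibbs dF lam q x =
      w x * (1 / lam * G x + Real.log Z) := by
    intro x
    rw [mul_right_comm, hg2p, hg2, Real.log_exp]
  have hgrad : ∀ x, ‖∇ g x‖ ^ 2 * proximalGibbs dF lam q x =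
      1 / (4 * lam ^ 2) * (w x * ‖∇ G x‖ ^ 2) := by
    intro x
    have h1 : HasGradientAt G (∇ G x) x := (hGs.differentiable (by simp) _).hasGradientAt
    have h2 : HasGradientAt g ((g x * (1 / (2 * lam))) • ∇ G x) x := by
      rw [hasGradientAt_iff_hasFDerivAt] at h1 ⊢
      refine (((h1.const_mul (1 / (2 * lam))).add_const (Real.log Z / 2)).exp).congr_fderiv ?_
      ext v
      simp [hgdef]
      ring
    rw [h2.gradient, norm_smul, mul_pow, Real.norm_eq_abs, sq_abs, mul_pow]
    have := hg2p x
    calc g x ^ 2 * (1 / (2 * lam)) ^ 2 * ‖∇ G x‖ ^ 2 * proximalGibbs dF lam q x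
        = (1 / (2 * lam)) ^ 2 * ((g x ^ 2 * proximalGibbs dF lam q x) * ‖∇ G x‖ ^ 2) := by ring
      _ = _ := by rw [this]; ring
  have iwG : Integrable fun x => w x * G x := by
    have : Integrable fun x => q x * G x := by
      refine (i1.add (i3.const_mul lam)).congr (ae_of_all _ fun x => ?_)
      simp only [hG, Pi.add_apply]; ring
    refine this.congr ?_
    filter_upwards [hqw] with x hx
    rw [hx]
  have hlsi := hLSI g hgs (by simp_rw [hg2p]; exact hwi)
    (by
      simp_rw [hglog]
      refine ((iwG.const_mul (1 / lam)).add (hwi.const_mul (Real.log Z))).congr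
        (ae_of_all _ fun x => ?_)
      simp only [Pi.add_apply]; ring)
    (by simp_rw [hgrad]; exact hfisher.const_mul _)
  simp_rw [hg2p, hglog, hgrad] at hlsi
  rw [hw1, Real.log_one, mul_zero, sub_zero, integral_const_mul] at hlsi
  have e0 : ∫ x, w x * (1 / lam * G x + Real.log Z) = 1 / lam * (∫ x, w x * G x) + Real.log Z := by
    have h := integral_add (iwG.const_mul (1 / lam)) (hwi.const_mul (Real.log Z))
    rw [integral_const_mul, integral_const_mul, hw1, mul_one] at h
    rw [← h]
    congr 1; ext x; ring
  rw [e0] at hlsi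
  -- Gibbs' inequality for the competitor against the proximal Gibbs density
  have hgibbs := integral_mul_log_le (ν := volume) hq'.2.1 hq'.2.2.1 hp0 hpi
    (by rw [hq'.2.2.2.1, hp1]) hq'.2.2.2.2.2
    (by
      simp_rw [hlogp]
      refine ((i2.const_mul (-(1 / lam))).sub (hq'.2.2.1.const_mul (Real.log Z))).congr
        (ae_of_all _ fun x => ?_)
      simp only [Pi.sub_apply]; ring)
  have e1 : ∫ x, q' x * Real.log (proximalGibbs dF lam q x) =
      -(1 / lam) * (∫ x, q' x * dF q x) - Real.log Z := by
    have h := integral_sub (i2.const_mul (-(1 / lam))) (hq'.2.2.1.const_mul (Real.log Z))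
    rw [integral_const_mul, integral_const_mul, hq'.2.2.2.1, mul_one] at h
    rw [← h]
    congr 1; ext x; rw [hlogp]; ring
  rw [e1] at hgibbs
  have e2 : ∫ x, dF q x * (q' x - q x) = (∫ x, q' x * dF q x) - ∫ x, q x * dF q x := by
    rw [← integral_sub i2 i1]
    congr 1; ext x; ring
  have e3 : ∫ x, w x * G x = (∫ x, q x * dF q x) + lam * ∫ x, q x * Real.log (q x) := by
    rw [← integral_const_mul, ← integral_add i1 (hq.2.2.2.2.2.const_mul lam)]
    refine integral_congr_ae ?_
    filter_upwards [hqw] with x hx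
    simp only [hG]
    rw [hx]; ring
  rw [e2] at hcv
  rw [objective, objective]
  have h1 := mul_le_mul_of_nonneg_left hgibbs hlam.le
  have h2 := mul_le_mul_of_nonneg_left hlsi hlam.le
  have h3 : lam * (-(1 / lam) * (∫ x, q' x * dF q x) - Real.log Z) =
      -(∫ x, q' x * dF q x) - lam * Real.log Z := by field_simp
  have h4 : lam * (1 / lam * (∫ x, w x * G x) + Real.log Z) =
      (∫ x, w x * G x) + lam * Real.log Z := by field_simp
  have h5 : lam * (2 / α * (1 / (4 * lam ^ 2) * ∫ x, w x * ‖∇ G x‖ ^ 2)) =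
      1 / (2 * α * lam) * ∫ x, w x * ‖∇ G x‖ ^ 2 := by field_simp; norm_num
  rw [h3] at h1
  rw [h4, h5, e3] at h2
  linarith

end Gibbs

/-! ### Decrease of the objective along one step -/

section Descent

variable {d : ℕ} {F : (EuclideanSpace ℝ (Fin d) → ℝ) → ℝ}
  {dF : (EuclideanSpace ℝ (Fin d) → ℝ) → EuclideanSpace ℝ (Fin d) → ℝ} {lam : ℝ}
  {μ : Measure (EuclideanSpace ℝ (Fin d))} [IsProbabilityMeasure μ]
  {b : EuclideanSpace ℝ (Fin d) → EuclideanSpace ℝ (Fin d)} {C : ℝ}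

/-- The law of a noisy gradient step belongs to the class `𝒫`. -/
lemma mem_densities_of_ae_eq_stepDensity (hb : Measurable b)
    (hC : ∀ y, ‖b y‖ ≤ C * (1 + ‖y‖)) (hμ : Integrable (fun y => ‖y‖ ^ 2) μ) (hlam : 0 < lam)
    {s : ℝ} (hs : 0 < s) {r : EuclideanSpace ℝ (Fin d) → ℝ} (hr : Measurable r)
    (hr0 : ∀ x, 0 ≤ r x) (hrs : r =ᵐ[volume] stepDensity μ b lam s) : r ∈ densities d := by
  obtain ⟨K, hK⟩ := exists_abs_log_stepDensity_le hb hC hμ hlam hs s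
  have h1 := integrable_stepDensity_mul hb hlam hC hμ hs (f := fun _ => (1 : ℝ))
    measurable_const (K := 1) (fun x => by simp)
  have h2 := integrable_stepDensity_mul hb hlam hC hμ hs (f := fun x => ‖x‖ ^ 2)
    (by fun_prop) (K := 1) (fun x => by rw [abs_of_nonneg (by positivity)]; linarith)
  have h3 := integrable_stepDensity_mul hb hlam hC hμ hs
    (measurable_stepDensity hb lam s).log (hK s le_rfl le_rfl)
  refine ⟨hr, hr0, h1.congr ?_, ?_, h2.congr ?_, h3.congr ?_⟩
  · filter_upwards [hrs] with x hx
    simp [hx]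
  · rw [integral_congr_ae hrs, integral_stepDensity hb hlam hs]
  · filter_upwards [hrs] with x hx
    rw [hx, mul_comm]
  · filter_upwards [hrs] with x hx
    rw [hx]

/-- Along the noisy gradient step, the left increments of the objective at time `t` are dominated
by those of the expectation of the fixed function `dF q_t + lam * log q_t`, whose derivative at `t`
is bounded through the Fisher information and the discretization error. -/
lemma exists_left_increment_bound (hF : PotentialAssumption F dF lam) (hb : Measurable b)
    (hC0 : 0 ≤ C) (hC : ∀ y, ‖b y‖ ≤ C * (1 + ‖y‖)) (hμ : Integrable (fun y => ‖y‖ ^ 2) μ)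
    (hlam : 0 < lam) {α δ : ℝ} (hα : 0 < α) {r : ℝ → EuclideanSpace ℝ (Fin d) → ℝ}
    (hr : ∀ s, 0 < s → r s ∈ densities d)
    (hrs : ∀ s, 0 < s → r s =ᵐ[volume] stepDensity μ b lam s) {t : ℝ} (ht : 0 < t)
    (hLSI : LogSobolev (proximalGibbs dF lam (r t)) α) {Cf : ℝ}
    (hCf : ∀ x, ‖∇ (dF (r t)) x‖ ≤ Cf * (1 + ‖x‖))
    (hδ : ∫ p, ‖b p.1 - ∇ (dF (r t)) (noisyMap b lam t p)‖ ^ 2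
      ∂(μ.prod (stdGaussian (EuclideanSpace ℝ (Fin d)))) ≤ δ)
    {q' : EuclideanSpace ℝ (Fin d) → ℝ} (hq' : q' ∈ densities d) :
    ∃ (A : ℝ → ℝ) (D : ℝ), HasDerivAt A D t ∧
      D ≤ -(α * lam) * (objective F lam (r t) - (objective F lam q' + δ / (2 * α * lam))) ∧
      ∀ s, 0 < s → s < t → objective F lam (r t) - objective F lam (r s) ≤ A t - A s := by
  obtain ⟨Cg, hCg⟩ := hF.growth
  have hrt := hr t ht
  set w := stepDensity μ b lam t with hw
  have hwm : Measurable w := measurable_stepDensity hb lam t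
  have hw0 : ∀ x, 0 < w x := stepDensity_pos hb hlam ht
  have hds := hF.smooth (r t) hrt
  have hws : ContDiff ℝ ∞ fun x => Real.log (w x) := contDiff_log_stepDensity hb hlam ht
  obtain ⟨K, hK⟩ := exists_abs_log_stepDensity_le hb hC hμ hlam ht t
  replace hK := hK t le_rfl le_rfl
  obtain ⟨K₁, hK₁0, hK₁⟩ := exists_norm_gradient_log_stepDensity_le hb hC hμ hlam ht
  set G : EuclideanSpace ℝ (Fin d) → ℝ := fun x => dF (r t) x + lam * Real.log (w x) with hG
  have hGs : ContDiff ℝ ∞ G := hds.add (contDiff_const.mul hws)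
  have hGm : Measurable G := hGs.continuous.measurable
  have hCf0 : 0 ≤ Cf := by
    have := (norm_nonneg _).trans (hCf 0)
    simpa using this
  have hGgrad : ∀ x, ∇ G x = ∇ (dF (r t)) x + lam • ∇ (fun x => Real.log (w x)) x := by
    intro x
    have h1 := (hds.differentiable (by simp) x).hasGradientAt
    have h2 := (hws.differentiable (by simp) x).hasGradientAt
    refine HasGradientAt.gradient ?_
    rw [hasGradientAt_iff_hasFDerivAt] at h1 h2 ⊢
    exact (h1.add (h2.const_mul lam)).congr_fderiv (by simp)
  have hGK : ∀ x, ‖∇ G x‖ ≤ (Cf + lam * K₁) * (1 + ‖x‖) := by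
    intro x
    rw [hGgrad]
    refine (norm_add_le _ _).trans ?_
    rw [norm_smul, Real.norm_of_nonneg hlam.le]
    have := mul_le_mul_of_nonneg_left (hK₁ x) hlam.le
    linarith [hCf x]
  have hGa : ∀ x, |G x| ≤ (Cg + lam * K) * (1 + ‖x‖ ^ 2) := by
    intro x
    refine (abs_add_le _ _).trans ?_
    rw [abs_mul, abs_of_pos hlam]
    have := mul_le_mul_of_nonneg_left (hK x) hlam.le
    linarith [hCg (r t) hrt x]
  have hK0 : 0 ≤ Cf + lam * K₁ := by positivity
  have hgm : Measurable fun x => ‖∇ G x‖ ^ 2 :=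
    ((continuous_gradient hGs).norm.pow 2).measurable
  have hfisher : Integrable fun x => w x * ‖∇ G x‖ ^ 2 := by
    refine integrable_stepDensity_mul hb hlam hC hμ ht hgm
      (K := 2 * (Cf + lam * K₁) ^ 2) fun x => ?_
    rw [abs_of_nonneg (by positivity)]
    have h1 := pow_le_pow_left₀ (norm_nonneg _) (hGK x) 2
    refine h1.trans ?_
    rw [mul_pow, mul_comm (2 : ℝ), mul_assoc]
    gcongr
    nlinarith [sq_nonneg (1 - ‖x‖)]
  have hgap := objective_sub_le_fisher hF hlam hα hLSI hrt hq' hwm hw0 (hrs t ht) hK hws hfisher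
  have eI := integral_stepDensity_mul (μ := μ) hb hlam ht hgm
  rw [← hw] at eI
  change objective F lam (r t) - objective F lam q' ≤
    1 / (2 * α * lam) * ∫ x, w x * ‖∇ G x‖ ^ 2 at hgap
  rw [eI] at hgap
  have hder := (hasDerivAt_integral_noisyMap hb hC0 hC hμ hlam hGs hK0 hGK hGa ht).2
  refine ⟨_, _, hder, ?_, fun s hs hst => ?_⟩
  · have hD := integral_inner_gradient_le hb hC hμ hlam ht hds hCf hGK
    refine hD.trans ?_
    have h1 := mul_le_mul_of_nonneg_left hgap (mul_pos hα hlam).le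
    change -(1 / 2) * ∫ p, ‖∇ G (noisyMap b lam t p)‖ ^ 2 ∂_ + _ ≤ _
    have h2 : ∀ I : ℝ, α * lam * (1 / (2 * α * lam) * I) = 1 / 2 * I := fun I => by field_simp
    have h3 : α * lam * (δ / (2 * α * lam)) = 1 / 2 * δ := by field_simp
    rw [h2] at h1
    linarith
  · have h1 := objective_sub_le hF hlam hrt (hr s hs) hwm hw0 (hrs t ht) hK
    have e1 : ∀ u, 0 < u → ∫ x, r u x * G x =
        ∫ p, G (noisyMap b lam u p) ∂(μ.prod (stdGaussian (EuclideanSpace ℝ (Fin d)))) := by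
      intro u hu
      rw [← integral_stepDensity_mul hb hlam hu hGm]
      refine integral_congr_ae ?_
      filter_upwards [hrs u hu] with x hx
      rw [hx]
    change _ ≤ (∫ x, r t x * G x) - ∫ x, r s x * G x at h1
    rwa [e1 t ht, e1 s hs] at h1

/-- A function of quadratic growth integrates two densities of `𝒫` to nearby values when the
densities are close in weighted `L¹`. -/
lemma abs_integral_mul_sub_le {q q' f : EuclideanSpace ℝ (Fin d) → ℝ} (hq : q ∈ densities d)
    (hq' : q' ∈ densities d) (hf : Measurable f) {K : ℝ} (hK : ∀ x, |f x| ≤ K * (1 + ‖x‖ ^ 2)) :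
    |(∫ x, q x * f x) - ∫ x, q' x * f x| ≤ K * ∫ x, (1 + ‖x‖ ^ 2) * |q x - q' x| := by
  have h1 := integrable_mul_of_quadratic hq hf hK
  have h2 := integrable_mul_of_quadratic hq' hf hK
  have hi : Integrable fun x => (1 + ‖x‖ ^ 2) * |q x - q' x| := by
    have hd := (hq.2.2.1.sub hq'.2.2.1).abs.add
      (((hq.2.2.2.2.1).sub hq'.2.2.2.2.1).abs)
    refine hd.congr (ae_of_all _ fun x => ?_)
    simp only [Pi.add_apply, Pi.sub_apply]
    rw [← mul_sub, abs_mul, abs_of_nonneg (sq_nonneg ‖x‖)]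
    ring
  rw [← integral_sub h1 h2, ← integral_const_mul]
  refine abs_integral_le_integral_abs.trans
    (integral_mono (h1.sub h2).abs (hi.const_mul K) fun x => ?_)
  simp only
  rw [← sub_mul, abs_mul, ← mul_assoc, mul_comm]
  exact mul_le_mul_of_nonneg_right (hK x) (abs_nonneg _)

/-- The objective is upper semicontinuous from the right along the noisy gradient step, at positive
times. -/
lemma eventually_objective_le (hF : PotentialAssumption F dF lam) (hb : Measurable b)
    (hC0 : 0 ≤ C) (hC : ∀ y, ‖b y‖ ≤ C * (1 + ‖y‖)) (hμ : Integrable (fun y => ‖y‖ ^ 2) μ)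
    (hlam : 0 < lam) {r : ℝ → EuclideanSpace ℝ (Fin d) → ℝ}
    (hr : ∀ s, 0 < s → r s ∈ densities d)
    (hrs : ∀ s, 0 < s → r s =ᵐ[volume] stepDensity μ b lam s) {t : ℝ} (ht : 0 < t) {ε : ℝ}
    (hε : 0 < ε) : ∀ᶠ s in 𝓝[>] t, objective F lam (r s) ≤ objective F lam (r t) + ε := by
  obtain ⟨Cg, hCg⟩ := hF.growth
  obtain ⟨K, hK⟩ := exists_abs_log_stepDensity_le hb hC hμ hlam ht (t + 1)
  have hlim := (tendsto_integral_weight_abs_sub hb hC0 hC hμ hlam ht).const_mul (Cg + lam * K)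
  rw [mul_zero] at hlim
  have hlt : ∀ᶠ s in 𝓝[>] t, s < t + 1 := nhdsWithin_le_nhds (Iio_mem_nhds (by linarith))
  filter_upwards [hlim.eventually_lt_const hε, hlt, self_mem_nhdsWithin] with s hs hst hts
  have hts' : t < s := hts
  have hs0 : 0 < s := ht.trans hts'
  have h1 := objective_sub_le hF hlam (hr s hs0) (hr t ht) (measurable_stepDensity hb lam s)
    (stepDensity_pos hb hlam hs0) (hrs s hs0) (hK s hts'.le hst.le)
  have h2 := abs_integral_mul_sub_le (hr s hs0) (hr t ht)
    (f := fun x => dF (r s) x + lam * Real.log (stepDensity μ b lam s x))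
    ((hF.smooth _ (hr s hs0)).continuous.measurable.add
      ((measurable_stepDensity hb lam s).log.const_mul lam)) (K := Cg + lam * K) (fun x => by
      refine (abs_add_le _ _).trans ?_
      rw [abs_mul, abs_of_pos hlam]
      have := mul_le_mul_of_nonneg_left (hK s hts'.le hst.le x) hlam.le
      linarith [hCg (r s) (hr s hs0) x])
  have e : ∫ x, (1 + ‖x‖ ^ 2) * |r s x - r t x| =
      ∫ x, (1 + ‖x‖ ^ 2) * |stepDensity μ b lam s x - stepDensity μ b lam t x| := by
    refine integral_congr_ae ?_
    filter_upwards [hrs s hs0, hrs t ht] with x hx hx'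
    rw [hx, hx']
  rw [e] at h2
  linarith [le_abs_self ((∫ x, r s x * (dF (r s) x + lam * Real.log (stepDensity μ b lam s x))) -
    ∫ x, r t x * (dF (r s) x + lam * Real.log (stepDensity μ b lam s x)))]

/-- The objective is upper semicontinuous from the right along the noisy gradient step, at the
initial time. -/
lemma eventually_objective_le_zero (hF : PotentialAssumption F dF lam) (hb : Continuous b)
    (hC0 : 0 ≤ C) (hC : ∀ y, ‖b y‖ ≤ C * (1 + ‖y‖)) (hlam : 0 < lam)
    {q : EuclideanSpace ℝ (Fin d) → ℝ} (hq : q ∈ densities d)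
    {r : ℝ → EuclideanSpace ℝ (Fin d) → ℝ} (hr : ∀ s, 0 < s → r s ∈ densities d)
    (hrs : ∀ s, 0 < s → r s =ᵐ[volume] stepDensity (densityMeasure q) b lam s) {ε : ℝ}
    (hε : 0 < ε) : ∀ᶠ s in 𝓝[>] 0, objective F lam (r s) ≤ objective F lam q + ε := by
  obtain ⟨Cg, hCg⟩ := hF.growth
  obtain ⟨hqm, hq0, hqi, hq1, hq2, hqe⟩ := id hq
  have hlim := (tendsto_integral_weight_abs_sub_zero hb hC0 hC hlam hqm hq0 hqi hq2).const_mul Cg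
  rw [mul_zero] at hlim
  have hent := eventually_entropy_stepDensity_le hb.measurable hC0 hC hlam hqm hq0 hq1 hq2 hqe
    (ε := ε / (2 * lam)) (by positivity)
  filter_upwards [hlim.eventually_lt_const (half_pos hε), hent, self_mem_nhdsWithin]
    with s hs hse hs0
  replace hs0 : 0 < s := hs0
  have hdm : Measurable (dF (r s)) := (hF.smooth _ (hr s hs0)).continuous.measurable
  have hcv := hF.convex (r s) (hr s hs0) q hq
  have h2 := abs_integral_mul_sub_le (hr s hs0) hq hdm (hCg _ (hr s hs0))
  have e : ∫ x, (1 + ‖x‖ ^ 2) * |r s x - q x| =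
      ∫ x, (1 + ‖x‖ ^ 2) * |stepDensity (densityMeasure q) b lam s x - q x| := by
    refine integral_congr_ae ?_
    filter_upwards [hrs s hs0] with x hx
    rw [hx]
  have e' : ∫ x, r s x * Real.log (r s x) =
      ∫ x, stepDensity (densityMeasure q) b lam s x *
        Real.log (stepDensity (densityMeasure q) b lam s x) := by
    refine integral_congr_ae ?_
    filter_upwards [hrs s hs0] with x hx
    rw [hx]
  have e1 : ∫ x, dF (r s) x * (q x - r s x) =
      (∫ x, q x * dF (r s) x) - ∫ x, r s x * dF (r s) x := by
    rw [← integral_sub (integrable_mul_of_quadratic hq hdm (hCg _ (hr s hs0)))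
      (integrable_mul_of_quadratic (hr s hs0) hdm (hCg _ (hr s hs0)))]
    congr 1; ext x; ring
  rw [e] at h2
  rw [e1] at hcv
  have h3 := le_abs_self ((∫ x, r s x * dF (r s) x) - ∫ x, q x * dF (r s) x)
  have h4 := mul_le_mul_of_nonneg_left hse hlam.le
  have h5 : lam * ((∫ x, q x * Real.log (q x)) + ε / (2 * lam)) =
      lam * (∫ x, q x * Real.log (q x)) + ε / 2 := by field_simp
  rw [objective, objective, e']
  linarith

/-- One noisy gradient step contracts the gap of the objective above the level
`objective F lam q' + δ / (2 * α * lam)`. -/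
lemma objective_step_le (hF : PotentialAssumption F dF lam)
    (hgrad : ∀ q ∈ densities d, ∃ C : ℝ, ∀ x, ‖∇ (dF q) x‖ ≤ C * (1 + ‖x‖))
    {α δ η : ℝ} (hlam : 0 < lam) (hα : 0 < α) (hη : 0 < η)
    (hLSI : ∀ q ∈ densities d, LogSobolev (proximalGibbs dF lam q) α)
    {q q' : EuclideanSpace ℝ (Fin d) → ℝ} (hq : q ∈ densities d) (hq' : q' ∈ densities d)
    {r : ℝ → EuclideanSpace ℝ (Fin d) → ℝ} (hr0 : r 0 = q) (hr : ∀ s, 0 < s → r s ∈ densities d)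
    (hrs : ∀ s, 0 < s → r s =ᵐ[volume] stepDensity (densityMeasure q) (∇ (dF q)) lam s)
    (hδ : ∀ t, 0 < t → t ≤ η → ∫ p, ‖∇ (dF q) p.1 -
        ∇ (dF (r t)) (noisyMap (∇ (dF q)) lam t p)‖ ^ 2
        ∂((densityMeasure q).prod (stdGaussian (EuclideanSpace ℝ (Fin d)))) ≤ δ) :
    objective F lam (r η) - (objective F lam q' + δ / (2 * α * lam)) ≤
      Real.exp (-(α * lam * η)) *
        (objective F lam q - (objective F lam q' + δ / (2 * α * lam))) := by
  obtain ⟨C, hC⟩ := hgrad q hq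
  have hC0 : 0 ≤ C := by simpa using (norm_nonneg _).trans (hC 0)
  obtain ⟨hqm, hq0, -, hq1, hq2, -⟩ := id hq
  have := isProbabilityMeasure_densityMeasure hq0 hq1
  have hμ : Integrable (fun y => ‖y‖ ^ 2) (densityMeasure q) := by
    rw [integrable_densityMeasure_iff hqm hq0]
    simpa only [mul_comm] using hq2
  have hb : Continuous (∇ (dF q)) := continuous_gradient (hF.smooth q hq)
  have h := gronwall_of_left_increment (f := fun t => objective F lam (r t)) (a := α * lam)
    (c := objective F lam q' + δ / (2 * α * lam)) hη ?_ ?_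
  · simpa only [hr0] using h
  · intro t ht htη
    obtain ⟨Cf, hCf⟩ := hgrad (r t) (hr t ht)
    exact exists_left_increment_bound hF hb.measurable hC0 hC hμ hlam hα hr hrs ht
      (hLSI _ (hr t ht)) hCf (hδ t ht htη) hq'
  · intro t ht htη ε hε
    rcases ht.eq_or_lt with h0 | h0
    · rw [← h0]
      simp only [hr0]
      exact eventually_objective_le_zero hF hb hC0 hC hlam hq hr hrs hε
    · exact eventually_objective_le hF hb.measurable hC0 hC hμ hlam hr hrs h0 hε

end Descent

/-! ### Random vectors -/

section RandomVectors

variable {d : ℕ} {F : (EuclideanSpace ℝ (Fin d) → ℝ) → ℝ}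
  {dF : (EuclideanSpace ℝ (Fin d) → ℝ) → EuclideanSpace ℝ (Fin d) → ℝ} {lam : ℝ}
  {Ω : Type*} [MeasurableSpace Ω] {P : Measure Ω} [IsProbabilityMeasure P]
  {X ξ : Ω → EuclideanSpace ℝ (Fin d)}

lemma measurable_density : Measurable (density P X) := (measurable_pdf X P volume).ennreal_toReal

lemma density_nonneg (x : EuclideanSpace ℝ (Fin d)) : 0 ≤ density P X x := ENNReal.toReal_nonneg

lemma density_congr {Y : Ω → EuclideanSpace ℝ (Fin d)} (h : X =ᵐ[P] Y) :
    density P X = density P Y := by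
  ext x
  rw [density, density, pdf.congr h]

lemma map_eq_densityMeasure_density [HasPDF X P volume] :
    P.map X = densityMeasure (density P X) := by
  rw [map_eq_withDensity_pdf X P volume, densityMeasure]
  refine withDensity_congr_ae ?_
  have hlt : ∀ᵐ x, pdf X P volume x < ⊤ := pdf.ae_lt_top
  filter_upwards [hlt] with x hx
  rw [density, ENNReal.ofReal_toReal hx.ne]

lemma hasPDF_of_map_eq_densityMeasure (hX : AEMeasurable X P)
    {q : EuclideanSpace ℝ (Fin d) → ℝ} (hq : Measurable q)
    (h : P.map X = densityMeasure q) : HasPDF X P volume :=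
  hasPDF_of_map_eq_withDensity hX _ hq.ennreal_ofReal.aemeasurable h

lemma density_ae_eq_of_map_eq_densityMeasure {q : EuclideanSpace ℝ (Fin d) → ℝ}
    (hq : Measurable q) (hq0 : ∀ x, 0 ≤ q x) (h : P.map X = densityMeasure q) :
    density P X =ᵐ[volume] q := by
  filter_upwards [Measure.rnDeriv_withDensity volume hq.ennreal_ofReal] with x hx
  rw [density, pdf_def, h, densityMeasure, hx, ENNReal.toReal_ofReal (hq0 x)]

lemma noisyStep_eq (t : ℝ) : noisyStep P dF lam t X ξ =
    fun w => noisyMap (∇ (dF (density P X))) lam t (X w, ξ w) := rfl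

lemma noisyStep_zero : noisyStep P dF lam 0 X ξ = X := by
  ext1 w
  simp [noisyStep]

lemma map_prodMk_eq [HasPDF X P volume]
    (hξ : HasLaw ξ (stdGaussian (EuclideanSpace ℝ (Fin d))) P) (hind : IndepFun X ξ P) :
    P.map (fun w => (X w, ξ w)) =
      (densityMeasure (density P X)).prod (stdGaussian (EuclideanSpace ℝ (Fin d))) := by
  rw [(indepFun_iff_map_prod_eq_prod_map_map (HasPDF.aemeasurable X P volume)
    hξ.aemeasurable).1 hind, map_eq_densityMeasure_density, hξ.map_eq]

lemma aemeasurable_noisyStep [HasPDF X P volume]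
    (hξ : HasLaw ξ (stdGaussian (EuclideanSpace ℝ (Fin d))) P)
    (hb : Measurable (∇ (dF (density P X)))) (t : ℝ) :
    AEMeasurable (noisyStep P dF lam t X ξ) P :=
  (measurable_noisyMap hb lam t).comp_aemeasurable
    ((HasPDF.aemeasurable X P volume).prodMk hξ.aemeasurable)

lemma map_noisyStep [HasPDF X P volume]
    (hξ : HasLaw ξ (stdGaussian (EuclideanSpace ℝ (Fin d))) P) (hind : IndepFun X ξ P)
    (hb : Measurable (∇ (dF (density P X)))) (hq : density P X ∈ densities d) (hlam : 0 < lam)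
    {t : ℝ} (ht : 0 < t) : P.map (noisyStep P dF lam t X ξ) =
      densityMeasure
        (stepDensity (densityMeasure (density P X)) (∇ (dF (density P X))) lam t) := by
  have := isFiniteMeasure_densityMeasure hq.2.2.1
  rw [densityMeasure]
  refine Eq.trans ?_ (map_add_sqrt_smul (measurable_driftMap hb t) (by positivity))
  rw [← map_prodMk_eq hξ hind, noisyStep_eq]
  exact (AEMeasurable.map_map_of_aemeasurable (measurable_noisyMap hb lam t).aemeasurable
    ((HasPDF.aemeasurable X P volume).prodMk hξ.aemeasurable)).symm

lemma discretizationError_eq [HasPDF X P volume]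
    (hξ : HasLaw ξ (stdGaussian (EuclideanSpace ℝ (Fin d))) P) (hind : IndepFun X ξ P)
    (hb : Measurable (∇ (dF (density P X)))) {t : ℝ}
    (hb' : Measurable (∇ (dF (density P (noisyStep P dF lam t X ξ))))) :
    discretizationError P dF lam t X ξ =
      ∫ p, ‖∇ (dF (density P X)) p.1 - ∇ (dF (density P (noisyStep P dF lam t X ξ)))
        (noisyMap (∇ (dF (density P X))) lam t p)‖ ^ 2
        ∂((densityMeasure (density P X)).prod (stdGaussian (EuclideanSpace ℝ (Fin d)))) := by
  rw [← map_prodMk_eq hξ hind, integral_map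
    ((HasPDF.aemeasurable X P volume).prodMk hξ.aemeasurable)]
  · rfl
  · exact (((hb.comp measurable_fst).sub
      (hb'.comp (measurable_noisyMap hb lam t))).norm.pow_const 2).aestronglyMeasurable

/-- One noisy gradient step from a random vector with density in `𝒫` leads to a random vector with
density in `𝒫`, and contracts the gap of the objective up to the discretization error. -/
lemma noisyStep_contraction (hF : PotentialAssumption F dF lam)
    (hgrad : ∀ q ∈ densities d, ∃ C : ℝ, ∀ x, ‖∇ (dF q) x‖ ≤ C * (1 + ‖x‖))
    {α δ η : ℝ} (hlam : 0 < lam) (hα : 0 < α) (hη : 0 < η)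
    (hLSI : ∀ q ∈ densities d, LogSobolev (proximalGibbs dF lam q) α)
    {q' : EuclideanSpace ℝ (Fin d) → ℝ} (hq' : q' ∈ densities d) [HasPDF X P volume]
    (hq : density P X ∈ densities d)
    (hξ : HasLaw ξ (stdGaussian (EuclideanSpace ℝ (Fin d))) P) (hind : IndepFun X ξ P)
    (hδ : ∀ t, 0 < t → t ≤ η → discretizationError P dF lam t X ξ ≤ δ) :
    HasPDF (noisyStep P dF lam η X ξ) P volume ∧
      density P (noisyStep P dF lam η X ξ) ∈ densities d ∧
      objective F lam (density P (noisyStep P dF lam η X ξ)) -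
          (objective F lam q' + δ / (2 * α * lam)) ≤
        Real.exp (-(α * lam * η)) *
          (objective F lam (density P X) - (objective F lam q' + δ / (2 * α * lam))) := by
  have hb : Measurable (∇ (dF (density P X))) :=
    (continuous_gradient (hF.smooth _ hq)).measurable
  obtain ⟨C, hC⟩ := hgrad _ hq
  have := isProbabilityMeasure_densityMeasure hq.2.1 hq.2.2.2.1
  have hμ : Integrable (fun y => ‖y‖ ^ 2) (densityMeasure (density P X)) := by
    rw [integrable_densityMeasure_iff hq.1 hq.2.1]
    simpa only [mul_comm] using hq.2.2.2.2.1
  have hmap := fun (t : ℝ) (ht : 0 < t) => map_noisyStep hξ hind hb hq hlam ht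
  have hrs : ∀ t, 0 < t → density P (noisyStep P dF lam t X ξ) =ᵐ[volume]
      stepDensity (densityMeasure (density P X)) (∇ (dF (density P X))) lam t := fun t ht =>
    density_ae_eq_of_map_eq_densityMeasure (measurable_stepDensity hb lam t)
      (stepDensity_nonneg hlam ht) (hmap t ht)
  have hr : ∀ t, 0 < t → density P (noisyStep P dF lam t X ξ) ∈ densities d := fun t ht =>
    mem_densities_of_ae_eq_stepDensity hb hC hμ hlam ht measurable_density density_nonneg
      (hrs t ht)
  refine ⟨hasPDF_of_map_eq_densityMeasure (aemeasurable_noisyStep hξ hb η)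
    (measurable_stepDensity hb lam η) (hmap η hη), hr η hη, ?_⟩
  refine objective_step_le hF hgrad hlam hα hη hLSI hq hq'
    (r := fun t => density P (noisyStep P dF lam t X ξ)) (by rw [noisyStep_zero]) hr hrs
    fun t ht htη => ?_
  rw [← discretizationError_eq hξ hind hb
    (continuous_gradient (hF.smooth _ (hr t ht))).measurable]
  exact hδ t ht htη

end RandomVectors

end MeanFieldLangevin

theorem theorem2 {d : ℕ}
    (F : (EuclideanSpace ℝ (Fin d) → ℝ) → ℝ)
    (dF : (EuclideanSpace ℝ (Fin d) → ℝ) → EuclideanSpace ℝ (Fin d) → ℝ)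
    (lam α η δη : ℝ) (hlam : 0 < lam) (hα : 0 < α) (hη : 0 < η)
    -- the functional `F` and the uniform log-Sobolev inequality
    (hF : MeanFieldLangevin.PotentialAssumption F dF lam)
    (hgrad : ∀ q ∈ MeanFieldLangevin.densities d,
      ∃ C : ℝ, ∀ x, ‖∇ (dF q) x‖ ≤ C * (1 + ‖x‖))
    (hLSI : ∀ q ∈ MeanFieldLangevin.densities d,
      MeanFieldLangevin.LogSobolev (MeanFieldLangevin.proximalGibbs dF lam q) α)
    -- an optimal solution
    (qstar : EuclideanSpace ℝ (Fin d) → ℝ) (hqstar : qstar ∈ MeanFieldLangevin.densities d)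
    (hmin : ∀ q ∈ MeanFieldLangevin.densities d,
      MeanFieldLangevin.objective F lam qstar ≤ MeanFieldLangevin.objective F lam q)
    -- the iterates of noisy gradient descent
    {Ω : Type*} [MeasurableSpace Ω] (P : Measure Ω) [IsProbabilityMeasure P]
    (θ ξ : ℕ → Ω → EuclideanSpace ℝ (Fin d))
    (hθ0 : HasPDF (θ 0) P volume)
    (hq0 : MeanFieldLangevin.density P (θ 0) ∈ MeanFieldLangevin.densities d)
    (hξ : ∀ k, HasLaw (ξ k) (stdGaussian (EuclideanSpace ℝ (Fin d))) P)
    (hindep : ∀ k, IndepFun (θ k) (ξ k) P)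
    (hstep : ∀ k, ∀ᵐ w ∂P,
      θ (k + 1) w = MeanFieldLangevin.noisyStep P dF lam η (θ k) (ξ k) w)
    -- the bound on the one-step discretization error
    (hδ : ∀ k t, 0 < t → t ≤ η →
      MeanFieldLangevin.discretizationError P dF lam t (θ k) (ξ k) ≤ δη) :
    ∀ k : ℕ,
      MeanFieldLangevin.density P (θ k) ∈ MeanFieldLangevin.densities d ∧
      MeanFieldLangevin.objective F lam (MeanFieldLangevin.density P (θ k))
          - MeanFieldLangevin.objective F lam qstar
        ≤ δη / (2 * α * lam)
          + Real.exp (-(α * lam * η * k))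
            * (MeanFieldLangevin.objective F lam (MeanFieldLangevin.density P (θ 0))
              - MeanFieldLangevin.objective F lam qstar) := by
  -- the error bound is non-negative, as it bounds an expectation of squares
  have hδ0 : 0 ≤ δη :=
    (integral_nonneg fun w => sq_nonneg _).trans (hδ 0 η hη le_rfl)
  have key : ∀ k : ℕ, HasPDF (θ k) P volume ∧
      MeanFieldLangevin.density P (θ k) ∈ MeanFieldLangevin.densities d ∧
      MeanFieldLangevin.objective F lam (MeanFieldLangevin.density P (θ k))
          - (MeanFieldLangevin.objective F lam qstar + δη / (2 * α * lam))
        ≤ Real.exp (-(α * lam * η * k))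
          * (MeanFieldLangevin.objective F lam (MeanFieldLangevin.density P (θ 0))
            - (MeanFieldLangevin.objective F lam qstar + δη / (2 * α * lam))) := by
    intro k
    induction k with
    | zero => exact ⟨hθ0, hq0, by simp⟩
    | succ k ih =>
      obtain ⟨hpdf, hmem, hle⟩ := ih
      obtain ⟨hpdf', hmem', hle'⟩ := MeanFieldLangevin.noisyStep_contraction hF hgrad hlam hα hη
        hLSI hqstar hmem (hξ k) (hindep k) (hδ k)
      have hae : MeanFieldLangevin.noisyStep P dF lam η (θ k) (ξ k) =ᵐ[P] θ (k + 1) :=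
        (hstep k).mono fun w hw => hw.symm
      rw [MeanFieldLangevin.density_congr hae] at hmem' hle'
      refine ⟨HasPDF.congr hae, hmem', hle'.trans ?_⟩
      refine (mul_le_mul_of_nonneg_left hle (Real.exp_pos _).le).trans_eq ?_
      rw [← mul_assoc, ← Real.exp_add]
      congr 2
      push_cast
      ring
  intro k
  obtain ⟨-, hmem, hle⟩ := key k
  refine ⟨hmem, ?_⟩
  have hc : 0 ≤ Real.exp (-(α * lam * η * k)) * (δη / (2 * α * lam)) := by positivity
  linarith
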